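/- Fix $\alpha\in(0,\pi)$ and $N\ge 1$, and write $\mathbb R^2_+=\mathbb R\times(0,\infty)$. **Setting.** Let $A_N$ be the set of $a=(a_1,\dots,a_N)$ with $-1<a_1<\dots<a_N<1$, and let $\rho(a)=\frac12\min\{2a_1+2,\,a_2-a_1,\dots,a_N-a_{N-1},\,2-2a_N\}$. For $d\in\{\pm1\}^N$ let $M(a,d)$ be the set of $m=(m_1,m_2)\in W^{1,2}((-1,1);\mathbb S^1)$ (continuous representatives on $[-1,1]$) with $m_1(\pm1)=\cos\alpha$ and $m_1(a_n)=d_n$ for all $n$. Let $\dot W^{1,2}(\mathbb R^2)$ be the completion of $C_0^\infty(\mathbb R^2)$ in the norm $\|\nabla\zeta\|_{L^2}$ (functions modulo constants), and $\dot W^{1,2}(\mathbb R^2_+)$ the space of restrictions to $\mathbb R^2_+$. For $m\in M(a,d)$ let $U(m)\in\dot W^{1,2}(\mathbb R^2_+)$ be the unique harmonic function in $\mathbb R^2_+$ with $U(m)(x)\to0$ as $|x|\to\infty$ and $$\int_{\mathbb R^2_+}\nabla U(m)\cdot\nabla\zeta\,dx=\int_{-1}^1m_1'\,\zeta(\cdot,0)\,dx_1\qquad\text{for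 all }\zeta\in C_0^\infty(\mathbb R^2).$$ For $\epsilon\in(0,\frac12]$ put $\delta=\epsilon\log\frac1\epsilon$ and $$E_\epsilon(m)=\frac\epsilon2\int_{-1}^1|m'|^2\,dx_1+\frac12\int_{\mathbb R^2_+}|\nabla U(m)|^2\,dx.$$ Let $\Omega_r(a)=\mathbb R^2_+\setminus\bigcup_{n=1}^NB_r(a_n,0)$. **The limiting potential.** Identify $\mathbb R^2$ with $\mathbb C$. The map $F(w)=-1/\cosh w$ is a conformal bijection from $\{w:\operatorname{Re}w>0,\ 0<\operatorname{Im}w<\pi\}$ onto $\mathbb R^2_+$; set $u(z)=\frac\pi2-\operatorname{Im}F^{-1}(z)$, $u_b(z)=u\!\left(\frac{z-b}{1-bz}\right)$ for $b\in(-1,1)$, and $$u^*_{a,d}=\sum_{n=1}^N(d_n-\cos\alpha)\,u_{a_n}.$$ **Theorem.** For every $R\in(0,\frac12]$ and $C_0>0$ there is a constant $C_1>0$ (depending only on $\alpha,N,R,C_0$) such that the following holds. Let $a\in A_N$ with $\rho(a)\ge R$, let $d\in\{\pm1\}^N$ and $\Gamma=\sum_{n=1}^N(d_n-\cos\alpha)^2$.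 Let $\epsilon\in(0,\frac12]$ with $\delta\le R$, and let $m\in M(a,d)$ satisfy $$E_\epsilon(m)\le\frac{\pi\Gamma}{2\log\frac1\delta}+\frac{C_0}{(\log\frac1\delta)^2}.$$ Then $$\int_{\Omega_\delta(a)}\left|\nabla U(m)-\frac{\nabla u^*_{a,d}}{\log\frac1\delta}\right|^2dx\le\frac{C_1}{(\log\frac1\delta)^2} \qquad\text{and}\qquad \int_{\Omega_\delta(a)}|\nabla U(m)|^2\,dx\ge\frac{\pi\Gamma}{\log\frac1\delta}-\frac{C_1}{(\log\frac1\delta)^2}.$$ -/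

import Mathlib

open MeasureTheory Filter Topology
open scoped ContDiff

namespace NeelWall

/-- The Euclidean plane. -/
abbrev Plane : Type := EuclideanSpace ℝ (Fin 2)

/-- The open upper half-plane `ℝ × (0, ∞)`. -/
def halfPlane : Set Plane := {x | 0 < x 1}

/-- `C₀^∞(ℝ²)`. -/
def IsTestFunction (ζ : Plane → ℝ) : Prop := ContDiff ℝ ∞ ζ ∧ HasCompactSupport ζ

/-- `G` is the weak gradient of `v` on the whole plane. -/
def IsWeakGradient (v : Plane → ℝ) (G : Plane → Plane) : Prop :=
  LocallyIntegrable v volume ∧ LocallyIntegrable G volume ∧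
    ∀ φ : Plane → ℝ, IsTestFunction φ → ∀ i : Fin 2,
      ∫ x, v x * gradient φ x i = - ∫ x, G x i * φ x

/-- `v` represents an element of the homogeneous space `Ẇ^{1,2}(ℝ²)`, the completion of
`C₀^∞(ℝ²)` with respect to `‖∇ζ‖_{L²}`: its weak gradient is square integrable and is the
`L²`-limit of gradients of test functions. -/
def MemHomSobolevPlane (v : Plane → ℝ) : Prop :=
  ∃ G : Plane → Plane, IsWeakGradient v G ∧ MemLp G 2 volume ∧
    ∃ φ : ℕ → Plane → ℝ, (∀ k, IsTestFunction (φ k)) ∧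
      Tendsto (fun k => eLpNorm (fun x => G x - gradient (φ k) x) 2 volume) atTop (𝓝 0)

/-- `Ẇ^{1,2}(ℝ²₊)`: restrictions to the half-plane of elements of `Ẇ^{1,2}(ℝ²)`. -/
def MemHomSobolevHalfPlane (u : Plane → ℝ) : Prop :=
  ∃ v : Plane → ℝ, MemHomSobolevPlane v ∧ Set.EqOn u v halfPlane

/-- `f ∈ W^{1,2}(-1, 1)`, for the representative that is continuous on `[-1, 1]`: `f` is
absolutely continuous there and its derivative is square integrable. -/
def MemSobolevInterval (f : ℝ → ℝ) : Prop :=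
  AbsolutelyContinuousOnInterval f (-1) 1 ∧
    MemLp (deriv f) 2 (volume.restrict (Set.Ioo (-1) 1))

/-- `u` is the stray field potential of a magnetisation with first component `m₁` (which is
continued by a constant outside `(-1, 1)`, so that its derivative vanishes there): the harmonic
function in `Ẇ^{1,2}(ℝ²₊)` with `∫ ∇u · ∇ζ = ∫ m₁' ζ(·, 0)` for every test function `ζ` and with
`u(x) → 0` as `|x| → ∞`. Only the values of `u` in the half-plane matter. -/
structure IsStrayPotential (m₁ : ℝ → ℝ) (u : Plane → ℝ) : Prop where
  harmonic : InnerProductSpace.HarmonicOnNhd u halfPlane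
  mem : MemHomSobolevHalfPlane u
  weak_eq : ∀ ζ : Plane → ℝ, IsTestFunction ζ →
    ∫ x in halfPlane, inner ℝ (gradient u x) (gradient ζ x) =
      ∫ t in Set.Ioo (-1 : ℝ) 1, deriv m₁ t * ζ !₂[t, 0]
  tendsto_zero : Tendsto u (cocompact Plane ⊓ 𝓟 halfPlane) (𝓝 0)

/-- The stray field potential `U(m)`. -/
noncomputable def strayPotential (m : ℝ → Plane) : Plane → ℝ :=
  Classical.epsilon (IsStrayPotential (fun t => m t 0))

/-- The energy
`E_ε(m) = ε/2 ∫_{-1}^1 |m'|² dx₁ + 1/2 ∫_{ℝ²₊} |∇U(m)|² dx`. -/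
noncomputable def energy (ε : ℝ) (m : ℝ → Plane) : ℝ :=
  ε / 2 * (∫ t in Set.Ioo (-1 : ℝ) 1, ∑ i : Fin 2, (deriv (fun s => m s i) t) ^ 2) +
    1 / 2 * ∫ x in halfPlane, ‖gradient (strayPotential m) x‖ ^ 2

/-- `A_N`: admissible wall positions `-1 < a₁ < ⋯ < a_N < 1`. -/
def IsWallPositions {N : ℕ} (a : Fin N → ℝ) : Prop :=
  StrictMono a ∧ ∀ n, a n ∈ Set.Ioo (-1 : ℝ) 1

/-- `d ∈ {±1}^N`. -/
def IsWallSigns {N : ℕ} (d : Fin N → ℝ) : Prop := ∀ n, d n = 1 ∨ d n = -1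

/-- `ρ(a) = 1/2 min {2a₁ + 2, a₂ - a₁, …, a_N - a_{N-1}, 2 - 2a_N}`. -/
noncomputable def wallDistance {N : ℕ} (a : Fin N → ℝ) : ℝ :=
  1 / 2 * sInf
    ({r | ∃ n : Fin N, (n : ℕ) = 0 ∧ r = 2 * a n + 2} ∪
      {r | ∃ k n : Fin N, (n : ℕ) = k + 1 ∧ r = a n - a k} ∪
      {r | ∃ n : Fin N, (n : ℕ) + 1 = N ∧ r = 2 - 2 * a n})

/-- `M(a, d)`: the maps `m ∈ W^{1,2}((-1, 1); 𝕊¹)` with `m₁(±1) = cos α` and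
`m₁(a_n) = d_n` for all `n`. -/
structure IsMagnetisation (α : ℝ) {N : ℕ} (a d : Fin N → ℝ) (m : ℝ → Plane) : Prop where
  sobolev : ∀ i : Fin 2, MemSobolevInterval (fun t => m t i)
  norm_eq_one : ∀ t ∈ Set.Icc (-1 : ℝ) 1, ‖m t‖ = 1
  left_boundary : m (-1) 0 = Real.cos α
  right_boundary : m 1 0 = Real.cos α
  wall : ∀ n, m (a n) 0 = d n

/-- `Ω_r(a)`: the half-plane without the balls of radius `r` around the walls. -/
def perforatedHalfPlane {N : ℕ} (a : Fin N → ℝ) (r : ℝ) : Set Plane :=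
  halfPlane \ ⋃ n, Metric.ball (!₂[a n, 0] : Plane) r

/-- The half-strip `S = {w | Re w > 0, 0 < Im w < π}`. -/
def halfStrip : Set ℂ := {w | 0 < w.re ∧ 0 < w.im ∧ w.im < Real.pi}

/-- The conformal map `F(w) = -1 / cosh w` from the half-strip onto the upper half-plane. -/
noncomputable def stripMap (w : ℂ) : ℂ := -1 / Complex.cosh w

/-- The harmonic function `u(z) = π/2 - Im F⁻¹(z)` in the upper half-plane, with boundary values
`π/2` on `(-1, 0)`, `-π/2` on `(0, 1)` and vanishing normal derivative on the rest of the line. -/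
noncomputable def basicTail (z : ℂ) : ℝ :=
  Real.pi / 2 - (Function.invFunOn stripMap halfStrip z).im

/-- The Möbius transform `Φ_b(z) = (z + b) / (1 + b z)`. -/
noncomputable def moebius (b : ℝ) (z : ℂ) : ℂ := (z + b) / (1 + b * z)

/-- `u*_{a,d} = ∑ γ_n u_{a_n}`, where `γ_n = d_n - cos α` and `u_b = u ∘ Φ_{-b}`. -/
noncomputable def limitPotential (α : ℝ) {N : ℕ} (a d : Fin N → ℝ) (x : Plane) : ℝ :=
  ∑ n, (d n - Real.cos α) * basicTail (moebius (-(a n)) (⟨x 0, x 1⟩ : ℂ))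

/-- `δ = ε log (1/ε)`, the length scale of the core of a wall. -/
noncomputable def coreWidth (ε : ℝ) : ℝ := ε * Real.log (1 / ε)

/-- `Γ = ∑ (d_n - cos α)²`. -/
noncomputable def wallStrength (α : ℝ) {N : ℕ} (d : Fin N → ℝ) : ℝ :=
  ∑ n, (d n - Real.cos α) ^ 2

end NeelWall

/-! Write f = m₁', V = ∇U(m), L = log(1/δ), l = 1/L, γ_n = d_n - cos α, Z = ∫|m'|² and X = εZ. The
proof compares V with l∇ζ, where the single test function ζ = `tailSum` is the combination Σ γ_n ζ_n
of the tails u_{a_n}, each shifted by a constant so as to vanish at infinity and cut off at a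
distance comparable to δ/N from its own wall. Everything follows from expanding the square D = ∫|V -
l∇ζ|² = ∫|V|² - 2l ∫V·∇ζ + l² ∫|∇ζ|².

Work of the charge (`IsMagnetisation.abs_integral_mul_tailSum_sub_le`). The weak equation gives
∫V·∇ζ = ∫fζ. On (-1,1) the tail u_b equals π/2 to the left of b and -π/2 to the right, so
integrating f against it yields π(m₁(b) - cos α) exactly; summation gives πΓ. The cutoff changes
this only within distance r of a wall. There |m₁'|² = m₂²|m'|² and m₂ vanishes at the wall, so the
charge in that interval is at most 2rZ. With r a small multiple of δ = ε log(1/ε) and log(1/ε) ≤ 2L,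
the error is at most XL/4; after multiplication by 2l it is half of the exchange term X that the
energy supplies.

Energy of the test function (`exists_bound_integral_tailSum`). The tail u_b is, up to an affine
change, the imaginary part of a conformal map onto the half-strip of width π. By conformal
invariance its Dirichlet integral outside the cutoff is an area of a rectangle, π log(1/δ) + O(1).
Products of gradients for different walls are bounded by integrable kernels, uniformly in the
cutoff. Hence ∫|∇ζ|² ≤ πΓL + C'. The same area computation shows that ∫|∇ζ|² is O(1) on the δ-balls
(`exists_bound_core_tailSum`).

Conclusion (`exists_bound_strayField`). The assumed bound reads X + ∫|V|² ≤ πΓl + 2C₀l². In the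
expansion of D the leading terms πΓl - 2πΓl + πΓl cancel, and D + X/2 ≤ (2C₀ + C')l² remains. Away
from the δ-balls ∇ζ = ∇u*, which is the first claim. Reading the same expansion with D ≥ 0 bounds
∫|V|² from below, and on the balls ∫|V|² ≤ 2D + 2l²∫|∇ζ|² = O(l²); this is the second claim.

The rest justifies the weak equation for ζ, which is neither smooth up to the boundary nor compactly
supported. The single layer potential -(1/π)∫f(t) log|z - t| dt is shown to satisfy all conditions
on U(m), and the gradient of a stray potential is shown to be unique. For this explicit field the
weak equation extends to all functions in `IsAdmissible` by Fubini and the formula ∫∇log|z - t|·∇ζ =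
-πζ(t), which is the fundamental theorem of calculus along rays from t. -/

namespace NeelWall

/-! ### Transfer between ℂ and the Euclidean plane -/

section
/-- The isometric identification of `ℂ` with the plane. -/
noncomputable def toPlane : ℂ ≃ₗᵢ[ℝ] Plane := Complex.orthonormalBasisOneI.repr

lemma toPlane_apply (z : ℂ) : toPlane z = !₂[z.re, z.im] := by
  ext i
  have := Complex.orthonormalBasisOneI_repr_apply z
  fin_cases i <;> simp [toPlane, this]

@[simp] lemma toPlane_zero (z : ℂ) : toPlane z 0 = z.re := by simp [toPlane_apply]
@[simp] lemma toPlane_one (z : ℂ) : toPlane z 1 = z.im := by simp [toPlane_apply]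

lemma toPlane_ofReal (t : ℝ) : toPlane (t : ℂ) = !₂[t, 0] := by simp [toPlane_apply]

/-- The open upper half-plane as a set of complex numbers. -/
def upperHalf : Set ℂ := {z | 0 < z.im}

lemma isOpen_upperHalf : IsOpen upperHalf := isOpen_lt continuous_const Complex.continuous_im

lemma measurableSet_upperHalf : MeasurableSet upperHalf := isOpen_upperHalf.measurableSet

lemma isOpen_halfPlane : IsOpen halfPlane :=
  isOpen_lt continuous_const (by fun_prop)

lemma toPlane_mem_halfPlane {z : ℂ} : toPlane z ∈ halfPlane ↔ z ∈ upperHalf := by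
  simp [halfPlane, upperHalf]

lemma preimage_halfPlane : toPlane ⁻¹' halfPlane = upperHalf := by
  ext z; exact toPlane_mem_halfPlane

lemma measurePreserving_toPlane : MeasurePreserving toPlane volume volume :=
  toPlane.measurePreserving

lemma measurableEmbedding_toPlane : MeasurableEmbedding toPlane :=
  toPlane.toHomeomorph.measurableEmbedding

lemma setIntegral_toPlane {E : Type*} [NormedAddCommGroup E] [NormedSpace ℝ E]
    (g : Plane → E) (s : Set Plane) :
    ∫ x in s, g x = ∫ z in toPlane ⁻¹' s, g (toPlane z) :=
  (measurePreserving_toPlane.setIntegral_preimage_emb measurableEmbedding_toPlane g s).symm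

lemma integral_toPlane {E : Type*} [NormedAddCommGroup E] [NormedSpace ℝ E] (g : Plane → E) :
    ∫ x, g x = ∫ z, g (toPlane z) :=
  (measurePreserving_toPlane.integral_comp measurableEmbedding_toPlane g).symm

lemma integrableOn_toPlane {E : Type*} [NormedAddCommGroup E] {g : Plane → E} {s : Set Plane} :
    IntegrableOn g s ↔ IntegrableOn (fun z => g (toPlane z)) (toPlane ⁻¹' s) :=
  (measurePreserving_toPlane.integrableOn_comp_preimage measurableEmbedding_toPlane).symm

lemma gradient_toPlane (g : Plane → ℝ) (z : ℂ) :
    gradient g (toPlane z) = toPlane (gradient (fun w => g (toPlane w)) z) := by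
  refine ext_inner_right ℝ fun y => ?_
  obtain ⟨y, rfl⟩ := toPlane.surjective y
  rw [LinearIsometryEquiv.inner_map_map, inner_gradient_left, inner_gradient_left]
  have := toPlane.toContinuousLinearEquiv.comp_right_fderiv (f := g) (x := z)
  have h2 := congrArg (fun T => T y) this
  simpa [Function.comp_def] using h2.symm

lemma gradient_comp_symm (g : ℂ → ℝ) (x : Plane) :
    gradient (fun x => g (toPlane.symm x)) x = toPlane (gradient g (toPlane.symm x)) := by
  obtain ⟨z, rfl⟩ := toPlane.surjective x
  rw [gradient_toPlane]; simp

lemma inner_gradient_toPlane (g h : Plane → ℝ) (z : ℂ) :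
    inner ℝ (gradient g (toPlane z)) (gradient h (toPlane z)) =
      inner ℝ (gradient (fun w => g (toPlane w)) z) (gradient (fun w => h (toPlane w)) z) := by
  rw [gradient_toPlane, gradient_toPlane, LinearIsometryEquiv.inner_map_map]

/-- The gradient of the real part of a holomorphic function. -/
lemma hasGradientAt_re {h : ℂ → ℂ} {h' z : ℂ} (hh : HasDerivAt h h' z) :
    HasGradientAt (fun w => (h w).re) ((starRingEnd ℂ) h') z := by
  rw [hasGradientAt_iff_hasFDerivAt]
  have h1 := Complex.reCLM.hasFDerivAt.comp z (hh.hasFDerivAt.restrictScalars ℝ)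
  refine h1.congr_fderiv (ContinuousLinearMap.ext fun v => ?_)
  simp [Complex.inner, mul_comm]

/-- The Laplacian may be computed in any orthonormal basis, in particular in the image under the
isometry of the basis of ℂ. -/
lemma harmonicAt_comp_toPlane_symm {g : ℂ → ℝ} {z : ℂ}
    (hg : InnerProductSpace.HarmonicAt g z) :
    InnerProductSpace.HarmonicAt (fun x => g (toPlane.symm x)) (toPlane z) := by
  have key : ∀ w : ℂ, ContDiffAt ℝ 2 g w →
      Laplacian.laplacian (fun x => g (toPlane.symm x)) (toPlane w) = Laplacian.laplacian g w := by
    intro w hw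
    rw [InnerProductSpace.laplacian_eq_iteratedFDeriv_orthonormalBasis _
        (Complex.orthonormalBasisOneI.map toPlane),
      InnerProductSpace.laplacian_eq_iteratedFDeriv_orthonormalBasis g
        Complex.orthonormalBasisOneI]
    refine Finset.sum_congr rfl fun i _ => ?_
    have := toPlane.symm.toContinuousLinearEquiv.iteratedFDerivWithin_comp_right g
      uniqueDiffOn_univ (x := toPlane w) (Set.mem_univ _) 2
    simp only [Set.preimage_univ, iteratedFDerivWithin_univ] at this
    have e : (fun x => g (toPlane.symm x)) = g ∘ toPlane.symm.toContinuousLinearEquiv := rfl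
    rw [e, this]
    rw [ContinuousMultilinearMap.compContinuousLinearMap_apply]
    simp only [OrthonormalBasis.map_apply]
    congr 1
    · simp
    · ext j; fin_cases j <;> simp
  obtain ⟨h1, h2⟩ := hg
  refine ⟨?_, ?_⟩
  · have : ContDiffAt ℝ 2 g (toPlane.symm (toPlane z)) := by simpa using h1
    exact this.comp (toPlane z) toPlane.symm.contDiff.contDiffAt
  · have h3 := h1.eventually (by simp)
    have h4 : Tendsto toPlane.symm (𝓝 (toPlane z)) (𝓝 z) := by
      have := toPlane.symm.continuous.tendsto (toPlane z)
      simpa using this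
    filter_upwards [h4.eventually h2, h4.eventually h3] with x hx hx3
    obtain ⟨w, rfl⟩ := toPlane.surjective x
    simp only [LinearIsometryEquiv.symm_apply_apply] at hx hx3
    rw [key w hx3, hx]; rfl

lemma IsTestFunction.comp_toPlane {ζ : Plane → ℝ} (h : IsTestFunction ζ) :
    ContDiff ℝ ∞ (fun z => ζ (toPlane z)) ∧ HasCompactSupport (fun z => ζ (toPlane z)) :=
  ⟨h.1.comp toPlane.contDiff, h.2.comp_homeomorph toPlane.toHomeomorph⟩

lemma isTestFunction_comp_symm {ζ : ℂ → ℝ} (h : ContDiff ℝ ∞ ζ) (h' : HasCompactSupport ζ) :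
    IsTestFunction (fun x => ζ (toPlane.symm x)) :=
  ⟨h.comp toPlane.symm.contDiff, h'.comp_homeomorph toPlane.symm.toHomeomorph⟩

end

/-! ### Integrable kernels on the plane -/

section
-- The quadratic polynomial s ↦ ∫(a + sb)² is nonnegative, so its discriminant is at most zero.
lemma sq_integral_mul_le {X : Type*} [MeasurableSpace X] {μ : Measure X} {a b : X → ℝ}
    (ha : MemLp a 2 μ) (hb : MemLp b 2 μ) :
    (∫ x, a x * b x ∂μ) ^ 2 ≤ (∫ x, a x ^ 2 ∂μ) * ∫ x, b x ^ 2 ∂μ := by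
  have hab : Integrable (fun x => a x * b x) μ := ha.integrable_mul hb
  have ha2 := ha.integrable_sq
  have hb2 := hb.integrable_sq
  have key : ∀ s : ℝ, 0 ≤ (∫ x, b x ^ 2 ∂μ) * (s * s) + (2 * ∫ x, a x * b x ∂μ) * s +
      ∫ x, a x ^ 2 ∂μ := by
    intro s
    have : ∫ x, (a x + s * b x) ^ 2 ∂μ = (∫ x, b x ^ 2 ∂μ) * (s * s) +
        (2 * ∫ x, a x * b x ∂μ) * s + ∫ x, a x ^ 2 ∂μ := by
      have e : ∀ x, (a x + s * b x) ^ 2 = (s * s) * b x ^ 2 + (2 * s) * (a x * b x) + a x ^ 2 :=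
        fun x => by ring
      simp_rw [e]
      have i12 : Integrable (fun x => (s * s) * b x ^ 2 + (2 * s) * (a x * b x)) μ :=
        (hb2.const_mul _).add (hab.const_mul _)
      rw [integral_add i12 ha2, integral_add (hb2.const_mul _) (hab.const_mul _), integral_const_mul, integral_const_mul]
      ring
    rw [← this]
    exact integral_nonneg fun x => sq_nonneg _
  have := discrim_le_zero key
  rw [discrim] at this
  nlinarith

/-- The integrable kernel `|z|^{-3/2} (1 + |z|)^{-1}` on the plane. -/
noncomputable def kernelW (z : ℂ) : ℝ := 1 / (‖z‖ * √‖z‖ * (1 + ‖z‖))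

lemma kernelW_nonneg (z : ℂ) : 0 ≤ kernelW z := by unfold kernelW; positivity

lemma measurable_kernelW : Measurable kernelW := by unfold kernelW; fun_prop

/-- In polar coordinates the radial integrand is at most y^(-1/2) on (0,1] and y^(-3/2) beyond 1. -/
lemma integrable_kernelW : Integrable kernelW := by
  have h := integrable_fun_norm_addHaar (volume : Measure ℂ)
    (f := fun y : ℝ => 1 / (y * √y * (1 + y)))
  refine h.2 ?_
  rw [Complex.finrank_real_complex, ← Set.Ioc_union_Ioi_eq_Ioi (zero_le_one' ℝ)]
  have hm : Measurable (fun y : ℝ => y ^ (2 - 1) • (1 / (y * √y * (1 + y)))) := by fun_prop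
  refine IntegrableOn.union ?_ ?_
  · have h1 : IntegrableOn (fun y : ℝ => y ^ (-(1 / 2) : ℝ)) (Set.Ioc 0 1) := by
      have := intervalIntegral.intervalIntegrable_rpow' (a := 0) (b := 1)
        (r := -(1 / 2)) (by norm_num)
      exact (intervalIntegrable_iff_integrableOn_Ioc_of_le zero_le_one).1 this
    refine h1.mono' hm.aestronglyMeasurable ?_
    filter_upwards [ae_restrict_mem measurableSet_Ioc] with y hy
    have hy0 : 0 < y := hy.1
    have hs : 0 < √y := Real.sqrt_pos.2 hy0
    rw [Real.rpow_neg hy0.le, ← Real.sqrt_eq_rpow, Real.norm_of_nonneg (by positivity)]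
    simp only [smul_eq_mul, pow_one, Nat.add_one_sub_one]
    rw [show y * (1 / (y * √y * (1 + y))) = (√y)⁻¹ * (1 / (1 + y)) by field_simp]
    exact mul_le_of_le_one_right (by positivity) ((div_le_one (by linarith)).2 (by linarith))
  · have h1 : IntegrableOn (fun y : ℝ => y ^ (-(3 / 2) : ℝ)) (Set.Ioi 1) :=
      integrableOn_Ioi_rpow_of_lt (by norm_num) one_pos
    refine h1.mono' hm.aestronglyMeasurable ?_
    filter_upwards [ae_restrict_mem measurableSet_Ioi] with y hy
    have hy0 : 0 < y := lt_trans one_pos hy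
    have hs : 0 < √y := Real.sqrt_pos.2 hy0
    have e : y ^ (-(3 / 2) : ℝ) = (y * √y)⁻¹ := by
      rw [Real.rpow_neg hy0.le, show (3 / 2 : ℝ) = 1 + 1 / 2 by norm_num, Real.rpow_add hy0,
        Real.rpow_one, ← Real.sqrt_eq_rpow]
    rw [e, Real.norm_of_nonneg (by positivity)]
    simp only [smul_eq_mul, pow_one, Nat.add_one_sub_one]
    rw [show y * (1 / (y * √y * (1 + y))) = (y * √y)⁻¹ * (y / (1 + y)) by field_simp]
    exact mul_le_of_le_one_right (by positivity) ((div_le_one (by linarith)).2 (by linarith))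

lemma integrable_kernelW_sub (p : ℂ) : Integrable (fun z => kernelW (z - p)) :=
  integrable_kernelW.comp_sub_right p

lemma integral_kernelW_sub (p : ℂ) : ∫ z, kernelW (z - p) = ∫ z, kernelW z :=
  integral_sub_right_eq_self _ p

/-- The kernel `∫_{-1}^1 |x - t|^{-1/2} dt` is bounded. -/
lemma exists_bound_integral_inv_sqrt : ∃ C : ℝ, 0 < C ∧ ∀ x : ℝ,
    IntegrableOn (fun t => 1 / √|x - t|) (Set.Ioo (-1) 1) ∧
    ∫ t in Set.Ioo (-1 : ℝ) 1, 1 / √|x - t| ≤ C := by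
  set k : ℝ → ℝ := (Set.Ioc (-1 : ℝ) 1).indicator (fun s => 1 / √|s|) with hk
  have hki : Integrable k := by
    rw [hk, integrable_indicator_iff measurableSet_Ioc]
    have h1 : IntervalIntegrable (fun y : ℝ => y ^ (-(1 / 2) : ℝ)) volume 0 1 :=
      intervalIntegral.intervalIntegrable_rpow' (by norm_num)
    have h2 : IntervalIntegrable (fun y : ℝ => 1 / √|y|) volume 0 1 := by
      refine h1.congr fun y hy => ?_
      rw [Set.uIoc_of_le zero_le_one] at hy
      rw [Real.rpow_neg hy.1.le, ← Real.sqrt_eq_rpow, abs_of_pos hy.1, one_div]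
    have h3 : IntervalIntegrable (fun y : ℝ => 1 / √|y|) volume (-1) 0 := by
      have := (IntervalIntegrable.iff_comp_neg (f := fun y : ℝ => 1 / √|y|)
        (a := 0) (b := 1)).1 h2
      simpa using this.symm
    exact (intervalIntegrable_iff_integrableOn_Ioc_of_le (by norm_num)).1 (h3.trans h2)
  have hk0 : ∀ s, 0 ≤ k s := fun s => Set.indicator_nonneg (fun _ _ => by positivity) s
  have hkx : ∀ x : ℝ, Integrable (fun t => k (x - t)) := fun x => hki.comp_sub_left x
  -- The singular part is a translate of one fixed integrable function, so its integral does not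
  -- depend on x.
  have hle : ∀ x t : ℝ, 1 / √|x - t| ≤ 1 + k (x - t) := by
    intro x t
    by_cases h : x - t ∈ Set.Ioc (-1 : ℝ) 1
    · rw [hk, Set.indicator_of_mem h]; linarith
    · have h1 : 1 ≤ |x - t| := by
        by_contra hc
        push Not at hc
        rw [abs_lt] at hc
        exact h ⟨hc.1, hc.2.le⟩
      have : 1 / √|x - t| ≤ 1 := (div_le_one (by positivity)).2 (Real.one_le_sqrt.2 h1)
      linarith [hk0 (x - t)]
  have hint : ∀ x : ℝ, IntegrableOn (fun t => 1 / √|x - t|) (Set.Ioo (-1) 1) := by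
    intro x
    have hg : IntegrableOn (fun t => 1 + k (x - t)) (Set.Ioo (-1) 1) :=
      Integrable.add (integrable_const _) (hkx x).integrableOn
    have hm : Measurable (fun t => 1 / √|x - t|) := by fun_prop
    refine hg.mono' hm.aestronglyMeasurable (Eventually.of_forall fun t => ?_)
    rw [Real.norm_of_nonneg (by positivity)]
    exact hle x t
  refine ⟨2 + ∫ s, k s, by
    have := integral_nonneg (μ := volume) (f := k) hk0
    positivity, fun x => ⟨hint x, ?_⟩⟩
  calc ∫ t in Set.Ioo (-1 : ℝ) 1, 1 / √|x - t|
      ≤ ∫ t in Set.Ioo (-1 : ℝ) 1, (1 + k (x - t)) :=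
        integral_mono (hint x)
          (Integrable.add (integrable_const _) (hkx x).integrableOn) (fun t => hle x t)
    _ = 2 + ∫ t in Set.Ioo (-1 : ℝ) 1, k (x - t) := by
        rw [integral_add (integrable_const _) (hkx x).integrableOn]
        simp; norm_num
    _ ≤ 2 + ∫ t, k (x - t) := by
        have := setIntegral_le_integral (s := Set.Ioo (-1 : ℝ) 1) (hkx x)
          (Eventually.of_forall fun t => hk0 _)
        linarith
    _ = 2 + ∫ s, k s := by rw [integral_sub_left_eq_self k volume x]

/-- Replacing both A and B by the smaller one only increases the quotient. If either vanishes, the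
left side is zero by the convention for division by zero. -/
lemma one_div_mul_sqrt_le {A B : ℝ} (hA : 0 ≤ A) (hB : 0 ≤ B) :
    1 / (A * √B) ≤ 1 / (A * √A) + 1 / (B * √B) := by
  rcases hA.eq_or_lt with rfl | hA
  · simp; positivity
  rcases hB.eq_or_lt with rfl | hB
  · simp; positivity
  have h1 : 0 ≤ 1 / (A * √A) := by positivity
  have h2 : 0 ≤ 1 / (B * √B) := by positivity
  rcases le_total A B with h | h
  · have : 1 / (A * √B) ≤ 1 / (A * √A) := by gcongr
    linarith
  · have : 1 / (A * √B) ≤ 1 / (B * √B) := by gcongr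
    linarith

/-- The weight that dominates gradients of admissible test functions. -/
noncomputable def gradWeight (z : ℂ) : ℝ := 1 / (√(‖z - 1‖ * ‖z + 1‖) * (1 + ‖z‖))

lemma gradWeight_nonneg (z : ℂ) : 0 ≤ gradWeight z := by unfold gradWeight; positivity

/-- To be used with S = 1 + |z|, A = |z - t|, B the distance to the nearer end point and D the
distance to the farther one; only A and B can be small, and `one_div_mul_sqrt_le` separates their
singularities. -/
lemma kernelW_aux {S A B D : ℝ} (hS : 1 ≤ S) (hA : 0 ≤ A) (hB : 0 ≤ B) (hA2 : 1 + A ≤ 2 * S)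
    (hB2 : 1 + B ≤ 2 * S) (hD : S / 2 ≤ D) :
    1 / (A * (√(B * D) * S)) ≤ 4 * (1 / (A * √A * (1 + A)) + 1 / (B * √B * (1 + B))) := by
  have h1 := one_div_mul_sqrt_le hA hB
  have hD0 : 0 < D := by linarith
  have h2 : 1 / 2 ≤ √D := by
    apply Real.le_sqrt_of_sq_le; linarith
  have e : 1 / (A * (√(B * D) * S)) = 1 / (A * √B) * (1 / (√D * S)) := by
    rw [Real.sqrt_mul hB]; field_simp
  have h3 : 1 / (√D * S) ≤ 2 / S := by
    rw [div_le_div_iff₀ (by positivity) (by positivity)]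
    nlinarith
  have hSA : 2 / S ≤ 4 / (1 + A) := by
    rw [div_le_div_iff₀ (by positivity) (by positivity)]; linarith
  have hSB : 2 / S ≤ 4 / (1 + B) := by
    rw [div_le_div_iff₀ (by positivity) (by positivity)]; linarith
  rw [e]
  calc 1 / (A * √B) * (1 / (√D * S)) ≤ (1 / (A * √A) + 1 / (B * √B)) * (2 / S) := by gcongr
    _ = 1 / (A * √A) * (2 / S) + 1 / (B * √B) * (2 / S) := by ring
    _ ≤ 1 / (A * √A) * (4 / (1 + A)) + 1 / (B * √B) * (4 / (1 + B)) := by gcongr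
    _ = _ := by rw [mul_comm (A * √A), mul_comm (B * √B)]; field_simp

lemma one_add_norm_sub_le (z p : ℂ) (hp : ‖p‖ ≤ 1) : 1 + ‖z - p‖ ≤ 2 * (1 + ‖z‖) := by
  have := norm_sub_le z p
  linarith [norm_nonneg z]

/-- This dominates ∇log|z - t|·∇ζ by translates of one integrable kernel, so that the integral is
bounded uniformly in t. The farther of the points ±1 is at distance at least (1 + |z|)/2 from z. -/
lemma gradWeight_div_le (z t : ℂ) (ht : ‖t‖ ≤ 1) :
    1 / ‖z - t‖ * gradWeight z ≤
      4 * (kernelW (z - t) + (kernelW (z - 1) + kernelW (z - (-1)))) := by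
  have hS : 1 ≤ 1 + ‖z‖ := by linarith [norm_nonneg z]
  have hA := one_add_norm_sub_le z t ht
  have hB := one_add_norm_sub_le z 1 (by simp)
  have hD := one_add_norm_sub_le z (-1) (by simp)
  have hBD : 1 + ‖z‖ ≤ ‖z - 1‖ + ‖z - (-1)‖ := by
    have h1 : ‖(2 : ℂ) * z‖ ≤ ‖z - 1‖ + ‖z - (-1)‖ := by
      rw [show (2 : ℂ) * z = (z - 1) + (z - (-1)) by ring]; exact norm_add_le _ _
    have h2 : ‖(2 : ℂ)‖ ≤ ‖z - (-1)‖ + ‖z - 1‖ := by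
      rw [show (2 : ℂ) = (z - (-1)) - (z - 1) by ring]; exact norm_sub_le _ _
    rw [norm_mul] at h1
    simp only [Complex.norm_ofNat] at h1 h2
    linarith
  have e1 : 1 / ‖z - t‖ * gradWeight z =
      1 / (‖z - t‖ * (√(‖z - 1‖ * ‖z - (-1)‖) * (1 + ‖z‖))) := by
    unfold gradWeight; rw [sub_neg_eq_add]; field_simp
  rw [e1]
  have w1 := kernelW_nonneg (z - 1)
  have w2 := kernelW_nonneg (z - (-1))
  rcases le_total ‖z - 1‖ ‖z - (-1)‖ with h | h
  · have := kernelW_aux hS (norm_nonneg (z - t)) (norm_nonneg (z - 1)) hA hB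
      (D := ‖z - (-1)‖) (by linarith)
    unfold kernelW at *
    linarith
  · have := kernelW_aux hS (norm_nonneg (z - t)) (norm_nonneg (z - (-1))) hA hD
      (D := ‖z - 1‖) (by linarith)
    rw [mul_comm ‖z - (-1)‖ ‖z - 1‖] at this
    unfold kernelW at *
    linarith

/-- Here A is the one distance that may be small, and q₁, q₂, q₃ are comparable to S = 1 + |z|. The
factor S⁻³ absorbs the weight √A(1 + A) ≤ 4S² ≤ 4S³. -/
lemma cross_aux {S c A q₁ q₂ q₃ : ℝ} (hS : 1 ≤ S) (hc : 0 < c) (hA : 0 ≤ A) (hA2 : 1 + A ≤ 2 * S)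
    (h₁ : S ≤ c * q₁) (h₂ : S ≤ c * q₂) (h₃ : S ≤ c * q₃) :
    1 / (A * (q₁ * q₂ * q₃)) ≤ 4 * c ^ 3 * (1 / (A * √A * (1 + A))) := by
  rcases hA.eq_or_lt with rfl | hA
  · simp
  have hq : S ^ 3 ≤ c ^ 3 * (q₁ * q₂ * q₃) := by
    have h12 : S * S ≤ (c * q₁) * (c * q₂) := by gcongr; linarith
    have : S * S * S ≤ (c * q₁) * (c * q₂) * (c * q₃) := by
      gcongr
      have : 0 ≤ S * S := by positivity
      linarith
    nlinarith
  have hq0 : 0 < q₁ * q₂ * q₃ := by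
    have : 0 < c ^ 3 * (q₁ * q₂ * q₃) := lt_of_lt_of_le (by positivity) hq
    exact pos_of_mul_pos_right this (by positivity)
  have hs : √A ≤ 2 * S := by
    rw [Real.sqrt_le_left (by linarith)]; nlinarith
  rw [mul_one_div, div_le_div_iff₀ (by positivity) (by positivity), one_mul]
  calc A * √A * (1 + A) ≤ A * (2 * S) * (2 * S) := by gcongr
    _ = 4 * A * S ^ 2 * 1 := by ring
    _ ≤ 4 * A * S ^ 2 * S := by gcongr
    _ = 4 * A * S ^ 3 := by ring
    _ ≤ 4 * A * (c ^ 3 * (q₁ * q₂ * q₃)) := by gcongr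
    _ = _ := by ring

lemma norm_le_of_far {z p : ℂ} {R : ℝ} (hR : 0 < R) (hR1 : R ≤ 1) (hp : ‖p‖ ≤ 1)
    (h : R / 2 ≤ ‖z - p‖) : 1 + ‖z‖ ≤ 5 / R * ‖z - p‖ := by
  have h1 : ‖z‖ ≤ ‖z - p‖ + ‖p‖ := by simpa using norm_add_le (z - p) p
  have h2 : 2 ≤ 4 / R * ‖z - p‖ := by
    rw [div_mul_eq_mul_div, le_div_iff₀ hR]; linarith
  have h3 : ‖z - p‖ ≤ 1 / R * ‖z - p‖ :=
    le_mul_of_one_le_left (norm_nonneg _) ((one_le_div hR).2 hR1)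
  have : 5 / R * ‖z - p‖ = 4 / R * ‖z - p‖ + 1 / R * ‖z - p‖ := by ring
  linarith

lemma far_of_near {z p q : ℂ} {R : ℝ} (hpq : R ≤ ‖p - q‖) (h : ‖z - p‖ < R / 2) :
    R / 2 ≤ ‖z - q‖ := by
  have : ‖p - q‖ ≤ ‖z - q‖ + ‖z - p‖ := by
    rw [show p - q = (z - q) - (z - p) by ring]; exact norm_sub_le _ _
  linarith

/-- The product of four inverse distances to separated points is dominated by kernels. -/
lemma cross_kernel_le {R : ℝ} (hR : 0 < R) (hR1 : R ≤ 1) {p q r s : ℂ} (hp : ‖p‖ ≤ 1)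
    (hq : ‖q‖ ≤ 1) (hr : ‖r‖ ≤ 1) (hs : ‖s‖ ≤ 1) (hpq : R ≤ ‖p - q‖) (hpr : R ≤ ‖p - r‖)
    (hps : R ≤ ‖p - s‖) (hqr : R ≤ ‖q - r‖) (hqs : R ≤ ‖q - s‖) (hrs : R ≤ ‖r - s‖) (z : ℂ) :
    1 / (‖z - p‖ * ‖z - q‖ * (‖z - r‖ * ‖z - s‖)) ≤
      4 * (5 / R) ^ 3 * (kernelW (z - p) + kernelW (z - q) + kernelW (z - r) + kernelW (z - s)) := by
  have hS : 1 ≤ 1 + ‖z‖ := by linarith [norm_nonneg z]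
  have hc : 0 < 5 / R := by positivity
  have n1 := kernelW_nonneg (z - p)
  have n2 := kernelW_nonneg (z - q)
  have n3 := kernelW_nonneg (z - r)
  have n4 := kernelW_nonneg (z - s)
  have hC : 0 ≤ 4 * (5 / R) ^ 3 := by positivity
  by_cases c1 : ‖z - p‖ < R / 2
  · have := cross_aux hS hc (norm_nonneg (z - p)) (one_add_norm_sub_le z p hp)
      (norm_le_of_far hR hR1 hq (far_of_near hpq c1))
      (norm_le_of_far hR hR1 hr (far_of_near hpr c1))
      (norm_le_of_far hR hR1 hs (far_of_near hps c1))
    rw [← kernelW] at this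
    calc _ = _ := by ring
      _ ≤ _ := this
      _ ≤ _ := mul_le_mul_of_nonneg_left (by linarith) hC
  by_cases c2 : ‖z - q‖ < R / 2
  · have := cross_aux hS hc (norm_nonneg (z - q)) (one_add_norm_sub_le z q hq)
      (norm_le_of_far hR hR1 hp (not_lt.1 c1))
      (norm_le_of_far hR hR1 hr (far_of_near hqr c2))
      (norm_le_of_far hR hR1 hs (far_of_near hqs c2))
    rw [← kernelW] at this
    calc _ = _ := by ring
      _ ≤ _ := this
      _ ≤ _ := mul_le_mul_of_nonneg_left (by linarith) hC
  by_cases c3 : ‖z - r‖ < R / 2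
  · have := cross_aux hS hc (norm_nonneg (z - r)) (one_add_norm_sub_le z r hr)
      (norm_le_of_far hR hR1 hp (not_lt.1 c1))
      (norm_le_of_far hR hR1 hq (not_lt.1 c2))
      (norm_le_of_far hR hR1 hs (far_of_near hrs c3))
    rw [← kernelW] at this
    calc _ = _ := by ring
      _ ≤ _ := this
      _ ≤ _ := mul_le_mul_of_nonneg_left (by linarith) hC
  have := cross_aux hS hc (norm_nonneg (z - s)) (one_add_norm_sub_le z s hs)
      (norm_le_of_far hR hR1 hp (not_lt.1 c1))
      (norm_le_of_far hR hR1 hq (not_lt.1 c2))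
      (norm_le_of_far hR hR1 hr (not_lt.1 c3))
  rw [← kernelW] at this
  calc _ = _ := by ring
      _ ≤ _ := this
      _ ≤ _ := mul_le_mul_of_nonneg_left (by linarith) hC

end

/-! ### The weak equation for the single layer field and admissible test functions -/

section
/-- Functions on the half-plane against which the stray field may be tested: their gradient is
dominated by `gradWeight`, they have the boundary values `ζ₀` on `(-1, 1)`, and they vanish at
infinity. -/
structure IsAdmissible (M : ℝ) (ζ : ℂ → ℝ) (ζ₀ : ℝ → ℝ) : Prop where
  differentiableAt : ∀ z ∈ upperHalf, DifferentiableAt ℝ ζ z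
  bound : ∀ z ∈ upperHalf, ‖gradient ζ z‖ ≤ M * gradWeight z
  trace : ∀ᵐ t : ℝ ∂(volume.restrict (Set.Ioo (-1 : ℝ) 1)),
    Tendsto ζ (𝓝[upperHalf] (t : ℂ)) (𝓝 (ζ₀ t))
  tendsto : Tendsto ζ (cocompact ℂ ⊓ 𝓟 upperHalf) (𝓝 0)

lemma measurable_gradient {E : Type*} [NormedAddCommGroup E] [InnerProductSpace ℝ E]
    [CompleteSpace E] [MeasurableSpace E] [BorelSpace E] (ζ : E → ℝ) :
    Measurable (gradient ζ) :=
  (InnerProductSpace.toDual ℝ E).symm.continuous.measurable.comp (measurable_fderiv ℝ ζ)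

/-- The gradient of `log |z - t|`. -/
noncomputable def logKernel (z t : ℂ) : ℂ := (starRingEnd ℂ) (z - t)⁻¹

lemma norm_logKernel (z t : ℂ) : ‖logKernel z t‖ = 1 / ‖z - t‖ := by
  rw [logKernel, RCLike.norm_conj, norm_inv, one_div]

lemma measurable_logKernel : Measurable (fun p : ℂ × ℝ => logKernel p.1 (p.2 : ℂ)) := by
  unfold logKernel
  exact Complex.continuous_conj.measurable.comp (by fun_prop)

lemma norm_inner_logKernel_le {M : ℝ} {ζ : ℂ → ℝ} {z t : ℂ} (hM : 0 ≤ M) (ht : ‖t‖ ≤ 1)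
    (h : ‖gradient ζ z‖ ≤ M * gradWeight z) :
    ‖inner ℝ (logKernel z t) (gradient ζ z)‖ ≤
      4 * M * (kernelW (z - t) + (kernelW (z - 1) + kernelW (z - (-1)))) := by
  calc ‖inner ℝ (logKernel z t) (gradient ζ z)‖ ≤ ‖logKernel z t‖ * ‖gradient ζ z‖ :=
        norm_inner_le_norm _ _
    _ ≤ 1 / ‖z - t‖ * (M * gradWeight z) := by 
        rw [norm_logKernel]; exact mul_le_mul_of_nonneg_left h (by positivity)
    _ = M * (1 / ‖z - t‖ * gradWeight z) := by ring
    _ ≤ M * (4 * (kernelW (z - t) + (kernelW (z - 1) + kernelW (z - (-1))))) := by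
        exact mul_le_mul_of_nonneg_left (gradWeight_div_le z t ht) hM
    _ = _ := by ring

lemma integrable_three_kernels (t : ℂ) : Integrable (fun z : ℂ =>
    kernelW (z - t) + (kernelW (z - 1) + kernelW (z - (-1)))) :=
  (integrable_kernelW_sub t).add ((integrable_kernelW_sub 1).add (integrable_kernelW_sub (-1)))

lemma integrableOn_inner_logKernel {M : ℝ} {ζ : ℂ → ℝ} {t : ℂ} (hM : 0 ≤ M) (ht : ‖t‖ ≤ 1)
    (h : ∀ z ∈ upperHalf, ‖gradient ζ z‖ ≤ M * gradWeight z) :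
    IntegrableOn (fun z => inner ℝ (logKernel z t) (gradient ζ z)) upperHalf := by
  refine Integrable.mono' ((integrable_three_kernels t).const_mul (4 * M)).integrableOn
    (Measurable.aestronglyMeasurable ?_) ?_
  · refine Measurable.inner ?_ (measurable_gradient ζ)
    unfold logKernel
    exact Complex.continuous_conj.measurable.comp (by fun_prop)
  · filter_upwards [ae_restrict_mem measurableSet_upperHalf] with z hz
    exact norm_inner_logKernel_le hM ht (h z hz)

/-- Integrability in polar coordinates is what allows the angle and the radius to be integrated in
either order. -/
lemma integrableOn_polarCoord {g : ℂ → ℝ} (hg : Integrable g) :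
    IntegrableOn (fun p : ℝ × ℝ => p.1 • g (Complex.polarCoord.symm p)) polarCoord.target := by
  have hop := polarCoord.open_target.measurableSet
  have hm : Measurable (fun p : ℝ × ℝ => Complex.polarCoord.symm p) := by
    simp_rw [Complex.polarCoord_symm_apply]; fun_prop
  have hmeas : AEStronglyMeasurable (fun p : ℝ × ℝ => p.1 • g (Complex.polarCoord.symm p))
      (volume.restrict polarCoord.target) := by
    -- Since g is only almost everywhere measurable, preimages of null sets must be null; this
    -- follows from the change of variables applied to indicators, the Jacobian being positive on
    -- the target.
    have hpre : Measure.QuasiMeasurePreserving (fun p : ℝ × ℝ => Complex.polarCoord.symm p)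
        (volume.restrict polarCoord.target) volume := by
      refine ⟨hm, Measure.AbsolutelyContinuous.mk fun s hs h0 => ?_⟩
      rw [Measure.map_apply hm hs]
      have := Complex.lintegral_comp_polarCoord_symm (s.indicator 1)
      rw [lintegral_indicator_one hs, h0, lintegral_eq_zero_iff (by
        simp only [smul_eq_mul]
        exact (ENNReal.measurable_ofReal.comp measurable_fst).mul
          ((measurable_one.indicator hs).comp hm))] at this
      rw [← compl_compl ((fun p : ℝ × ℝ => Complex.polarCoord.symm p) ⁻¹' s)]
      change ∀ᵐ p ∂(volume.restrict polarCoord.target),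
        p ∈ ((fun p : ℝ × ℝ => Complex.polarCoord.symm p) ⁻¹' s)ᶜ
      filter_upwards [this, ae_restrict_mem hop] with p hp hpt
      intro hps
      have h1 : 0 < p.1 := by
        rw [polarCoord_target] at hpt; exact hpt.1
      have hps' : (Complex.polarCoord.symm p) ∈ s := hps
      rw [Set.indicator_of_mem hps'] at hp
      simp [h1.not_ge] at hp
    exact (by fun_prop : AEStronglyMeasurable (fun p : ℝ × ℝ => p.1) _).smul
      (hg.1.comp_quasiMeasurePreserving hpre)
  refine ⟨hmeas, ?_⟩
  rw [hasFiniteIntegral_iff_enorm]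
  have h2 := Complex.lintegral_comp_polarCoord_symm (fun z => ‖g z‖ₑ)
  have h3 := hg.2
  rw [hasFiniteIntegral_iff_enorm, ← h2] at h3
  refine lt_of_le_of_lt (le_of_eq (setLIntegral_congr_fun hop fun p hp => ?_)) h3
  have h1 : 0 < p.1 := by rw [polarCoord_target] at hp; exact hp.1
  rw [enorm_smul, Real.enorm_of_nonneg h1.le, smul_eq_mul]

/-- Integration along a ray from the boundary point `t`. -/
lemma integral_ray {M : ℝ} {ζ : ℂ → ℝ} {ζ₀ : ℝ → ℝ} (h : IsAdmissible M ζ ζ₀) {t θ : ℝ}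
    (htr : Tendsto ζ (𝓝[upperHalf] (t : ℂ)) (𝓝 (ζ₀ t))) (hθ : θ ∈ Set.Ioo 0 Real.pi)
    (hint : IntegrableOn (fun ρ : ℝ => inner ℝ (Complex.exp (θ * Complex.I))
      (gradient ζ (t + ρ * Complex.exp (θ * Complex.I)))) (Set.Ioi 0)) :
    ∫ ρ in Set.Ioi (0 : ℝ), inner ℝ (Complex.exp (θ * Complex.I))
      (gradient ζ (t + ρ * Complex.exp (θ * Complex.I))) = - ζ₀ t := by
  set e : ℂ := Complex.exp (θ * Complex.I) with he
  have hen : ‖e‖ = 1 := Complex.norm_exp_ofReal_mul_I θ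
  have heim : 0 < e.im := by
    rw [he, Complex.exp_ofReal_mul_I_im]; exact Real.sin_pos_of_mem_Ioo hθ
  have hmem : ∀ ρ : ℝ, 0 < ρ → (t : ℂ) + ρ * e ∈ upperHalf := by
    intro ρ hρ
    simp only [upperHalf, Set.mem_ofPred_eq, Complex.add_im, Complex.ofReal_im, Complex.mul_im,
      Complex.ofReal_re, zero_add, zero_mul, add_zero]
    positivity
  -- At the starting point the value is replaced by the boundary trace, because ζ is controlled only
  -- inside the half-plane.
  set F : ℝ → ℝ := Function.update (fun ρ : ℝ => ζ (t + ρ * e)) 0 (ζ₀ t) with hF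
  have hcont : ContinuousWithinAt F (Set.Ici 0) 0 := by
    rw [← continuousWithinAt_sdiff_self, Set.Ici_sdiff_left, ContinuousWithinAt, hF,
      Function.update_self]
    have h1 : Tendsto (fun ρ : ℝ => (t : ℂ) + ρ * e) (𝓝[>] 0) (𝓝[upperHalf] (t : ℂ)) := by
      refine tendsto_nhdsWithin_iff.2 ⟨?_, ?_⟩
      · have : Continuous (fun ρ : ℝ => (t : ℂ) + ρ * e) := by fun_prop
        have := (this.tendsto 0).mono_left (nhdsWithin_le_nhds (s := Set.Ioi 0))
        simpa using this
      · filter_upwards [self_mem_nhdsWithin] with ρ hρ using hmem ρ hρ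
    refine (htr.comp h1).congr' ?_
    filter_upwards [self_mem_nhdsWithin] with ρ hρ
    rw [Function.update_of_ne (ne_of_gt hρ)]; rfl
  have hderiv : ∀ ρ ∈ Set.Ioi (0 : ℝ), HasDerivAt F (inner ℝ e (gradient ζ (t + ρ * e))) ρ := by
    intro ρ hρ
    have h1 : HasDerivAt (fun ρ : ℝ => (t : ℂ) + ρ * e) e ρ := by
      have := ((Complex.ofRealCLM.hasDerivAt (x := ρ)).mul_const e).const_add (t : ℂ)
      simpa using this
    have h2 := ((h.differentiableAt _ (hmem ρ hρ)).hasFDerivAt).comp_hasDerivAt ρ h1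
    rw [← inner_gradient_left, real_inner_comm] at h2
    refine h2.congr_of_eventuallyEq ?_
    filter_upwards [isOpen_ne.mem_nhds (ne_of_gt hρ)] with x hx
    rw [hF, Function.update_of_ne hx]; rfl
  have hlim : Tendsto F atTop (𝓝 0) := by
    have h1 : Tendsto (fun ρ : ℝ => (t : ℂ) + ρ * e) atTop (cocompact ℂ ⊓ 𝓟 upperHalf) := by
      refine tendsto_inf.2 ⟨?_, tendsto_principal.2 ?_⟩
      · rw [← Metric.cobounded_eq_cocompact, ← tendsto_norm_atTop_iff_cobounded]
        refine tendsto_atTop_mono (f := fun ρ : ℝ => ρ - |t|) (fun ρ => ?_)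
          (tendsto_atTop_add_const_right _ _ tendsto_id)
        have := norm_sub_le ((t : ℂ) + ρ * e) t
        rw [add_sub_cancel_left, norm_mul, hen, mul_one, Complex.norm_real, Complex.norm_real] at this
        have := le_abs_self ρ
        simp only [Real.norm_eq_abs] at *
        linarith
      · filter_upwards [eventually_gt_atTop 0] with ρ hρ using hmem ρ hρ
    refine (h.tendsto.comp h1).congr' ?_
    filter_upwards [eventually_gt_atTop 0] with ρ hρ
    rw [hF, Function.update_of_ne hρ.ne']; rfl
  rw [integral_Ioi_of_hasDerivAt_of_tendsto hcont hderiv hint hlim]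
  simp [hF]

/-- The polar Jacobian ρ cancels the modulus 1/ρ of ∇log|z - t|, leaving the radial unit vector and
hence a radial derivative. -/
lemma inner_logKernel_polar {t θ ρ : ℝ} (hρ : 0 < ρ) (v : ℂ) :
    ρ * inner ℝ (logKernel (t + ρ * Complex.exp (θ * Complex.I)) t) v =
      inner ℝ (Complex.exp (θ * Complex.I)) v := by
  have : ρ • logKernel (t + ρ * Complex.exp (θ * Complex.I)) t = Complex.exp (θ * Complex.I) := by
    have h0 : (ρ : ℂ) ≠ 0 := by exact_mod_cast hρ.ne'
    rw [logKernel, add_sub_cancel_left, mul_inv, map_mul, ← Complex.exp_neg, ← Complex.exp_conj]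
    simp only [map_inv₀, Complex.conj_ofReal, map_neg, map_mul, Complex.conj_I, Complex.real_smul]
    rw [← mul_assoc, mul_inv_cancel₀ h0]; simp
  conv_rhs => rw [← this, real_inner_smul_left]

/-- Green's representation of boundary values by the logarithmic kernel. -/
lemma integral_logKernel {M : ℝ} {ζ : ℂ → ℝ} {ζ₀ : ℝ → ℝ} (hM : 0 ≤ M) (h : IsAdmissible M ζ ζ₀)
    {t : ℝ} (ht : |t| ≤ 1) (htr : Tendsto ζ (𝓝[upperHalf] (t : ℂ)) (𝓝 (ζ₀ t))) :
    ∫ z in upperHalf, inner ℝ (logKernel z t) (gradient ζ z) = -(Real.pi * ζ₀ t) := by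
  have htn : ‖(t : ℂ)‖ ≤ 1 := by simpa using ht
  have hi := integrableOn_inner_logKernel hM htn h.bound
  set g : ℂ → ℝ := fun z => upperHalf.indicator
    (fun z => inner ℝ (logKernel z t) (gradient ζ z)) (t + z) with hg
  have hgi : Integrable g :=
    ((integrable_indicator_iff measurableSet_upperHalf).2 hi).comp_add_left (t : ℂ)
  have e1 : ∫ z in upperHalf, inner ℝ (logKernel z t) (gradient ζ z) = ∫ z, g z := by
    rw [← integral_indicator measurableSet_upperHalf, hg]
    exact (integral_add_left_eq_self (μ := (volume : Measure ℂ)) (upperHalf.indicator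
      (fun z => inner ℝ (logKernel z t) (gradient ζ z))) (t : ℂ)).symm
  have hpi := integrableOn_polarCoord hgi
  have hsymm : ∀ p : ℝ × ℝ, Complex.polarCoord.symm p = p.1 * Complex.exp (p.2 * Complex.I) := by
    intro p
    rw [Complex.polarCoord_symm_apply, Complex.exp_mul_I]
    push_cast; ring
  have hupper : ∀ ρ θ : ℝ, 0 < ρ → θ ∈ Set.Ioo (-Real.pi) Real.pi →
      ((t : ℂ) + ρ * Complex.exp (θ * Complex.I) ∈ upperHalf ↔ θ ∈ Set.Ioo 0 Real.pi) := by
    intro ρ θ hρ hθ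
    simp only [upperHalf, Set.mem_ofPred_eq, Complex.add_im, Complex.ofReal_im, Complex.mul_im,
      Complex.ofReal_re, zero_add, zero_mul, add_zero, Complex.exp_ofReal_mul_I_im]
    rw [mul_pos_iff_of_pos_left hρ]
    constructor
    · intro hs
      refine ⟨?_, hθ.2⟩
      by_contra hc
      push Not at hc
      have := Real.sin_nonpos_of_nonpos_of_neg_pi_le hc hθ.1.le
      linarith
    · exact fun hs => Real.sin_pos_of_mem_Ioo hs
  have hval : ∀ ρ ∈ Set.Ioi (0 : ℝ), ∀ θ ∈ Set.Ioo (-Real.pi) Real.pi,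
      ρ • g (Complex.polarCoord.symm (ρ, θ)) = (Set.Ioo 0 Real.pi).indicator (fun θ : ℝ =>
        inner ℝ (Complex.exp (θ * Complex.I))
          (gradient ζ (t + ρ * Complex.exp (θ * Complex.I)))) θ := by
    intro ρ hρ θ hθ
    rw [hsymm, hg]
    by_cases hθ' : θ ∈ Set.Ioo 0 Real.pi
    · simp only [Set.indicator_of_mem hθ', Set.indicator_of_mem ((hupper ρ θ hρ hθ).2 hθ'),
        smul_eq_mul]
      exact inner_logKernel_polar hρ _
    · have := mt (hupper ρ θ hρ hθ).1 hθ'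
      simp only [Set.indicator_of_notMem hθ', Set.indicator_of_notMem this, smul_zero]
  rw [e1, ← Complex.integral_comp_polarCoord_symm]
  rw [IntegrableOn, polarCoord_target, Measure.volume_eq_prod, ← Measure.prod_restrict] at hpi
  rw [polarCoord_target, Measure.volume_eq_prod, ← Measure.prod_restrict,
    integral_prod_symm _ hpi]
  -- Each ray that points into the half-plane contributes -ζ₀(t), the others nothing; the admissible
  -- angles have total length π.
  have hae : ∀ᵐ θ ∂(volume.restrict (Set.Ioo (-Real.pi) Real.pi)),
      ∫ ρ in Set.Ioi (0 : ℝ), ρ • g (Complex.polarCoord.symm (ρ, θ)) =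
        (Set.Ioo 0 Real.pi).indicator (fun _ => - ζ₀ t) θ := by
    filter_upwards [hpi.prod_left_ae, ae_restrict_mem measurableSet_Ioo] with θ hθi hθ
    rw [setIntegral_congr_fun measurableSet_Ioi fun ρ hρ => hval ρ hρ θ hθ]
    by_cases hθ' : θ ∈ Set.Ioo 0 Real.pi
    · simp only [Set.indicator_of_mem hθ']
      refine integral_ray h htr hθ' ?_
      refine IntegrableOn.congr_fun (f := fun ρ => ρ • g (Complex.polarCoord.symm (ρ, θ)))
        hθi (fun ρ hρ => ?_) measurableSet_Ioi
      exact (hval ρ hρ θ hθ).trans (Set.indicator_of_mem hθ' _)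
    · simp only [Set.indicator_of_notMem hθ', integral_zero]
  rw [integral_congr_ae hae, integral_indicator measurableSet_Ioo,
    Measure.restrict_restrict measurableSet_Ioo]
  have : Set.Ioo 0 Real.pi ∩ Set.Ioo (-Real.pi) Real.pi = Set.Ioo 0 Real.pi :=
    Set.inter_eq_left.2 (Set.Ioo_subset_Ioo_left (by linarith [Real.pi_pos]))
  rw [this, setIntegral_const]
  simp [Real.pi_pos.le]

/-- The gradient of the single layer potential with density `f` on `(-1, 1)`. -/
noncomputable def strayField (f : ℝ → ℝ) (z : ℂ) : ℂ :=
  (-(1 / Real.pi)) • ∫ t in Set.Ioo (-1 : ℝ) 1, f t • logKernel z t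

lemma abs_le_of_mem_Ioo {t : ℝ} (ht : t ∈ Set.Ioo (-1 : ℝ) 1) : |t| ≤ 1 :=
  abs_le.2 ⟨ht.1.le, ht.2.le⟩

lemma integrable_smul_logKernel {f : ℝ → ℝ} (hf : Measurable f)
    (hfi : IntegrableOn f (Set.Ioo (-1) 1)) {z : ℂ} (hz : z.im ≠ 0) :
    IntegrableOn (fun t : ℝ => f t • logKernel z t) (Set.Ioo (-1) 1) := by
  refine Integrable.mono' (hfi.norm.mul_const (1 / |z.im|)) ?_ (Eventually.of_forall fun t => ?_)
  · exact (hf.smul (measurable_logKernel.comp (measurable_const.prodMk measurable_id))).aestronglyMeasurable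
  · rw [norm_smul, norm_logKernel]
    gcongr
    simpa using Complex.abs_im_le_norm (z - t)

/-- The justification of Fubini: for fixed t the integral over z is at most 4M·3∫`kernelW`, by
translation invariance, and f is integrable. -/
lemma integrable_prod_logKernel {M : ℝ} {ζ : ℂ → ℝ} {ζ₀ : ℝ → ℝ} (hM : 0 ≤ M)
    (h : IsAdmissible M ζ ζ₀) {f : ℝ → ℝ} (hf : Measurable f)
    (hfi : IntegrableOn f (Set.Ioo (-1) 1)) :
    Integrable (fun p : ℂ × ℝ => f p.2 * inner ℝ (logKernel p.1 p.2) (gradient ζ p.1))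
      ((volume.restrict upperHalf).prod (volume.restrict (Set.Ioo (-1 : ℝ) 1))) := by
  have hm : Measurable (fun p : ℂ × ℝ => f p.2 * inner ℝ (logKernel p.1 p.2) (gradient ζ p.1)) :=
    (hf.comp measurable_snd).mul
      (measurable_logKernel.inner ((measurable_gradient ζ).comp measurable_fst))
  rw [integrable_prod_iff' hm.aestronglyMeasurable]
  constructor
  · filter_upwards [ae_restrict_mem measurableSet_Ioo] with t ht
    exact (integrableOn_inner_logKernel hM (by simpa using abs_le_of_mem_Ioo ht)
      h.bound).const_mul (f t)
  · refine Integrable.mono' (hfi.norm.mul_const (4 * M * (3 * ∫ z, kernelW z)))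
      hm.norm.stronglyMeasurable.integral_prod_left'.aestronglyMeasurable ?_
    filter_upwards [ae_restrict_mem measurableSet_Ioo] with t ht
    have htn : ‖(t : ℂ)‖ ≤ 1 := by simpa using abs_le_of_mem_Ioo ht
    rw [Real.norm_of_nonneg (integral_nonneg fun z => norm_nonneg _)]
    simp only [norm_mul]
    rw [integral_const_mul]
    gcongr
    calc ∫ z in upperHalf, ‖inner ℝ (logKernel z t) (gradient ζ z)‖
        ≤ ∫ z in upperHalf, 4 * M * (kernelW (z - t) + (kernelW (z - 1) + kernelW (z - (-1)))) := by
          refine setIntegral_mono_on (integrableOn_inner_logKernel hM htn h.bound).norm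
            ((integrable_three_kernels t).const_mul (4 * M)).integrableOn
            measurableSet_upperHalf fun z hz => norm_inner_logKernel_le hM htn (h.bound z hz)
      _ ≤ ∫ z, 4 * M * (kernelW (z - t) + (kernelW (z - 1) + kernelW (z - (-1)))) := by
          refine setIntegral_le_integral ((integrable_three_kernels t).const_mul (4 * M))
            (Eventually.of_forall fun z => ?_)
          have := kernelW_nonneg (z - t)
          have := kernelW_nonneg (z - 1)
          have := kernelW_nonneg (z - (-1))
          simp only [Pi.zero_apply]
          positivity
      _ = 4 * M * (3 * ∫ z, kernelW z) := by
          have i2 : Integrable (fun z : ℂ => kernelW (z - 1) + kernelW (z - (-1))) :=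
            (integrable_kernelW_sub _).add (integrable_kernelW_sub _)
          rw [integral_const_mul, integral_add (integrable_kernelW_sub _) i2,
            integral_add (integrable_kernelW_sub _) (integrable_kernelW_sub _)]
          simp only [integral_kernelW_sub]
          ring

/-- The weak equation of the single layer potential, for admissible test functions. -/
lemma integral_inner_strayField {M : ℝ} {ζ : ℂ → ℝ} {ζ₀ : ℝ → ℝ} (hM : 0 ≤ M)
    (h : IsAdmissible M ζ ζ₀) {f : ℝ → ℝ} (hf : Measurable f)
    (hfi : IntegrableOn f (Set.Ioo (-1) 1)) :
    ∫ z in upperHalf, inner ℝ (strayField f z) (gradient ζ z) =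
      ∫ t in Set.Ioo (-1 : ℝ) 1, f t * ζ₀ t := by
  have h1 : ∀ z ∈ upperHalf, inner ℝ (strayField f z) (gradient ζ z) =
      -(1 / Real.pi) * ∫ t in Set.Ioo (-1 : ℝ) 1,
        f t * inner ℝ (logKernel z t) (gradient ζ z) := by
    intro z hz
    have hz' : z.im ≠ 0 := ne_of_gt hz
    rw [strayField, real_inner_smul_left, real_inner_comm,
      ← integral_inner (integrable_smul_logKernel hf hfi hz')]
    simp only [real_inner_smul_right]
    congr 2
    ext t
    rw [real_inner_comm]
  rw [setIntegral_congr_fun measurableSet_upperHalf h1, integral_const_mul,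
    integral_integral_swap (integrable_prod_logKernel hM h hf hfi)]
  have h2 : ∀ᵐ t ∂(volume.restrict (Set.Ioo (-1 : ℝ) 1)),
      ∫ z in upperHalf, f t * inner ℝ (logKernel z t) (gradient ζ z) =
        -Real.pi * (f t * ζ₀ t) := by
    filter_upwards [h.trace, ae_restrict_mem measurableSet_Ioo] with t htr ht
    rw [integral_const_mul, integral_logKernel hM h (abs_le_of_mem_Ioo ht) htr]
    ring
  rw [integral_congr_ae h2, integral_const_mul]
  have := Real.pi_ne_zero
  field_simp

end

/-! ### Smoothness of integrals of translates, and the regularized logarithm -/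

section
section Parametric

variable {F : Type} [NormedAddCommGroup F]

lemma exists_bound_shift {L : ℂ → F} (hL : Continuous L) (r : ℝ) : ∃ C : ℝ, 0 ≤ C ∧
    ∀ z : ℂ, ‖z‖ ≤ r → ∀ t : ℝ, t ∈ Set.Ioo (-1 : ℝ) 1 → ‖L (z - t)‖ ≤ C := by
  obtain ⟨C, hC⟩ := (isCompact_closedBall (0 : ℂ) (r + 1)).exists_bound_of_continuousOn
    hL.continuousOn
  refine ⟨max C 0, le_max_right _ _, fun z hz t ht => (hC _ ?_).trans (le_max_left _ _)⟩
  rw [mem_closedBall_zero_iff]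
  have := norm_sub_le z t
  have h2 : ‖(t : ℂ)‖ ≤ 1 := by simpa using abs_le_of_mem_Ioo ht
  linarith

variable [NormedSpace ℝ F]

lemma aestronglyMeasurable_smul_shift {f : ℝ → ℝ} (hf : Measurable f) {L : ℂ → F}
    (hL : Continuous L) (z : ℂ) (μ : Measure ℝ) :
    AEStronglyMeasurable (fun t : ℝ => f t • L (z - t)) μ :=
  hf.aestronglyMeasurable.smul
    (hL.comp (by fun_prop : Continuous fun t : ℝ => z - (t : ℂ))).aestronglyMeasurable

lemma integrableOn_smul_shift {f : ℝ → ℝ} (hf : Measurable f)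
    (hfi : IntegrableOn f (Set.Ioo (-1) 1)) {L : ℂ → F} (hL : Continuous L) (z : ℂ) :
    IntegrableOn (fun t : ℝ => f t • L (z - t)) (Set.Ioo (-1) 1) := by
  obtain ⟨C, -, hC⟩ := exists_bound_shift hL ‖z‖
  refine Integrable.mono' (hfi.norm.mul_const C) (aestronglyMeasurable_smul_shift hf hL z _) ?_
  filter_upwards [ae_restrict_mem measurableSet_Ioo] with t ht
  rw [norm_smul]
  gcongr
  exact hC z le_rfl t ht

/-- The shifts z - t with z near a given point and t in (-1,1) stay in a compact set, so the
derivative of L is bounded there and f times a constant dominates. -/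
lemma hasFDerivAt_integral_shift {f : ℝ → ℝ} (hf : Measurable f)
    (hfi : IntegrableOn f (Set.Ioo (-1) 1)) {L : ℂ → F} (hL : ContDiff ℝ 1 L) (z : ℂ) :
    HasFDerivAt (fun z : ℂ => ∫ t in Set.Ioo (-1 : ℝ) 1, f t • L (z - t))
      (∫ t in Set.Ioo (-1 : ℝ) 1, f t • fderiv ℝ L (z - t)) z := by
  have hc := hL.continuous_fderiv one_ne_zero
  obtain ⟨C, hC0, hC⟩ := exists_bound_shift hc (‖z‖ + 1)
  refine hasFDerivAt_integral_of_dominated_of_fderiv_le (Metric.ball_mem_nhds z one_pos)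
    (bound := fun t => ‖f t‖ * C) (F' := fun z t => f t • fderiv ℝ L (z - t))
    (Eventually.of_forall fun x => aestronglyMeasurable_smul_shift hf hL.continuous x _)
    (integrableOn_smul_shift hf hfi hL.continuous z)
    (aestronglyMeasurable_smul_shift hf hc z _) ?_ (hfi.norm.mul_const C) ?_
  · filter_upwards [ae_restrict_mem measurableSet_Ioo] with t ht x hx
    rw [norm_smul]
    gcongr
    refine hC x ?_ t ht
    have := norm_le_norm_add_norm_sub' x z
    rw [Metric.mem_ball, dist_eq_norm] at hx
    linarith
  · refine Eventually.of_forall fun t x _ => ?_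
    have h1 := (hL.differentiable one_ne_zero (x - t)).hasFDerivAt.comp x
      ((hasFDerivAt_id x).sub_const (t : ℂ))
    exact (h1.const_smul (f t))

/-- The target space is quantified inside the induction because the derivative is an integral of the
same kind with values in a space of linear maps. -/
lemma contDiff_integral_shift_nat {f : ℝ → ℝ} (hf : Measurable f)
    (hfi : IntegrableOn f (Set.Ioo (-1) 1)) (n : ℕ) : ∀ {F : Type} [NormedAddCommGroup F]
    [NormedSpace ℝ F] {L : ℂ → F}, ContDiff ℝ ∞ L →
    ContDiff ℝ n (fun z : ℂ => ∫ t in Set.Ioo (-1 : ℝ) 1, f t • L (z - t)) := by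
  induction n with
  | zero =>
    intro F _ _ L hL
    refine contDiff_zero.2 (continuous_iff_continuousAt.2 fun z =>
      (hasFDerivAt_integral_shift hf hfi (hL.of_le (by simp)) z).continuousAt)
  | succ n ih =>
    intro F _ _ L hL
    push_cast
    refine contDiff_succ_iff_hasFDerivAt.2 ⟨_, ih (hL.fderiv_right (m := ∞) (by simp)), fun z =>
      hasFDerivAt_integral_shift hf hfi (hL.of_le (by simp)) z⟩

lemma contDiff_integral_shift {f : ℝ → ℝ} (hf : Measurable f)
    (hfi : IntegrableOn f (Set.Ioo (-1) 1)) {L : ℂ → F} (hL : ContDiff ℝ ∞ L) :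
    ContDiff ℝ ∞ (fun z : ℂ => ∫ t in Set.Ioo (-1 : ℝ) 1, f t • L (z - t)) :=
  contDiff_infty.2 fun n => contDiff_integral_shift_nat hf hfi n hL

end Parametric

/-- The regularized logarithm `½ log (|z|² + η)`. -/
noncomputable def logReg (η : ℝ) (z : ℂ) : ℝ := 1 / 2 * Real.log (‖z‖ ^ 2 + η)

/-- The gradient of the regularized logarithm. -/
noncomputable def gradReg (η : ℝ) (z : ℂ) : ℂ := (1 / (‖z‖ ^ 2 + η)) • z

lemma contDiff_logReg {η : ℝ} (hη : 0 < η) : ContDiff ℝ ∞ (logReg η) := by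
  refine contDiff_const.mul (ContDiff.log ((contDiff_norm_sq ℝ).add contDiff_const) fun z => ?_)
  positivity

lemma hasGradientAt_logReg {η : ℝ} (hη : 0 < η) (z : ℂ) :
    HasGradientAt (logReg η) (gradReg η z) z := by
  rw [hasGradientAt_iff_hasFDerivAt]
  have hp : ‖z‖ ^ 2 + η ≠ 0 := by positivity
  have h1 := ((((hasStrictFDerivAt_norm_sq z).hasFDerivAt.add_const η).log hp).const_mul (1 / 2 : ℝ))
  refine h1.congr_fderiv (ContinuousLinearMap.ext fun v => ?_)
  rw [InnerProductSpace.toDual_apply_apply, gradReg, real_inner_smul_left]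
  simp only [_root_.smul_apply, innerSL_apply_apply, smul_eq_mul]
  ring

lemma norm_gradReg_le {η : ℝ} (hη : 0 ≤ η) (z : ℂ) : ‖gradReg η z‖ ≤ 1 / ‖z‖ := by
  rcases eq_or_ne z 0 with rfl | hz
  · simp [gradReg]
  have hz' : 0 < ‖z‖ := norm_pos_iff.2 hz
  rw [gradReg, norm_smul, Real.norm_of_nonneg (by positivity), one_div_mul_eq_div,
    div_le_div_iff₀ (by positivity) hz']
  nlinarith

/-- For η = 0 this is the distance formula for inversion, from |b|²a - |a|²b = ab·conj(b - a); the
regularization adds η(a - b), which the enlarged denominators compensate. -/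
lemma norm_gradReg_sub_le {η : ℝ} (hη : 0 ≤ η) {a b : ℂ} (ha : a ≠ 0) (hb : b ≠ 0) :
    ‖gradReg η a - gradReg η b‖ ≤ ‖a - b‖ / (‖a‖ * ‖b‖) := by
  have ha' : 0 < ‖a‖ := norm_pos_iff.2 ha
  have hb' : 0 < ‖b‖ := norm_pos_iff.2 hb
  have hA : 0 < ‖a‖ ^ 2 + η := by positivity
  have hB : 0 < ‖b‖ ^ 2 + η := by positivity
  set A := ‖a‖ ^ 2 + η with hAd
  set B := ‖b‖ ^ 2 + η with hBd
  have e1 : gradReg η a - gradReg η b =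
      (1 / (A * B)) • ((‖b‖ ^ 2 • a - ‖a‖ ^ 2 • b) + η • (a - b)) := by
    have : (‖b‖ ^ 2 • a - ‖a‖ ^ 2 • b) + η • (a - b) = B • a - A • b := by
      rw [hAd, hBd]; module
    rw [this, smul_sub, smul_smul, smul_smul, gradReg, gradReg, ← hAd, ← hBd]
    congr 2 <;> field_simp
  have e2 : ‖‖b‖ ^ 2 • a - ‖a‖ ^ 2 • b‖ = ‖a‖ * ‖b‖ * ‖a - b‖ := by
    have h1 : (‖b‖ ^ 2 • a - ‖a‖ ^ 2 • b : ℂ) = a * b * (starRingEnd ℂ) (b - a) := by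
      simp only [Complex.real_smul, Complex.ofReal_pow, ← Complex.mul_conj', map_sub]; ring
    rw [h1, norm_mul, norm_mul, RCLike.norm_conj, norm_sub_rev]
  have e3 : ‖(‖b‖ ^ 2 • a - ‖a‖ ^ 2 • b) + η • (a - b)‖ ≤ (‖a‖ * ‖b‖ + η) * ‖a - b‖ := by
    refine (norm_add_le _ _).trans ?_
    rw [e2, norm_smul, Real.norm_of_nonneg hη]; linarith
  rw [e1, norm_smul, Real.norm_of_nonneg (by positivity), one_div_mul_eq_div,
    div_le_div_iff₀ (by positivity) (by positivity)]
  have h4 : (‖a‖ * ‖b‖ + η) * (‖a‖ * ‖b‖) ≤ A * B := by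
    rw [hAd, hBd]; nlinarith [sq_nonneg (‖a‖ - ‖b‖), sq_nonneg ‖a‖, sq_nonneg ‖b‖, mul_nonneg hη (sq_nonneg ‖a‖), mul_nonneg hη (sq_nonneg ‖b‖), mul_nonneg hη hη]
  calc _ ≤ ((‖a‖ * ‖b‖ + η) * ‖a - b‖) * (‖a‖ * ‖b‖) := by gcongr
    _ = ‖a - b‖ * ((‖a‖ * ‖b‖ + η) * (‖a‖ * ‖b‖)) := by ring
    _ ≤ _ := by gcongr

lemma abs_log_sub_log_le {A B m : ℝ} (hm : 0 < m) (hA : m ≤ A) (hB : m ≤ B) :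
    |Real.log A - Real.log B| ≤ |A - B| / m := by
  have key : ∀ {A B : ℝ}, m ≤ A → m ≤ B → Real.log A - Real.log B ≤ |A - B| / m := by
    intro A B hA hB
    have hB0 : 0 < B := by linarith
    have hA0 : 0 < A := by linarith
    rw [← Real.log_div hA0.ne' hB0.ne']
    calc Real.log (A / B) ≤ A / B - 1 := Real.log_le_sub_one_of_pos (by positivity)
      _ = (A - B) / B := by field_simp
      _ ≤ |A - B| / B := by gcongr; exact le_abs_self _
      _ ≤ |A - B| / m := by gcongr
  rw [abs_sub_le_iff]
  refine ⟨key hA hB, ?_⟩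
  rw [abs_sub_comm]; exact key hB hA

/-- Both arguments of the logarithm are at least (|z|/2)² and differ by at most 3|z|. For a density
of mean zero this turns logarithmic growth into decay of order 1/|z|, uniformly in η. -/
lemma abs_logReg_sub_le {η : ℝ} (hη : 0 ≤ η) {z t : ℂ} (hz : 2 ≤ ‖z‖) (ht : ‖t‖ ≤ 1) :
    |logReg η (z - t) - logReg η z| ≤ 6 / ‖z‖ := by
  have hz0 : 0 < ‖z‖ := by linarith
  have h1 : ‖z‖ / 2 ≤ ‖z - t‖ := by
    have := norm_sub_norm_le z t; linarith
  have h2 : ‖z - t‖ ≤ ‖z‖ + 1 := by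
    have := norm_sub_le z t; linarith
  have h3 : |‖z - t‖ - ‖z‖| ≤ 1 := by
    have := abs_norm_sub_norm_le (z - t) z
    rw [sub_sub_cancel_left, norm_neg] at this; linarith
  have hm : 0 < (‖z‖ / 2) ^ 2 := by positivity
  have hA : (‖z‖ / 2) ^ 2 ≤ ‖z - t‖ ^ 2 + η := by
    have := pow_le_pow_left₀ (by positivity) h1 2; linarith
  have hB : (‖z‖ / 2) ^ 2 ≤ ‖z‖ ^ 2 + η := by nlinarith
  have h5 := abs_log_sub_log_le hm hA hB
  have h6 : |(‖z - t‖ ^ 2 + η) - (‖z‖ ^ 2 + η)| ≤ 3 * ‖z‖ := by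
    rw [show (‖z - t‖ ^ 2 + η) - (‖z‖ ^ 2 + η) = (‖z - t‖ - ‖z‖) * (‖z - t‖ + ‖z‖) by ring,
      abs_mul, abs_of_nonneg (by positivity : 0 ≤ ‖z - t‖ + ‖z‖)]
    calc _ ≤ 1 * (‖z - t‖ + ‖z‖) := by gcongr
      _ ≤ _ := by linarith
  rw [logReg, logReg, ← mul_sub, abs_mul, abs_of_pos (by norm_num : (0 : ℝ) < 1 / 2)]
  calc 1 / 2 * |Real.log (‖z - t‖ ^ 2 + η) - Real.log (‖z‖ ^ 2 + η)|
      ≤ 1 / 2 * (3 * ‖z‖ / (‖z‖ / 2) ^ 2) := by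
        gcongr; exact h5.trans (by gcongr)
    _ = 6 / ‖z‖ := by field_simp; norm_num

lemma abs_logReg_le {η : ℝ} (hη : 0 ≤ η) (hη1 : η ≤ 1) {z : ℂ} (hz : z ≠ 0) :
    |logReg η z| ≤ ‖z‖ + 1 / ‖z‖ := by
  have hz0 : 0 < ‖z‖ := norm_pos_iff.2 hz
  rw [logReg, abs_le]
  constructor
  · have h1 : Real.log (‖z‖ ^ 2) ≤ Real.log (‖z‖ ^ 2 + η) :=
      Real.log_le_log (by positivity) (by linarith)
    rw [Real.log_pow] at h1
    have h2 := Real.log_le_sub_one_of_pos (inv_pos.2 hz0)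
    rw [Real.log_inv] at h2
    rw [one_div ‖z‖]
    push_cast at h1
    linarith
  · have h1 : Real.log (‖z‖ ^ 2 + η) ≤ Real.log ((1 + ‖z‖) ^ 2) :=
      Real.log_le_log (by positivity) (by nlinarith)
    rw [Real.log_pow] at h1
    have h2 := Real.log_le_sub_one_of_pos (by positivity : 0 < 1 + ‖z‖)
    have : 0 ≤ 1 / ‖z‖ := by positivity
    push_cast at h1
    linarith

lemma logReg_zero (z : ℂ) : logReg 0 z = Real.log ‖z‖ := by
  rw [logReg, add_zero, Real.log_pow]; push_cast; ring

lemma gradReg_zero (z t : ℂ) : gradReg 0 (z - t) = logKernel z t := by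
  rw [gradReg, logKernel, Complex.inv_def, map_mul, Complex.conj_conj, Complex.conj_ofReal,
    Complex.normSq_eq_norm_sq, Complex.real_smul]
  push_cast; rw [add_zero, mul_comm, one_div]

lemma measurable_logReg : Measurable (fun p : ℝ × ℂ => logReg p.1 p.2) := by
  unfold logReg; fun_prop

lemma measurable_gradReg : Measurable (fun p : ℝ × ℂ => gradReg p.1 p.2) := by
  unfold gradReg; fun_prop

lemma tendsto_logReg {z : ℂ} (hz : z ≠ 0) {η : ℕ → ℝ} (hη : Tendsto η atTop (𝓝 0)) :
    Tendsto (fun k => logReg (η k) z) atTop (𝓝 (logReg 0 z)) := by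
  have : ‖z‖ ^ 2 + 0 ≠ 0 := by simpa using hz
  exact ((Real.continuousAt_log this).tendsto.comp (tendsto_const_nhds.add hη)).const_mul _

lemma tendsto_gradReg {z : ℂ} (hz : z ≠ 0) {η : ℕ → ℝ} (hη : Tendsto η atTop (𝓝 0)) :
    Tendsto (fun k => gradReg (η k) z) atTop (𝓝 (gradReg 0 z)) := by
  have : ‖z‖ ^ 2 + 0 ≠ 0 := by simpa using hz
  exact (tendsto_const_nhds.div (tendsto_const_nhds.add hη) this).smul tendsto_const_nhds

end

/-! ### Single layer potentials: uniform bounds and square integrability -/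

section
-- The pointwise estimates for layer potentials hold off the real line, where the kernels are
-- bounded in t; this makes them hold almost everywhere in the plane.
lemma ae_im_ne_zero : ∀ᵐ z : ℂ, z.im ≠ 0 := by
  have h := Measure.addHaar_submodule (volume : Measure ℂ) (LinearMap.ker Complex.imLm)
    (fun h => by
      have : Complex.I ∈ LinearMap.ker Complex.imLm := h ▸ Submodule.mem_top
      simp at this)
  rw [ae_iff]
  convert h using 2
  ext z; simp

/-- Square integrable densities on `(-1, 1)` with zero mean. -/
structure IsDensity (f : ℝ → ℝ) : Prop where
  measurable : Measurable f
  memLp : MemLp f 2 (volume.restrict (Set.Ioo (-1) 1))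
  mean : ∫ t in Set.Ioo (-1 : ℝ) 1, f t = 0

lemma IsDensity.integrableOn {f : ℝ → ℝ} (h : IsDensity f) : IntegrableOn f (Set.Ioo (-1) 1) :=
  h.memLp.integrable (by norm_num)

/-- The regularized single layer potential. -/
noncomputable def layerPot (η : ℝ) (f : ℝ → ℝ) (z : ℂ) : ℝ :=
  -(1 / Real.pi) * ∫ t in Set.Ioo (-1 : ℝ) 1, f t * logReg η (z - t)

/-- The gradient of the regularized single layer potential. -/
noncomputable def layerField (η : ℝ) (f : ℝ → ℝ) (z : ℂ) : ℂ :=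
  (-(1 / Real.pi)) • ∫ t in Set.Ioo (-1 : ℝ) 1, f t • gradReg η (z - t)

lemma layerField_zero (f : ℝ → ℝ) : layerField 0 f = strayField f := by
  ext1 z; simp only [layerField, strayField, gradReg_zero]

/-- The function that dominates the regularized fields. -/
noncomputable def fieldBound (f : ℝ → ℝ) (z : ℂ) : ℝ :=
  1 / (1 + ‖z‖) * ∫ t in Set.Ioo (-1 : ℝ) 1, |f t| * (1 / ‖z - t‖)

lemma fieldBound_nonneg (f : ℝ → ℝ) (z : ℂ) : 0 ≤ fieldBound f z :=
  mul_nonneg (by positivity) (integral_nonneg fun t => by positivity)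

lemma sub_ofReal_ne_zero {z : ℂ} (hz : z.im ≠ 0) (t : ℝ) : z - t ≠ 0 := fun h =>
  hz (by simpa using congrArg Complex.im h)

lemma one_div_norm_sub_le {z : ℂ} (hz : z.im ≠ 0) (t : ℝ) : 1 / ‖z - t‖ ≤ 1 / |z.im| := by
  have : 0 < |z.im| := abs_pos.2 hz
  gcongr
  simpa using Complex.abs_im_le_norm (z - t)

variable {f : ℝ → ℝ}

lemma measurable_fieldBound (hf : Measurable f) : Measurable (fieldBound f) := by
  have : Measurable (fun p : ℂ × ℝ => |f p.2| * (1 / ‖p.1 - p.2‖)) :=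
    (hf.comp measurable_snd).abs.mul (by fun_prop)
  exact (by fun_prop : Measurable fun z : ℂ => 1 / (1 + ‖z‖)).mul
    this.stronglyMeasurable.integral_prod_right.measurable

lemma measurable_layerPot (hf : Measurable f) (η : ℝ) : Measurable (layerPot η f) := by
  have : Measurable (fun p : ℂ × ℝ => f p.2 * logReg η (p.1 - p.2)) := by
    unfold logReg; fun_prop
  exact Measurable.const_mul (this.stronglyMeasurable.integral_prod_right
    (f := fun z t => f t * logReg η (z - t))
    (ν := volume.restrict (Set.Ioo (-1 : ℝ) 1))).measurable _

lemma measurable_layerField (hf : Measurable f) (η : ℝ) : Measurable (layerField η f) := by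
  have : Measurable (fun p : ℂ × ℝ => f p.2 • gradReg η (p.1 - p.2)) := by
    unfold gradReg; fun_prop
  exact Measurable.const_smul (this.stronglyMeasurable.integral_prod_right
    (f := fun z t => f t • gradReg η (z - t))
    (ν := volume.restrict (Set.Ioo (-1 : ℝ) 1))).measurable (-(1 / Real.pi))

lemma integrableOn_abs_div_norm (h : IsDensity f) {z : ℂ} (hz : z.im ≠ 0) :
    IntegrableOn (fun t : ℝ => |f t| * (1 / ‖z - t‖)) (Set.Ioo (-1) 1) := by
  refine Integrable.mono' (h.integrableOn.norm.mul_const (1 / |z.im|)) ?_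
    (Eventually.of_forall fun t => ?_)
  · exact (h.measurable.abs.mul (by fun_prop)).aestronglyMeasurable
  · rw [Real.norm_of_nonneg (by positivity)]
    exact mul_le_mul_of_nonneg_left (one_div_norm_sub_le hz t) (abs_nonneg _)

lemma integrableOn_smul_gradReg (h : IsDensity f) {η : ℝ} (hη : 0 ≤ η) {z : ℂ} (hz : z.im ≠ 0) :
    IntegrableOn (fun t : ℝ => f t • gradReg η (z - t)) (Set.Ioo (-1) 1) := by
  refine Integrable.mono' (integrableOn_abs_div_norm h hz) ?_ (Eventually.of_forall fun t => ?_)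
  · exact (h.measurable.smul (measurable_gradReg.comp (by fun_prop :
      Measurable fun t : ℝ => (η, z - (t : ℂ))))).aestronglyMeasurable
  · rw [norm_smul]
    exact mul_le_mul_of_nonneg_left (norm_gradReg_le hη _) (abs_nonneg _)

/-- For |z| ≥ 1 the zero mean of f allows the field of a point charge at the origin to be
subtracted, which gains a factor 1/|z|. Without this gain the field would fail to be square
integrable at infinity. -/
lemma norm_layerField_le (h : IsDensity f) {η : ℝ} (hη : 0 ≤ η) {z : ℂ} (hz : z.im ≠ 0) :
    ‖layerField η f z‖ ≤ fieldBound f z := by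
  have hz0 : z ≠ 0 := fun h => hz (by simp [h])
  have hi := integrableOn_smul_gradReg h hη hz
  have hb := integrableOn_abs_div_norm h hz
  have key : ‖∫ t in Set.Ioo (-1 : ℝ) 1, f t • gradReg η (z - t)‖ ≤
      2 / (1 + ‖z‖) * ∫ t in Set.Ioo (-1 : ℝ) 1, |f t| * (1 / ‖z - t‖) := by
    rw [← integral_const_mul]
    rcases le_total ‖z‖ 1 with h1 | h1
    · refine norm_integral_le_of_norm_le (hb.const_mul _) (Eventually.of_forall fun t => ?_)
      rw [norm_smul, Real.norm_eq_abs]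
      have : (1 : ℝ) ≤ 2 / (1 + ‖z‖) := by
        rw [le_div_iff₀ (by positivity)]; linarith
      calc |f t| * ‖gradReg η (z - t)‖ ≤ |f t| * (1 / ‖z - t‖) :=
            mul_le_mul_of_nonneg_left (norm_gradReg_le hη _) (abs_nonneg _)
        _ ≤ _ := le_mul_of_one_le_left (by positivity) this
    · have e : ∫ t in Set.Ioo (-1 : ℝ) 1, f t • gradReg η (z - t) =
          ∫ t in Set.Ioo (-1 : ℝ) 1, f t • (gradReg η (z - t) - gradReg η z) := by
        simp_rw [smul_sub]
        rw [integral_sub hi (h.integrableOn.smul_const _), integral_smul_const, h.mean]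
        simp
      rw [e]
      refine norm_integral_le_of_norm_le (hb.const_mul _) ?_
      filter_upwards [ae_restrict_mem measurableSet_Ioo] with t ht
      rw [norm_smul, Real.norm_eq_abs]
      have h2 := norm_gradReg_sub_le hη (sub_ofReal_ne_zero hz t) hz0
      rw [sub_sub_cancel_left, norm_neg, Complex.norm_real, Real.norm_eq_abs] at h2
      have ht1 := abs_le_of_mem_Ioo ht
      have hn : 0 < ‖z - t‖ := norm_pos_iff.2 (sub_ofReal_ne_zero hz t)
      have hzn : 0 < ‖z‖ := by linarith
      calc |f t| * ‖gradReg η (z - t) - gradReg η z‖ ≤ |f t| * (1 / (‖z - t‖ * ‖z‖)) := by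
            gcongr; exact h2.trans (by gcongr)
        _ = 1 / ‖z‖ * (|f t| * (1 / ‖z - t‖)) := by field_simp
        _ ≤ 2 / (1 + ‖z‖) * (|f t| * (1 / ‖z - t‖)) := by
            refine mul_le_mul_of_nonneg_right ?_ (by positivity)
            rw [div_le_div_iff₀ hzn (by positivity)]; linarith
  rw [layerField, norm_smul, norm_neg, Real.norm_of_nonneg (by positivity), fieldBound]
  have hI : 0 ≤ ∫ t in Set.Ioo (-1 : ℝ) 1, |f t| * (1 / ‖z - t‖) :=
    integral_nonneg fun t => by positivity
  have hpi : 1 / Real.pi * 2 ≤ 1 := by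
    rw [one_div_mul_eq_div, div_le_one Real.pi_pos]; exact Real.two_le_pi
  calc _ ≤ 1 / Real.pi * (2 / (1 + ‖z‖) * ∫ t in Set.Ioo (-1 : ℝ) 1, |f t| * (1 / ‖z - t‖)) := by
        gcongr
    _ = (1 / Real.pi * 2) * (1 / (1 + ‖z‖) * ∫ t in Set.Ioo (-1 : ℝ) 1, |f t| * (1 / ‖z - t‖)) := by
        ring
    _ ≤ _ := mul_le_of_le_one_left (by positivity) hpi

lemma integrable_sq_mul_kernelW (h : IsDensity f) : Integrable
    (fun z : ℂ => ∫ t in Set.Ioo (-1 : ℝ) 1, f t ^ 2 * kernelW (z - t)) := by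
  have hm : Measurable (fun p : ℂ × ℝ => f p.2 ^ 2 * kernelW (p.1 - p.2)) :=
    ((h.measurable.comp measurable_snd).pow_const 2).mul (measurable_kernelW.comp (by fun_prop))
  refine Integrable.integral_prod_left (μ := volume) (f := fun p : ℂ × ℝ =>
    f p.2 ^ 2 * kernelW (p.1 - p.2)) ((integrable_prod_iff' hm.aestronglyMeasurable).2 ⟨?_, ?_⟩)
  · exact Eventually.of_forall fun t => (integrable_kernelW_sub (t : ℂ)).const_mul (f t ^ 2)
  · have e : ∀ t : ℝ, ∫ z, ‖f t ^ 2 * kernelW (z - t)‖ = f t ^ 2 * ∫ z, kernelW z := by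
      intro t
      rw [← integral_kernelW_sub t, ← integral_const_mul]
      congr 1; ext z
      rw [Real.norm_of_nonneg (mul_nonneg (sq_nonneg _) (kernelW_nonneg _))]
    simp only [e]
    exact h.memLp.integrable_sq.mul_const _

/-- Cauchy–Schwarz with |z - t|⁻¹ = |z - t|^(-3/4)·|z - t|^(-1/4): the second factor has a bounded
squared integral over (-1,1), while f² times the square of the first is a convolution with the
integrable `kernelW`. -/
lemma integrable_fieldBound_sq (h : IsDensity f) : Integrable (fun z => fieldBound f z ^ 2) := by
  obtain ⟨C, hC0, hC⟩ := exists_bound_integral_inv_sqrt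
  refine Integrable.mono' ((integrable_sq_mul_kernelW h).const_mul (2 * C))
    ((measurable_fieldBound h.measurable).pow_const 2).aestronglyMeasurable ?_
  filter_upwards [ae_im_ne_zero] with z hz
  rw [Real.norm_of_nonneg (sq_nonneg _)]
  have hn : ∀ t : ℝ, 0 < ‖z - t‖ := fun t => norm_pos_iff.2 (sub_ofReal_ne_zero hz t)
  set a : ℝ → ℝ := fun t => |f t| * (1 / √(‖z - t‖ * √‖z - t‖)) with ha
  set b : ℝ → ℝ := fun t => 1 / √√‖z - t‖ with hb
  have hab : ∀ t, a t * b t = |f t| * (1 / ‖z - t‖) := by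
    intro t
    have h1 : √(‖z - t‖ * √‖z - t‖) * √√‖z - t‖ = ‖z - t‖ := by
      rw [← Real.sqrt_mul (by positivity), mul_assoc, Real.mul_self_sqrt (norm_nonneg _),
        Real.sqrt_mul_self (norm_nonneg _)]
    rw [ha, hb]
    simp only
    rw [mul_assoc, one_div_mul_one_div, h1]
  have ha2 : ∀ t, a t ^ 2 = f t ^ 2 * (1 / (‖z - t‖ * √‖z - t‖)) := by
    intro t
    rw [ha]
    simp only
    rw [mul_pow, sq_abs, div_pow, Real.sq_sqrt (by positivity), one_pow]
  have hb2 : ∀ t, b t ^ 2 = 1 / √‖z - t‖ := by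
    intro t
    rw [hb]
    simp only
    rw [div_pow, Real.sq_sqrt (by positivity), one_pow]
  have hble : ∀ t : ℝ, t ∉ ({z.re} : Set ℝ) → 1 / √‖z - t‖ ≤ 1 / √|z.re - t| := by
    intro t ht
    have : z.re - t ≠ 0 := fun h0 => ht (by simp; linarith)
    have : 0 < |z.re - t| := abs_pos.2 this
    gcongr
    simpa using Complex.abs_re_le_norm (z - t)
  have hae : ∀ᵐ t : ℝ ∂(volume.restrict (Set.Ioo (-1 : ℝ) 1)), 1 / √‖z - t‖ ≤ 1 / √|z.re - t| := by
    have : ∀ᵐ t : ℝ, t ∉ ({z.re} : Set ℝ) := measure_eq_zero_iff_ae_notMem.1 (by simp)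
    filter_upwards [ae_restrict_of_ae this] with t ht using hble t ht
  have ia : IntegrableOn (fun t => a t ^ 2) (Set.Ioo (-1) 1) := by
    simp_rw [ha2]
    refine Integrable.mono' (h.memLp.integrable_sq.mul_const (1 / (|z.im| * √|z.im|))) ?_
      (Eventually.of_forall fun t => ?_)
    · exact ((h.measurable.pow_const 2).mul (by fun_prop)).aestronglyMeasurable
    · rw [Real.norm_of_nonneg (by positivity)]
      have : 0 < |z.im| := abs_pos.2 hz
      have h3 : |z.im| ≤ ‖z - t‖ := by simpa using Complex.abs_im_le_norm (z - t)
      gcongr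
  have ib : IntegrableOn (fun t => b t ^ 2) (Set.Ioo (-1) 1) := by
    simp_rw [hb2]
    refine Integrable.mono' (hC z.re).1 (by
      have : Measurable fun t : ℝ => 1 / √‖z - t‖ := by fun_prop
      exact this.aestronglyMeasurable) ?_
    filter_upwards [hae] with t ht
    rwa [Real.norm_of_nonneg (by positivity)]
  have hma : MemLp a 2 (volume.restrict (Set.Ioo (-1 : ℝ) 1)) :=
    (memLp_two_iff_integrable_sq ((h.measurable.abs.mul
      (by fun_prop)).aestronglyMeasurable)).2 ia
  have hmb : MemLp b 2 (volume.restrict (Set.Ioo (-1 : ℝ) 1)) :=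
    (memLp_two_iff_integrable_sq (by
      have : Measurable b := by rw [hb]; fun_prop
      exact this.aestronglyMeasurable)).2 ib
  have hcs := sq_integral_mul_le hma hmb
  simp_rw [hab, ha2, hb2] at hcs
  have hbC : ∫ t in Set.Ioo (-1 : ℝ) 1, 1 / √‖z - t‖ ≤ C := by
    refine (integral_mono_ae ?_ (hC z.re).1 hae).trans (hC z.re).2
    simpa only [hb2, IntegrableOn] using ib
  have i2 : 0 ≤ ∫ t in Set.Ioo (-1 : ℝ) 1, f t ^ 2 * (1 / (‖z - t‖ * √‖z - t‖)) :=
    integral_nonneg fun t => by positivity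
  rw [fieldBound, mul_pow]
  have hS : (1 / (1 + ‖z‖)) ^ 2 ≤ 1 / (1 + ‖z‖) := by
    have h1 : 1 / (1 + ‖z‖) ≤ 1 := (div_le_one (by positivity)).2 (by linarith [norm_nonneg z])
    have h0 : 0 ≤ 1 / (1 + ‖z‖) := by positivity
    nlinarith
  calc (1 / (1 + ‖z‖)) ^ 2 * (∫ t in Set.Ioo (-1 : ℝ) 1, |f t| * (1 / ‖z - t‖)) ^ 2
      ≤ 1 / (1 + ‖z‖) *
        ((∫ t in Set.Ioo (-1 : ℝ) 1, f t ^ 2 * (1 / (‖z - t‖ * √‖z - t‖))) * C) := by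
        gcongr
        exact hcs.trans (mul_le_mul_of_nonneg_left hbC i2)
    _ = C * ∫ t in Set.Ioo (-1 : ℝ) 1,
        1 / (1 + ‖z‖) * (f t ^ 2 * (1 / (‖z - t‖ * √‖z - t‖))) := by
        rw [integral_const_mul]; ring
    _ ≤ C * ∫ t in Set.Ioo (-1 : ℝ) 1, 2 * (f t ^ 2 * kernelW (z - t)) := by
        refine mul_le_mul_of_nonneg_left ?_ hC0.le
        refine integral_mono_ae ?_ ?_ ?_
        · have := ia.const_mul (1 / (1 + ‖z‖))
          simpa only [ha2, IntegrableOn] using this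
        · have hk : ∀ t, kernelW (z - (t : ℝ)) ≤ 1 / (‖z - t‖ * √‖z - t‖) := by
            intro t
            have := hn t
            rw [kernelW]
            apply one_div_le_one_div_of_le (by positivity)
            exact le_mul_of_one_le_right (by positivity) (by linarith)
          refine (Integrable.mono' (g := fun t => a t ^ 2) ia ?_ (Eventually.of_forall fun t => ?_)).const_mul 2
          · exact ((h.measurable.pow_const 2).mul
              (measurable_kernelW.comp (by fun_prop))).aestronglyMeasurable
          · rw [Real.norm_of_nonneg (mul_nonneg (sq_nonneg _) (kernelW_nonneg _)), ha2]
            exact mul_le_mul_of_nonneg_left (hk t) (sq_nonneg _)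
        · filter_upwards [ae_restrict_mem measurableSet_Ioo] with t ht
          have h1 := one_add_norm_sub_le z t (by simpa using abs_le_of_mem_Ioo ht)
          have h2 : 1 / (1 + ‖z‖) ≤ 2 * (1 / (1 + ‖z - t‖)) := by
            rw [mul_one_div, div_le_div_iff₀ (by positivity) (by positivity)]; linarith
          have := hn t
          calc 1 / (1 + ‖z‖) * (f t ^ 2 * (1 / (‖z - t‖ * √‖z - t‖)))
              ≤ 2 * (1 / (1 + ‖z - t‖)) * (f t ^ 2 * (1 / (‖z - t‖ * √‖z - t‖))) := by gcongr
            _ = _ := by rw [kernelW]; field_simp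
    _ = _ := by rw [integral_const_mul]; ring

/-- As the mean of f vanishes, the logarithm may be replaced by its increment from z to z - t. The
constant uses 6/π ≤ 2. -/
lemma abs_layerPot_le_div (h : IsDensity f) {η : ℝ} (hη : 0 ≤ η) {z : ℂ} (hz : 2 ≤ ‖z‖) :
    |layerPot η f z| ≤ 2 * (∫ t in Set.Ioo (-1 : ℝ) 1, |f t|) / ‖z‖ := by
  have hmeas : AEStronglyMeasurable (fun t : ℝ => f t * (logReg η (z - t) - logReg η z))
      (volume.restrict (Set.Ioo (-1) 1)) :=
    (h.measurable.mul ((measurable_logReg.comp (by fun_prop :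
      Measurable fun t : ℝ => (η, z - (t : ℂ)))).sub_const _)).aestronglyMeasurable
  have hle : ∀ᵐ t ∂(volume.restrict (Set.Ioo (-1 : ℝ) 1)),
      ‖f t * (logReg η (z - t) - logReg η z)‖ ≤ 6 / ‖z‖ * |f t| := by
    filter_upwards [ae_restrict_mem measurableSet_Ioo] with t ht
    rw [norm_mul, Real.norm_eq_abs, Real.norm_eq_abs, mul_comm]
    gcongr
    exact abs_logReg_sub_le hη hz (by simpa using abs_le_of_mem_Ioo ht)
  have hbi : IntegrableOn (fun t => 6 / ‖z‖ * |f t|) (Set.Ioo (-1) 1) :=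
    h.integrableOn.abs.const_mul _
  have hi : IntegrableOn (fun t : ℝ => f t * (logReg η (z - t) - logReg η z)) (Set.Ioo (-1) 1) :=
    hbi.mono' hmeas hle
  have e : ∫ t in Set.Ioo (-1 : ℝ) 1, f t * logReg η (z - t) =
      ∫ t in Set.Ioo (-1 : ℝ) 1, f t * (logReg η (z - t) - logReg η z) := by
    have : ∀ t : ℝ, f t * logReg η (z - t) =
        f t * (logReg η (z - t) - logReg η z) + f t * logReg η z := fun t => by ring
    simp_rw [this]
    rw [integral_add hi (h.integrableOn.mul_const _), integral_mul_const, h.mean]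
    simp
  have key := norm_integral_le_of_norm_le hbi hle
  rw [← e, integral_const_mul, Real.norm_eq_abs] at key
  have hI : 0 ≤ ∫ t in Set.Ioo (-1 : ℝ) 1, |f t| := integral_nonneg fun t => abs_nonneg _
  rw [layerPot, abs_mul, abs_neg, abs_of_pos (by positivity : 0 < 1 / Real.pi)]
  have hpi : 1 / Real.pi * 6 ≤ 2 := by
    rw [one_div_mul_eq_div, div_le_iff₀ Real.pi_pos]; linarith [Real.pi_gt_three]
  calc _ ≤ 1 / Real.pi * (6 / ‖z‖ * ∫ t in Set.Ioo (-1 : ℝ) 1, |f t|) := by gcongr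
    _ = (1 / Real.pi * 6) * ((∫ t in Set.Ioo (-1 : ℝ) 1, |f t|) / ‖z‖) := by ring
    _ ≤ 2 * ((∫ t in Set.Ioo (-1 : ℝ) 1, |f t|) / ‖z‖) := by gcongr
    _ = _ := by ring

lemma norm_mul_logReg_le {η : ℝ} (hη : 0 ≤ η) (hη1 : η ≤ 1) {z : ℂ} (hz : z.im ≠ 0) {t : ℝ}
    (ht : t ∈ Set.Ioo (-1 : ℝ) 1) :
    ‖f t * logReg η (z - t)‖ ≤ (1 + ‖z‖) * |f t| + |f t| * (1 / ‖z - t‖) := by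
  have h1 := abs_logReg_le hη hη1 (sub_ofReal_ne_zero hz t)
  have h2 := norm_sub_le z t
  have h3 : ‖(t : ℂ)‖ ≤ 1 := by simpa using abs_le_of_mem_Ioo ht
  rw [norm_mul, Real.norm_eq_abs, Real.norm_eq_abs]
  calc |f t| * |logReg η (z - t)| ≤ |f t| * ((1 + ‖z‖) + 1 / ‖z - t‖) := by
        gcongr; linarith
    _ = _ := by ring

lemma integrableOn_mul_logReg (h : IsDensity f) {η : ℝ} (hη : 0 ≤ η) (hη1 : η ≤ 1) {z : ℂ}
    (hz : z.im ≠ 0) : IntegrableOn (fun t : ℝ => f t * logReg η (z - t)) (Set.Ioo (-1) 1) := by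
  refine Integrable.mono' (g := fun t => (1 + ‖z‖) * |f t| + |f t| * (1 / ‖z - t‖))
    ((h.integrableOn.abs.const_mul _).add (integrableOn_abs_div_norm h hz)) ?_ ?_
  · exact (h.measurable.mul (measurable_logReg.comp (by fun_prop :
      Measurable fun t : ℝ => (η, z - (t : ℂ))))).aestronglyMeasurable
  · filter_upwards [ae_restrict_mem measurableSet_Ioo] with t ht using norm_mul_logReg_le hη hη1 hz ht

lemma abs_layerPot_le (h : IsDensity f) {η : ℝ} (hη : 0 ≤ η) (hη1 : η ≤ 1) {z : ℂ}
    (hz : z.im ≠ 0) :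
    |layerPot η f z| ≤ (1 + ‖z‖) * ((∫ t in Set.Ioo (-1 : ℝ) 1, |f t|) + fieldBound f z) := by
  have i1 : IntegrableOn (fun t => (1 + ‖z‖) * |f t|) (Set.Ioo (-1) 1) :=
    h.integrableOn.abs.const_mul _
  have key := norm_integral_le_of_norm_le (i1.add (integrableOn_abs_div_norm h hz))
    (f := fun t : ℝ => f t * logReg η (z - t)) (by
      filter_upwards [ae_restrict_mem measurableSet_Ioo] with t ht
        using norm_mul_logReg_le hη hη1 hz ht)
  have e : ∫ t in Set.Ioo (-1 : ℝ) 1, ((fun t => (1 + ‖z‖) * |f t|) +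
      fun t => |f t| * (1 / ‖z - t‖)) t =
      (1 + ‖z‖) * ((∫ t in Set.Ioo (-1 : ℝ) 1, |f t|) + fieldBound f z) := by
    rw [show ((fun t => (1 + ‖z‖) * |f t|) + fun t : ℝ => |f t| * (1 / ‖z - t‖)) =
      fun t => (1 + ‖z‖) * |f t| + |f t| * (1 / ‖z - t‖) from rfl,
      integral_add i1 (integrableOn_abs_div_norm h hz), integral_const_mul, fieldBound]
    have : 1 + ‖z‖ ≠ 0 := by positivity
    field_simp
  rw [e, Real.norm_eq_abs] at key
  rw [layerPot, abs_mul, abs_neg, abs_of_pos (by positivity : 0 < 1 / Real.pi)]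
  refine (mul_le_of_le_one_left (abs_nonneg _) ?_).trans key
  rw [div_le_one Real.pi_pos]; linarith [Real.pi_gt_three]

lemma tendsto_layerPot (h : IsDensity f) {η : ℕ → ℝ} (h0 : ∀ k, 0 ≤ η k) (h1 : ∀ k, η k ≤ 1)
    (hη : Tendsto η atTop (𝓝 0)) {z : ℂ} (hz : z.im ≠ 0) :
    Tendsto (fun k => layerPot (η k) f z) atTop (𝓝 (layerPot 0 f z)) := by
  refine (tendsto_integral_of_dominated_convergence
    (fun t => (1 + ‖z‖) * |f t| + |f t| * (1 / ‖z - t‖))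
    (fun k => (integrableOn_mul_logReg h (h0 k) (h1 k) hz).1)
    ((h.integrableOn.abs.const_mul _).add (integrableOn_abs_div_norm h hz)) (fun k => ?_)
    (Eventually.of_forall fun t => ?_)).const_mul _
  · filter_upwards [ae_restrict_mem measurableSet_Ioo] with t ht
      using norm_mul_logReg_le (h0 k) (h1 k) hz ht
  · exact (tendsto_logReg (sub_ofReal_ne_zero hz t) hη).const_mul _

lemma tendsto_layerField (h : IsDensity f) {η : ℕ → ℝ} (h0 : ∀ k, 0 ≤ η k)
    (hη : Tendsto η atTop (𝓝 0)) {z : ℂ} (hz : z.im ≠ 0) :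
    Tendsto (fun k => layerField (η k) f z) atTop (𝓝 (layerField 0 f z)) := by
  refine (tendsto_integral_of_dominated_convergence
    (fun t => |f t| * (1 / ‖z - t‖))
    (fun k => (integrableOn_smul_gradReg h (h0 k) hz).1)
    (integrableOn_abs_div_norm h hz) (fun k => Eventually.of_forall fun t => ?_)
    (Eventually.of_forall fun t => ?_)).const_smul _
  · rw [norm_smul]
    exact mul_le_mul_of_nonneg_left (norm_gradReg_le (h0 k) _) (abs_nonneg _)
  · exact (tendsto_gradReg (sub_ofReal_ne_zero hz t) hη).const_smul _

lemma contDiff_layerPot (h : IsDensity f) {η : ℝ} (hη : 0 < η) : ContDiff ℝ ∞ (layerPot η f) :=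
  contDiff_const.mul (contDiff_integral_shift h.measurable h.integrableOn (contDiff_logReg hη))

lemma hasGradientAt_layerPot (h : IsDensity f) {η : ℝ} (hη : 0 < η) (z : ℂ) :
    HasGradientAt (layerPot η f) (layerField η f z) z := by
  rw [hasGradientAt_iff_hasFDerivAt]
  have h1 := (hasFDerivAt_integral_shift h.measurable h.integrableOn
    ((contDiff_logReg hη).of_le (by simp)) z).const_mul (-(1 / Real.pi))
  refine h1.congr_fderiv ?_
  have hc : Continuous (gradReg η) := by
    unfold gradReg
    have h1 : Continuous fun z : ℂ => ‖z‖ ^ 2 + η := by fun_prop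
    have h2 : Continuous fun z : ℂ => 1 / (‖z‖ ^ 2 + η) :=
      continuous_const.div h1 fun z => by positivity
    exact h2.smul continuous_id
  have hi := integrableOn_smul_shift h.measurable h.integrableOn hc z
  have hi2 := integrableOn_smul_shift h.measurable h.integrableOn
    ((contDiff_logReg hη).continuous_fderiv (by simp)) z
  ext1 v
  rw [layerField, InnerProductSpace.toDual_apply_apply, real_inner_smul_left, real_inner_comm,
    ← integral_inner hi, _root_.smul_apply, ContinuousLinearMap.integral_apply hi2, smul_eq_mul]
  congr 2; ext1 t
  rw [real_inner_smul_right, real_inner_comm, ← (hasGradientAt_logReg hη (z - t)).gradient,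
    inner_gradient_left]
  rfl

end

/-! ### Approximation by test functions and the homogeneous Sobolev space -/

section
lemma hasGradientAt_mul {g h : ℂ → ℝ} {g' h' z : ℂ} (hg : HasGradientAt g g' z)
    (hh : HasGradientAt h h' z) :
    HasGradientAt (fun w => g w * h w) (g z • h' + h z • g') z := by
  rw [hasGradientAt_iff_hasFDerivAt] at *
  refine (hg.mul hh).congr_fderiv ?_
  ext v
  simp only [InnerProductSpace.toDual_apply_apply, inner_add_left, real_inner_smul_left,
    _root_.add_apply, _root_.smul_apply, smul_eq_mul]

/-- A smooth cutoff function equal to one on the disc of radius `n` and vanishing outside the disc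
of radius `2n`. -/
noncomputable def cutoff (n : ℝ) (z : ℂ) : ℝ :=
  (⟨1, 2, one_pos, one_lt_two⟩ : ContDiffBump (0 : ℂ)) (n⁻¹ • z)

lemma contDiff_cutoff (n : ℝ) : ContDiff ℝ ∞ (cutoff n) :=
  (ContDiffBump.contDiff _).comp (contDiff_const_smul _)

lemma cutoff_nonneg (n : ℝ) (z : ℂ) : 0 ≤ cutoff n z := ContDiffBump.nonneg _

lemma cutoff_le_one (n : ℝ) (z : ℂ) : cutoff n z ≤ 1 := ContDiffBump.le_one _

lemma cutoff_eventually_one {n : ℝ} (hn : 0 < n) {z : ℂ} (hz : ‖z‖ < n) :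
    cutoff n =ᶠ[𝓝 z] fun _ => 1 := by
  filter_upwards [(isOpen_lt continuous_norm continuous_const).mem_nhds hz] with w hw
  refine ContDiffBump.one_of_mem_closedBall _ ?_
  rw [mem_closedBall_zero_iff, norm_smul, norm_inv, Real.norm_of_nonneg hn.le]
  rw [inv_mul_le_iff₀ hn, mul_one]
  exact le_of_lt hw

lemma cutoff_eq_zero {n : ℝ} (hn : 0 < n) {z : ℂ} (hz : 2 * n ≤ ‖z‖) : cutoff n z = 0 := by
  refine ContDiffBump.zero_of_le_dist _ ?_
  rw [dist_zero_right, norm_smul, norm_inv, Real.norm_of_nonneg hn.le]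
  rw [le_inv_mul_iff₀ hn]
  linarith

lemma hasCompactSupport_cutoff {n : ℝ} (hn : 0 < n) : HasCompactSupport (cutoff n) :=
  HasCompactSupport.of_support_subset_isCompact (isCompact_closedBall (0 : ℂ) (2 * n))
    fun z hz => by
      rw [mem_closedBall_zero_iff]
      by_contra hc
      exact hz (cutoff_eq_zero hn (not_le.1 hc).le)

lemma gradient_cutoff_eq_zero {n : ℝ} (hn : 0 < n) {z : ℂ} (hz : ‖z‖ < n ∨ 2 * n < ‖z‖) :
    gradient (cutoff n) z = 0 := by
  rcases hz with hz | hz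
  · rw [(cutoff_eventually_one hn hz).gradient_eq]; simp
  · have : cutoff n =ᶠ[𝓝 z] fun _ => 0 := by
      filter_upwards [(isOpen_lt continuous_const continuous_norm).mem_nhds hz] with w hw
      exact cutoff_eq_zero hn (le_of_lt hw)
    rw [this.gradient_eq]; simp

lemma norm_gradient_eq (g : ℂ → ℝ) (z : ℂ) : ‖gradient g z‖ = ‖fderiv ℝ g z‖ := by
  rw [← toDual_gradient, LinearIsometryEquiv.norm_map]

lemma exists_bound_gradient_cutoff : ∃ B : ℝ, 0 ≤ B ∧ ∀ n : ℝ, 0 < n → ∀ z : ℂ,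
    ‖gradient (cutoff n) z‖ ≤ B / n := by
  have hs : HasCompactSupport (fderiv ℝ (cutoff 1)) := (hasCompactSupport_cutoff one_pos).fderiv ℝ
  have hc : Continuous (fderiv ℝ (cutoff 1)) := (contDiff_cutoff 1).continuous_fderiv (by simp)
  obtain ⟨B, hB⟩ := hc.bounded_above_of_compact_support hs
  refine ⟨max B 0, le_max_right _ _, fun n hn z => ?_⟩
  have e : cutoff n = fun z => cutoff 1 (n⁻¹ • z) := by ext z; simp [cutoff]
  have h1 : HasFDerivAt (cutoff n) (n⁻¹ • fderiv ℝ (cutoff 1) (n⁻¹ • z)) z := by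
    rw [e]
    have := (((contDiff_cutoff 1).differentiable (by simp)) (n⁻¹ • z)).hasFDerivAt.comp z
      ((hasFDerivAt_id z).const_smul n⁻¹)
    refine this.congr_fderiv (ContinuousLinearMap.ext fun v => ?_)
    simp
  rw [norm_gradient_eq, h1.fderiv, norm_smul, norm_inv, Real.norm_of_nonneg hn.le,
    inv_mul_eq_div]
  gcongr
  exact (hB _).trans (le_max_left _ _)

variable {f : ℝ → ℝ}

/-- The `L¹` norm of the density. -/
noncomputable def densityMass (f : ℝ → ℝ) : ℝ := ∫ t in Set.Ioo (-1 : ℝ) 1, |f t|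

lemma densityMass_nonneg (f : ℝ → ℝ) : 0 ≤ densityMass f :=
  integral_nonneg fun _ => abs_nonneg _

/-- Test functions approximating the single layer potential. -/
noncomputable def approxPot (f : ℝ → ℝ) (k : ℕ) (z : ℂ) : ℝ :=
  cutoff (k + 2) z * layerPot (1 / (k + 1)) f z

lemma contDiff_approxPot (h : IsDensity f) (k : ℕ) : ContDiff ℝ ∞ (approxPot f k) :=
  (contDiff_cutoff _).mul (contDiff_layerPot h (by positivity))

lemma hasCompactSupport_approxPot (f : ℝ → ℝ) (k : ℕ) : HasCompactSupport (approxPot f k) :=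
  (hasCompactSupport_cutoff (by positivity : (0 : ℝ) < k + 2)).mul_right

lemma gradient_approxPot (h : IsDensity f) (k : ℕ) (z : ℂ) :
    gradient (approxPot f k) z = cutoff (k + 2) z • layerField (1 / (k + 1)) f z +
      layerPot (1 / (k + 1)) f z • gradient (cutoff (k + 2)) z :=
  (hasGradientAt_mul ((contDiff_cutoff _).differentiable (by simp) z).hasGradientAt
    (hasGradientAt_layerPot h (by positivity) z)).gradient

lemma regParam_le_one (k : ℕ) : (1 : ℝ) / (k + 1) ≤ 1 :=
  (div_le_one (by positivity)).2 (by linarith [(Nat.cast_nonneg k : (0 : ℝ) ≤ k)])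

lemma abs_approxPot_le (h : IsDensity f) (k : ℕ) {z : ℂ} (hz : z.im ≠ 0) :
    |approxPot f k z| ≤ (1 + ‖z‖) * (densityMass f + fieldBound f z) := by
  rw [approxPot, abs_mul, abs_of_nonneg (cutoff_nonneg _ _)]
  exact (mul_le_of_le_one_left (abs_nonneg _) (cutoff_le_one _ _)).trans
    (abs_layerPot_le h (by positivity) (regParam_le_one k) hz)

/-- The gradient of the cutoff has size 1/(k + 2) and lives where |z| lies between k + 2 and 2(k +
2); the potential is O(1/|z|) there, so the product is O(|z|⁻²) uniformly in k, which is square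
integrable. -/
lemma exists_bound_gradient_approxPot (h : IsDensity f) : ∃ C : ℝ, 0 ≤ C ∧ ∀ k : ℕ, ∀ z : ℂ,
    z.im ≠ 0 → ‖gradient (approxPot f k) z‖ ≤ fieldBound f z + C / (1 + ‖z‖) ^ 2 := by
  obtain ⟨B, hB0, hB⟩ := exists_bound_gradient_cutoff
  have hF := densityMass_nonneg f
  refine ⟨16 * B * densityMass f, by positivity, fun k z hz => ?_⟩
  have hn : (0 : ℝ) < k + 2 := by positivity
  rw [gradient_approxPot h]
  refine (norm_add_le _ _).trans (add_le_add ?_ ?_)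
  · rw [norm_smul, Real.norm_of_nonneg (cutoff_nonneg _ _)]
    exact (mul_le_of_le_one_left (norm_nonneg _) (cutoff_le_one _ _)).trans
      (norm_layerField_le h (by positivity) hz)
  · by_cases hc : ‖z‖ < k + 2 ∨ 2 * ((k : ℝ) + 2) < ‖z‖
    · rw [gradient_cutoff_eq_zero hn hc, smul_zero, norm_zero]; positivity
    · push Not at hc
      have hk : (0 : ℝ) ≤ k := Nat.cast_nonneg k
      have h2 : 2 ≤ ‖z‖ := by linarith [hc.1]
      have hz0 : 0 < ‖z‖ := by linarith
      have h3 := abs_layerPot_le_div h (by positivity : (0 : ℝ) ≤ 1 / (k + 1)) h2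
      rw [← densityMass] at h3
      rw [norm_smul, Real.norm_eq_abs]
      calc _ ≤ 2 * densityMass f / ‖z‖ * (B / (k + 2)) := by
            gcongr; exact hB _ hn z
        _ ≤ 2 * densityMass f / ‖z‖ * (B * (2 / ‖z‖)) := by
            rw [div_eq_mul_one_div B]
            have : 1 / ((k : ℝ) + 2) ≤ 2 / ‖z‖ := by
              rw [div_le_div_iff₀ hn hz0]; linarith [hc.2]
            exact mul_le_mul_of_nonneg_left (mul_le_mul_of_nonneg_left this hB0) (by positivity)
        _ = 4 * B * densityMass f * (1 / ‖z‖ ^ 2) := by field_simp; ring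
        _ ≤ 4 * B * densityMass f * (4 / (1 + ‖z‖) ^ 2) := by
            gcongr ?_ * ?_
            rw [div_le_div_iff₀ (by positivity) (by positivity)]; nlinarith
        _ = _ := by ring

lemma tendsto_regParam : Tendsto (fun k : ℕ => (1 : ℝ) / (k + 1)) atTop (𝓝 0) :=
  tendsto_one_div_add_atTop_nhds_zero_nat

lemma eventually_norm_lt (z : ℂ) : ∀ᶠ k : ℕ in atTop, ‖z‖ < (k : ℝ) + 2 := by
  obtain ⟨N, hN⟩ := exists_nat_gt ‖z‖
  filter_upwards [eventually_ge_atTop N] with k hk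
  have : (N : ℝ) ≤ k := by exact_mod_cast hk
  linarith

lemma tendsto_approxPot (h : IsDensity f) {z : ℂ} (hz : z.im ≠ 0) :
    Tendsto (fun k => approxPot f k z) atTop (𝓝 (layerPot 0 f z)) := by
  refine (tendsto_layerPot h (fun k => by positivity) regParam_le_one tendsto_regParam hz).congr' ?_
  filter_upwards [eventually_norm_lt z] with k hk
  rw [approxPot, (cutoff_eventually_one (by positivity) hk).eq_of_nhds, one_mul]

lemma tendsto_gradient_approxPot (h : IsDensity f) {z : ℂ} (hz : z.im ≠ 0) :
    Tendsto (fun k => gradient (approxPot f k) z) atTop (𝓝 (layerField 0 f z)) := by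
  refine (tendsto_layerField h (fun k => by positivity) tendsto_regParam hz).congr' ?_
  filter_upwards [eventually_norm_lt z] with k hk
  rw [gradient_approxPot h, (cutoff_eventually_one (by positivity) hk).eq_of_nhds, one_smul,
    gradient_cutoff_eq_zero (by positivity) (Or.inl hk), smul_zero, add_zero]

lemma memLp_fieldBound (h : IsDensity f) : MemLp (fieldBound f) 2 :=
  (memLp_two_iff_integrable_sq (measurable_fieldBound h.measurable).aestronglyMeasurable).2
    (integrable_fieldBound_sq h)

lemma memLp_inv_sq (C : ℝ) : MemLp (fun z : ℂ => C / (1 + ‖z‖) ^ 2) 2 := by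
  rw [memLp_two_iff_integrable_sq (Measurable.aestronglyMeasurable (by fun_prop))]
  have := (integrable_one_add_norm (E := ℂ) (μ := volume) (r := 4)
    (by rw [Complex.finrank_real_complex]; norm_num)).const_mul (C ^ 2)
  refine this.congr (Eventually.of_forall fun z => ?_)
  have h0 : 0 < 1 + ‖z‖ := by positivity
  have h1 : (1 + ‖z‖) ^ (-(4 : ℝ)) = ((1 + ‖z‖) ^ 4)⁻¹ := by
    rw [Real.rpow_neg h0.le]; norm_cast
  simp only
  rw [h1]
  field_simp

lemma memLp_layerField (h : IsDensity f) : MemLp (layerField 0 f) 2 := by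
  refine (memLp_fieldBound h).mono (measurable_layerField h.measurable 0).aestronglyMeasurable ?_
  filter_upwards [ae_im_ne_zero] with z hz
  rw [Real.norm_of_nonneg (fieldBound_nonneg f z)]
  exact norm_layerField_le h le_rfl hz

/-- Dominated convergence: pointwise convergence off the real line with a square integrable majorant
independent of k. -/
lemma tendsto_eLpNorm_approxPot (h : IsDensity f) :
    Tendsto (fun k => eLpNorm (fun z => layerField 0 f z - gradient (approxPot f k) z) 2 volume)
      atTop (𝓝 0) := by
  obtain ⟨C, hC0, hC⟩ := exists_bound_gradient_approxPot h
  set D : ℂ → ℝ := fun z => fieldBound f z + (fieldBound f z + C / (1 + ‖z‖) ^ 2) with hD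
  have hDm : MemLp D 2 := (memLp_fieldBound h).add ((memLp_fieldBound h).add (memLp_inv_sq C))
  have e : ∀ g : ℂ → ℂ, eLpNorm g 2 volume = (∫⁻ z, ‖g z‖ₑ ^ (2 : ℝ)) ^ (1 / 2 : ℝ) := by
    intro g
    rw [eLpNorm_eq_lintegral_rpow_enorm_toReal (by norm_num) (by norm_num)]
    simp
  simp_rw [e]
  have h0 : (0 : ENNReal) = (∫⁻ _ : ℂ, (0 : ENNReal)) ^ (1 / 2 : ℝ) := by simp
  rw [h0]
  refine ((ENNReal.continuous_rpow_const).tendsto _).comp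
    (tendsto_lintegral_of_dominated_convergence (fun z => ‖D z‖ₑ ^ (2 : ℝ)) (fun k => ?_)
      (fun k => ?_) ?_ ?_)
  · exact (((measurable_layerField h.measurable 0).sub (measurable_gradient _)).enorm).pow_const _
  · filter_upwards [ae_im_ne_zero] with z hz
    gcongr
    rw [← ofReal_norm, ← ofReal_norm]
    refine ENNReal.ofReal_le_ofReal ?_
    have h1 := norm_layerField_le h le_rfl hz
    have h2 := hC k z hz
    rw [Real.norm_of_nonneg (by
      rw [hD]; have := fieldBound_nonneg f z; positivity)]
    exact (norm_sub_le _ _).trans (add_le_add h1 h2)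
  · have := hDm.2
    rw [eLpNorm_eq_lintegral_rpow_enorm_toReal (by norm_num) (by norm_num)] at this
    intro hc
    simp only [ENNReal.toReal_ofNat, hc] at this
    simp at this
  · filter_upwards [ae_im_ne_zero] with z hz
    have h1 : Tendsto (fun k => layerField 0 f z - gradient (approxPot f k) z) atTop (𝓝 0) := by
      simpa using (tendsto_gradient_approxPot h hz).const_sub (layerField 0 f z)
    have h2 := ((ENNReal.continuous_rpow_const (y := 2)).tendsto _).comp h1.enorm
    simpa [Function.comp_def] using h2

/-- A locally integrable majorant of the approximating potentials. -/
noncomputable def potBound (f : ℝ → ℝ) (z : ℂ) : ℝ :=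
  (1 + ‖z‖) ^ 2 + (2 * densityMass f ^ 2 + 2 * fieldBound f z ^ 2)

lemma le_potBound {f : ℝ → ℝ} {z : ℂ} {a : ℝ}
    (h : a ≤ (1 + ‖z‖) * (densityMass f + fieldBound f z)) : a ≤ potBound f z := by
  rw [potBound]
  -- Two applications of xy ≤ (x² + y²)/2, trading the product for a continuous part plus the
  -- integrable square of `fieldBound`.
  nlinarith [sq_nonneg ((1 + ‖z‖) - (densityMass f + fieldBound f z)),
    sq_nonneg (densityMass f - fieldBound f z), sq_nonneg (densityMass f + fieldBound f z),
    sq_nonneg (1 + ‖z‖)]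

lemma locallyIntegrable_potBound (h : IsDensity f) : LocallyIntegrable (potBound f) := by
  have h1 : Continuous fun z : ℂ => (1 + ‖z‖) ^ 2 := by fun_prop
  exact h1.locallyIntegrable.add ((continuous_const).locallyIntegrable.add
    ((integrable_fieldBound_sq h).const_mul 2).locallyIntegrable)

lemma locallyIntegrable_layerPot (h : IsDensity f) : LocallyIntegrable (layerPot 0 f) := by
  refine (locallyIntegrable_potBound h).mono
    (measurable_layerPot h.measurable 0).aestronglyMeasurable ?_
  filter_upwards [ae_im_ne_zero] with z hz
  exact (le_potBound (abs_layerPot_le h le_rfl zero_le_one hz)).trans (le_abs_self _)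

/-- Integration by parts holds for the smooth approximations, and both sides pass to the limit by
domination on the support of φ. The potential is thus weakly differentiable across the real line. -/
lemma integral_layerPot_mul (h : IsDensity f) {φ : ℂ → ℝ} (hφ : ContDiff ℝ ∞ φ)
    (hφc : HasCompactSupport φ) (e : ℂ) :
    ∫ z, layerPot 0 f z * fderiv ℝ φ z e = -∫ z, inner ℝ (layerField 0 f z) e * φ z := by
  obtain ⟨C, hC0, hC⟩ := exists_bound_gradient_approxPot h
  have hdc : Continuous (fun z => fderiv ℝ φ z e) :=
    (hφ.continuous_fderiv (by simp)).clm_apply continuous_const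
  have hds : HasCompactSupport (fun z => fderiv ℝ φ z e) := hφc.fderiv_apply ℝ e
  have key : ∀ k, ∫ z, approxPot f k z * fderiv ℝ φ z e =
      -∫ z, inner ℝ (gradient (approxPot f k) z) e * φ z := by
    intro k
    have hac : Continuous (approxPot f k) := (contDiff_approxPot h k).continuous
    have hadc : Continuous (fun z => fderiv ℝ (approxPot f k) z e) :=
      ((contDiff_approxPot h k).continuous_fderiv (by simp)).clm_apply continuous_const
    simp_rw [inner_gradient_left]
    refine integral_mul_fderiv_eq_neg_fderiv_mul_of_integrable ?_ ?_ ?_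
      (fun z _ => (contDiff_approxPot h k).differentiable (by simp) z)
      (fun z _ => hφ.differentiable (by simp) z)
    · exact (hadc.mul hφ.continuous).integrable_of_hasCompactSupport hφc.mul_left
    · exact (hac.mul hdc).integrable_of_hasCompactSupport hds.mul_left
    · exact (hac.mul hφ.continuous).integrable_of_hasCompactSupport hφc.mul_left
  have l1 : Tendsto (fun k => ∫ z, approxPot f k z * fderiv ℝ φ z e) atTop
      (𝓝 (∫ z, layerPot 0 f z * fderiv ℝ φ z e)) := by
    refine tendsto_integral_of_dominated_convergence
      (fun z => potBound f z * ‖fderiv ℝ φ z e‖) (fun k => ?_) ?_ (fun k => ?_) ?_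
    · exact ((contDiff_approxPot h k).continuous.mul hdc).aestronglyMeasurable
    · have := (locallyIntegrable_potBound h).integrable_smul_left_of_hasCompactSupport
        hdc.norm hds.norm
      simpa only [smul_eq_mul, mul_comm] using this
    · filter_upwards [ae_im_ne_zero] with z hz
      rw [norm_mul]
      exact mul_le_mul_of_nonneg_right (le_potBound (abs_approxPot_le h k hz)) (norm_nonneg _)
    · filter_upwards [ae_im_ne_zero] with z hz using (tendsto_approxPot h hz).mul_const _
  have l2 : Tendsto (fun k => -∫ z, inner ℝ (gradient (approxPot f k) z) e * φ z) atTop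
      (𝓝 (-∫ z, inner ℝ (layerField 0 f z) e * φ z)) := by
    refine (tendsto_integral_of_dominated_convergence
      (fun z => ((fieldBound f z + C / (1 + ‖z‖) ^ 2) * ‖e‖) * ‖φ z‖)
      (fun k => ?_) ?_ (fun k => ?_) ?_).neg
    · exact ((((measurable_gradient _).inner measurable_const)).mul
        hφ.continuous.measurable).aestronglyMeasurable
    · have hl : LocallyIntegrable fun z => fieldBound f z + C / (1 + ‖z‖) ^ 2 :=
        ((memLp_fieldBound h).add (memLp_inv_sq C)).locallyIntegrable (by norm_num)
      have := (hl.integrable_smul_left_of_hasCompactSupport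
        hφ.continuous.norm hφc.norm).const_mul ‖e‖
      refine this.congr (Eventually.of_forall fun z => ?_)
      simp only [smul_eq_mul]; ring
    · filter_upwards [ae_im_ne_zero] with z hz
      rw [norm_mul]
      gcongr
      exact (norm_inner_le_norm _ _).trans (by gcongr; exact hC k z hz)
    · filter_upwards [ae_im_ne_zero] with z hz
      exact ((tendsto_gradient_approxPot h hz).inner tendsto_const_nhds).mul_const _
  simp_rw [key] at l1
  exact tendsto_nhds_unique l1 l2

lemma locallyIntegrable_comp_symm {E : Type*} [NormedAddCommGroup E] {g : ℂ → E}
    (hg : LocallyIntegrable g) : LocallyIntegrable (fun x : Plane => g (toPlane.symm x)) := by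
  rw [locallyIntegrable_iff] at *
  intro K hK
  rw [integrableOn_toPlane]
  simp only [LinearIsometryEquiv.symm_apply_apply]
  exact hg _ (toPlane.toHomeomorph.isCompact_preimage.2 hK)

lemma toPlane_apply_eq_inner (z : ℂ) (i : Fin 2) :
    toPlane z i = inner ℝ z (toPlane.symm (EuclideanSpace.single i 1)) := by
  rw [← LinearIsometryEquiv.inner_map_map toPlane, LinearIsometryEquiv.apply_symm_apply,
    EuclideanSpace.inner_single_right]
  simp

/-- The single layer potential lies in the homogeneous Sobolev space. -/
lemma memHomSobolevPlane_layerPot (h : IsDensity f) :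
    MemHomSobolevPlane (fun x => layerPot 0 f (toPlane.symm x)) := by
  have hmp := toPlane.symm.measurePreserving
  refine ⟨fun x => toPlane (layerField 0 f (toPlane.symm x)), ⟨?_, ?_, ?_⟩, ?_,
    fun k x => approxPot f k (toPlane.symm x), fun k => ?_, ?_⟩
  · exact locallyIntegrable_comp_symm (locallyIntegrable_layerPot h)
  · have := locallyIntegrable_comp_symm
      (((memLp_layerField h).locallyIntegrable (by norm_num)))
    refine this.mono ?_ (Eventually.of_forall fun x => by simp)
    exact (toPlane.continuous.measurable.comp ((measurable_layerField h.measurable 0).comp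
      toPlane.symm.continuous.measurable)).aestronglyMeasurable
  · intro φ hφ i
    rw [integral_toPlane, integral_toPlane]
    simp only [LinearIsometryEquiv.symm_apply_apply, gradient_toPlane, toPlane_apply_eq_inner,
      inner_gradient_left]
    exact integral_layerPot_mul h hφ.comp_toPlane.1 hφ.comp_toPlane.2 _
  · have := (memLp_layerField h).comp_measurePreserving hmp
    refine this.mono ?_ (Eventually.of_forall fun x => by simp)
    exact (toPlane.continuous.measurable.comp ((measurable_layerField h.measurable 0).comp
      toPlane.symm.continuous.measurable)).aestronglyMeasurable
  · exact isTestFunction_comp_symm (contDiff_approxPot h k) (hasCompactSupport_approxPot f k)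
  · refine (tendsto_eLpNorm_approxPot h).congr fun k => ?_
    have hm : Measurable fun z => layerField 0 f z - gradient (approxPot f k) z :=
      (measurable_layerField h.measurable 0).sub (measurable_gradient _)
    rw [← eLpNorm_comp_measurePreserving hm.aestronglyMeasurable hmp]
    refine eLpNorm_congr_norm_ae (Eventually.of_forall fun x => ?_)
    simp only [Function.comp_apply]
    rw [gradient_comp_symm, ← map_sub, LinearIsometryEquiv.norm_map]

end

/-! ### Harmonicity of the potential and uniqueness of the stray field -/

section
variable {f : ℝ → ℝ}

lemma sub_ofReal_mem_slitPlane {z : ℂ} (hz : z ∈ upperHalf) (t : ℝ) : z - t ∈ Complex.slitPlane :=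
  Or.inr (by simpa using ne_of_gt hz)

/-- The holomorphic function on the half-plane with real part the single layer potential. -/
noncomputable def complexPot (f : ℝ → ℝ) (z : ℂ) : ℂ :=
  -(1 / Real.pi : ℂ) * ∫ t in Set.Ioo (-1 : ℝ) 1, (f t : ℂ) * Complex.log (z - t)

lemma integrableOn_mul_log (h : IsDensity f) {z : ℂ} (hz : z ∈ upperHalf) :
    IntegrableOn (fun t : ℝ => (f t : ℂ) * Complex.log (z - t)) (Set.Ioo (-1) 1) := by
  refine Integrable.mono' ((integrableOn_mul_logReg h le_rfl zero_le_one (ne_of_gt hz)).norm.add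
    (h.integrableOn.abs.mul_const Real.pi)) ?_ (Eventually.of_forall fun t => ?_)
  · exact ((Complex.measurable_ofReal.comp h.measurable).mul
      (Complex.measurable_log.comp (by fun_prop))).aestronglyMeasurable
  · rw [norm_mul, Complex.norm_real, Pi.add_apply, norm_mul, ← Real.norm_eq_abs (f t), ← mul_add]
    gcongr
    refine (Complex.norm_le_abs_re_add_abs_im _).trans ?_
    rw [Complex.log_re, Complex.log_im, logReg_zero, Real.norm_eq_abs]
    gcongr
    exact Complex.abs_arg_le_pi _

/-- For z in the half-plane z - t avoids the branch cut, and on the disc of radius Im z/2 the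
derivative of the integrand is at most 2|f|/Im z. -/
lemma hasDerivAt_complexPot (h : IsDensity f) {z : ℂ} (hz : z ∈ upperHalf) :
    HasDerivAt (complexPot f)
      (-(1 / Real.pi : ℂ) * ∫ t in Set.Ioo (-1 : ℝ) 1, (f t : ℂ) * (z - t)⁻¹) z := by
  have hz0 : 0 < z.im := hz
  refine HasDerivAt.const_mul _ (hasDerivAt_integral_of_dominated_loc_of_deriv_le
    (Metric.ball_mem_nhds z (half_pos hz0)) (bound := fun t => |f t| * (2 / z.im))
    (μ := volume.restrict (Set.Ioo (-1 : ℝ) 1)) (F := fun z t => (f t : ℂ) * Complex.log (z - t))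
    (F' := fun z t => (f t : ℂ) * (z - t)⁻¹) (Eventually.of_forall fun x => ?_)
    (integrableOn_mul_log h hz) ?_ ?_ (h.integrableOn.abs.mul_const _) ?_).2
  · exact ((Complex.measurable_ofReal.comp h.measurable).mul
      (Complex.measurable_log.comp (by fun_prop))).aestronglyMeasurable
  · exact ((Complex.measurable_ofReal.comp h.measurable).mul (by fun_prop)).aestronglyMeasurable
  all_goals
    refine Eventually.of_forall fun t x hx => ?_
    have him : z.im / 2 < x.im := by
      rw [Metric.mem_ball, dist_eq_norm] at hx
      have := (Complex.abs_im_le_norm (x - z)).trans_lt hx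
      rw [Complex.sub_im, abs_lt] at this
      linarith [this.1]
  · rw [norm_mul, Complex.norm_real, Real.norm_eq_abs, norm_inv]
    gcongr
    rw [inv_eq_one_div, div_le_div_iff₀]
    · have := Complex.abs_im_le_norm (x - t)
      rw [Complex.sub_im, Complex.ofReal_im, sub_zero] at this
      have := le_abs_self x.im
      linarith
    · exact norm_pos_iff.2 (sub_ofReal_ne_zero (by linarith) t)
    · exact hz0
  · have hx' : x ∈ upperHalf := by
      have : 0 < x.im := by linarith
      exact this
    have := ((Complex.hasDerivAt_log (sub_ofReal_mem_slitPlane hx' t)).comp x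
      ((hasDerivAt_id x).sub_const (t : ℂ))).const_mul (f t : ℂ)
    simpa using this

lemma re_complexPot (h : IsDensity f) {z : ℂ} (hz : z ∈ upperHalf) :
    (complexPot f z).re = layerPot 0 f z := by
  have e : (-(1 / Real.pi : ℂ)) = ((-(1 / Real.pi) : ℝ) : ℂ) := by push_cast; ring
  rw [complexPot, e, Complex.re_ofReal_mul, layerPot]
  congr 1
  rw [← Complex.reCLM_apply, ← Complex.reCLM.integral_comp_comm (integrableOn_mul_log h hz)]
  congr 1; ext1 t
  rw [Complex.reCLM_apply, Complex.re_ofReal_mul, Complex.log_re, logReg_zero]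

lemma harmonicAt_layerPot (h : IsDensity f) {z : ℂ} (hz : z ∈ upperHalf) :
    InnerProductSpace.HarmonicAt (layerPot 0 f) z := by
  have hd : DifferentiableOn ℂ (complexPot f) upperHalf := fun w hw =>
    (hasDerivAt_complexPot h hw).differentiableAt.differentiableWithinAt
  have ha := (hd.analyticAt (isOpen_upperHalf.mem_nhds hz)).harmonicAt_re
  refine (InnerProductSpace.harmonicAt_congr_nhds ?_).1 ha
  filter_upwards [isOpen_upperHalf.mem_nhds hz] with w hw using re_complexPot h hw

/-- The gradient of the real part of a holomorphic function is the conjugate of its derivative. -/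
lemma gradient_layerPot (h : IsDensity f) {z : ℂ} (hz : z ∈ upperHalf) :
    gradient (layerPot 0 f) z = strayField f z := by
  have h1 := (hasGradientAt_re (hasDerivAt_complexPot h hz)).gradient
  have h2 : (fun w => (complexPot f w).re) =ᶠ[𝓝 z] layerPot 0 f := by
    filter_upwards [isOpen_upperHalf.mem_nhds hz] with w hw using re_complexPot h hw
  rw [← h2.gradient_eq, h1, map_mul, ← integral_conj, strayField, Complex.real_smul]
  simp [logKernel]

lemma one_add_norm_sq_inv_le_gradWeight {z : ℂ} (hz : z ∈ upperHalf) :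
    1 / (1 + ‖z‖) ^ 2 ≤ gradWeight z := by
  have hz0 : z.im ≠ 0 := ne_of_gt hz
  have h1 : 0 < ‖z - 1‖ := norm_pos_iff.2 (by simpa using sub_ofReal_ne_zero hz0 1)
  have h2 : 0 < ‖z + 1‖ := norm_pos_iff.2 (by simpa using sub_ofReal_ne_zero hz0 (-1))
  have h3 : ‖z - 1‖ ≤ 1 + ‖z‖ := by
    have := norm_sub_le z 1; rw [norm_one] at this; linarith
  have h4 : ‖z + 1‖ ≤ 1 + ‖z‖ := by
    have := norm_add_le z 1; rw [norm_one] at this; linarith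
  rw [gradWeight]
  apply one_div_le_one_div_of_le (by positivity)
  rw [sq]
  gcongr
  rw [Real.sqrt_le_left (by positivity), sq]
  gcongr

/-- On a bounded support `gradWeight` is bounded below, so a bounded gradient is enough. -/
lemma isAdmissible_testFunction {ζ : ℂ → ℝ} (hζ : ContDiff ℝ ∞ ζ) (hc : HasCompactSupport ζ) :
    ∃ M, 0 ≤ M ∧ IsAdmissible M ζ (fun t => ζ t) := by
  have hdc : Continuous (fderiv ℝ ζ) := hζ.continuous_fderiv (by simp)
  obtain ⟨B, hB⟩ := hdc.bounded_above_of_compact_support (hc.fderiv ℝ)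
  obtain ⟨ρ, hρ⟩ := hc.isCompact.isBounded.exists_norm_le
  have hB0 : 0 ≤ B := (norm_nonneg _).trans (hB 0)
  refine ⟨B * (1 + |ρ|) ^ 2, by positivity, fun z _ => hζ.differentiable (by simp) z, ?_, ?_, ?_⟩
  · intro z hz
    by_cases hzs : z ∈ tsupport ζ
    · have h1 := one_add_norm_sq_inv_le_gradWeight hz
      have h2 : ‖z‖ ≤ |ρ| := (hρ z hzs).trans (le_abs_self _)
      rw [norm_gradient_eq]
      calc ‖fderiv ℝ ζ z‖ ≤ B := hB z
        _ = B * (1 + |ρ|) ^ 2 * (1 / (1 + |ρ|) ^ 2) := by field_simp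
        _ ≤ B * (1 + |ρ|) ^ 2 * (1 / (1 + ‖z‖) ^ 2) := by gcongr
        _ ≤ _ := by gcongr
    · have : ζ =ᶠ[𝓝 z] 0 := notMem_tsupport_iff_eventuallyEq.1 hzs
      have h0 : gradient ζ z = 0 := by
        rw [this.gradient_eq]; exact gradient_fun_const z 0
      rw [h0, norm_zero]
      have := gradWeight_nonneg z
      positivity
  · exact Eventually.of_forall fun t => (hζ.continuous.tendsto _).mono_left nhdsWithin_le_nhds
  · exact (hc.is_zero_at_infty).mono_left inf_le_left

lemma tendsto_layerPot_zero (h : IsDensity f) :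
    Tendsto (layerPot 0 f) (cocompact ℂ) (𝓝 0) := by
  have h1 : Tendsto (fun z : ℂ => 2 * densityMass f / ‖z‖) (cocompact ℂ) (𝓝 0) :=
    tendsto_const_nhds.div_atTop (tendsto_norm_cocompact_atTop (E := ℂ))
  refine squeeze_zero_norm' ?_ h1
  filter_upwards [(tendsto_norm_cocompact_atTop (E := ℂ)).eventually_ge_atTop 2] with z hz
  exact abs_layerPot_le_div h le_rfl hz

/-- The single layer potential is the stray field potential. -/
lemma isStrayPotential_layerPot {m₁ : ℝ → ℝ} (h : IsDensity (deriv m₁)) :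
    IsStrayPotential m₁ (fun x => layerPot 0 (deriv m₁) (toPlane.symm x)) := by
  refine ⟨fun x hx => ?_, ⟨_, memHomSobolevPlane_layerPot h, fun x _ => rfl⟩, fun ζ hζ => ?_, ?_⟩
  · obtain ⟨z, rfl⟩ := toPlane.surjective x
    exact harmonicAt_comp_toPlane_symm (harmonicAt_layerPot h (toPlane_mem_halfPlane.1 hx))
  · rw [setIntegral_toPlane, preimage_halfPlane]
    simp only [inner_gradient_toPlane, LinearIsometryEquiv.symm_apply_apply]
    obtain ⟨M, hM, hadm⟩ := isAdmissible_testFunction hζ.comp_toPlane.1 hζ.comp_toPlane.2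
    have := integral_inner_strayField hM hadm h.measurable h.integrableOn
    simp only [toPlane_ofReal] at this
    rw [← this]
    refine setIntegral_congr_fun measurableSet_upperHalf fun z hz => ?_
    rw [gradient_layerPot h hz]
  · refine Tendsto.mono_left ?_ inf_le_left
    exact (tendsto_layerPot_zero h).comp toPlane.symm.toHomeomorph.isClosedEmbedding.tendsto_cocompact

/-- The choice operator returns a genuine stray potential because the single layer potential is one.
-/
lemma isStrayPotential_strayPotential {m : ℝ → Plane} (h : IsDensity (deriv fun t => m t 0)) :
    IsStrayPotential (fun t => m t 0) (strayPotential m) :=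
  Classical.epsilon_spec ⟨_, isStrayPotential_layerPot h⟩

lemma gradient_apply_eq_fderiv (g : Plane → ℝ) (x : Plane) (i : Fin 2) :
    gradient g x i = fderiv ℝ g x (EuclideanSpace.single i 1) := by
  rw [← inner_gradient_left, EuclideanSpace.inner_single_right]; simp

lemma integrable_mul_of_tsupport {g φ : Plane → ℝ} {U : Set Plane} (hg : ContinuousOn g U)
    (hφ : Continuous φ) (hc : HasCompactSupport φ) (hU : tsupport φ ⊆ U) :
    Integrable (fun x => g x * φ x) := by
  have hK : IsCompact (tsupport φ) := hc
  have h1 : IntegrableOn (fun x => g x * φ x) (tsupport φ) :=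
    ((hg.mono hU).mul hφ.continuousOn).integrableOn_compact hK
  refine (integrableOn_iff_integrable_of_support_subset fun x hx => ?_).1 h1
  exact subset_tsupport φ (right_ne_zero_of_mul hx)

/-- On an open set where `u` is smooth, the weak gradient is the classical one. -/
lemma gradient_ae_eq_of_isWeakGradient {u v : Plane → ℝ} {G : Plane → Plane} {U : Set Plane}
    (hU : IsOpen U) (hu : ContDiffOn ℝ 2 u U) (hG : IsWeakGradient v G) (huv : Set.EqOn u v U) :
    ∀ᵐ x, x ∈ U → gradient u x = G x := by
  have hd : ContinuousOn (fderiv ℝ u) U := hu.continuousOn_fderiv_of_isOpen hU (by norm_num)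
  have hdi : ∀ i : Fin 2, ContinuousOn (fun x => gradient u x i) U := fun i => by
    simp only [gradient_apply_eq_fderiv]
    exact hd.clm_apply continuousOn_const
  have hGi : ∀ i : Fin 2, LocallyIntegrable (fun x => G x i) := fun i => by
    refine hG.2.1.mono ?_ (Eventually.of_forall fun x => ?_)
    · exact (by fun_prop : Continuous fun y : Plane => y i).comp_aestronglyMeasurable
        hG.2.1.aestronglyMeasurable
    · exact PiLp.norm_apply_le (G x) i
  have key : ∀ i : Fin 2, ∀ᵐ x, x ∈ U → gradient u x i - G x i = 0 := by
    intro i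
    -- The fundamental lemma of the calculus of variations: for φ supported in U, classical
    -- integration by parts for u and the weak identity for v have the same left side.
    refine hU.ae_eq_zero_of_integral_contDiff_smul_eq_zero
      (((hdi i).locallyIntegrableOn hU.measurableSet).sub ((hGi i).locallyIntegrableOn U))
      fun φ hφ hc hs => ?_
    have hφd : Continuous (fun x => fderiv ℝ φ x (EuclideanSpace.single i 1)) :=
      (hφ.continuous_fderiv (by simp)).clm_apply continuous_const
    have i1 : Integrable (fun x => gradient u x i * φ x) :=
      integrable_mul_of_tsupport (hdi i) hφ.continuous hc hs
    have i2 : Integrable (fun x => u x * fderiv ℝ φ x (EuclideanSpace.single i 1)) :=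
      integrable_mul_of_tsupport hu.continuousOn hφd (hc.fderiv_apply ℝ _)
        ((tsupport_fderiv_apply_subset ℝ _).trans hs)
    have i3 : Integrable (fun x => u x * φ x) :=
      integrable_mul_of_tsupport hu.continuousOn hφ.continuous hc hs
    have i4 : Integrable (fun x => G x i * φ x) := by
      have := (hGi i).integrable_smul_left_of_hasCompactSupport hφ.continuous hc
      simpa only [smul_eq_mul, mul_comm] using this
    have h1 := hG.2.2 φ ⟨hφ, hc⟩ i
    have h2 : ∫ x, v x * gradient φ x i = ∫ x, u x * fderiv ℝ φ x (EuclideanSpace.single i 1) := by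
      congr 1; ext1 x
      rw [gradient_apply_eq_fderiv]
      by_cases hx : x ∈ U
      · rw [huv hx]
      · have : fderiv ℝ φ x = 0 := by
          have := mt (fun h => hs (support_fderiv_subset ℝ h)) hx
          simpa using this
        simp [this]
    have h3 := integral_mul_fderiv_eq_neg_fderiv_mul_of_integrable (f := u) (g := φ)
      (v := EuclideanSpace.single i 1) (by simpa only [gradient_apply_eq_fderiv] using i1) i2 i3
      (fun x hx => (hu.differentiableOn (by norm_num)).differentiableAt (hU.mem_nhds (hs hx)))
      (fun x _ => hφ.differentiable (by simp) x)
    simp only [← gradient_apply_eq_fderiv] at h3 h2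
    rw [h2, h3] at h1
    have : ∀ x, φ x • (gradient u x i - G x i) = gradient u x i * φ x - G x i * φ x := fun x => by
      rw [smul_eq_mul]; ring
    simp_rw [this]
    rw [integral_sub i1 i4]
    linarith
  filter_upwards [key 0, key 1] with x h0 h1 hx
  ext i
  fin_cases i
  · exact sub_eq_zero.1 (h0 hx)
  · exact sub_eq_zero.1 (h1 hx)

lemma integral_norm_sq_eq {X E : Type*} [MeasurableSpace X] {μ : Measure X}
    [NormedAddCommGroup E] {b : X → E} (hb : MemLp b 2 μ) :
    ∫ x, ‖b x‖ ^ 2 ∂μ = (eLpNorm b 2 μ).toReal ^ 2 := by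
  have h0 : 0 ≤ ∫ x, ‖b x‖ ^ (2 : ℝ) ∂μ := integral_nonneg fun x => by positivity
  rw [hb.eLpNorm_eq_integral_rpow_norm (by norm_num) (by norm_num), ENNReal.toReal_ofReal
    (by simp only [ENNReal.toReal_ofNat]; positivity)]
  simp only [ENNReal.toReal_ofNat]
  rw [← Real.rpow_natCast, ← Real.rpow_mul h0]
  norm_num

/-- What the definition of a stray field potential says about its classical gradient. -/
lemma IsStrayPotential.exists_approx {m₁ : ℝ → ℝ} {u : Plane → ℝ} (h : IsStrayPotential m₁ u) :
    MemLp (gradient u) 2 (volume.restrict halfPlane) ∧ ∃ φ : ℕ → Plane → ℝ,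
      (∀ k, IsTestFunction (φ k)) ∧ Tendsto (fun k => eLpNorm (fun x => gradient u x -
        gradient (φ k) x) 2 (volume.restrict halfPlane)) atTop (𝓝 0) := by
  obtain ⟨v, ⟨G, hG, hG2, φ, hφ, hlim⟩, huv⟩ := h.mem
  have hae : gradient u =ᵐ[volume.restrict halfPlane] G :=
    (ae_restrict_iff' isOpen_halfPlane.measurableSet).2
      (gradient_ae_eq_of_isWeakGradient isOpen_halfPlane h.harmonic.contDiffOn hG huv)
  refine ⟨(memLp_congr_ae hae).2 (hG2.restrict _), φ, hφ, ?_⟩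
  refine tendsto_of_tendsto_of_tendsto_of_le_of_le tendsto_const_nhds hlim
    (fun _ => zero_le) fun k => ?_
  have : eLpNorm (fun x => gradient u x - gradient (φ k) x) 2 (volume.restrict halfPlane) =
      eLpNorm (fun x => G x - gradient (φ k) x) 2 (volume.restrict halfPlane) :=
    eLpNorm_congr_ae (by filter_upwards [hae] with x hx; rw [hx])
  simp only
  rw [this]
  exact eLpNorm_restrict_le _ _ _ _

lemma IsTestFunction.memLp_gradient {ζ : Plane → ℝ} (h : IsTestFunction ζ) (μ : Measure Plane)
    [IsFiniteMeasureOnCompacts μ] : MemLp (gradient ζ) 2 μ := by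
  have hc : Continuous (gradient ζ) := (InnerProductSpace.toDual ℝ Plane).symm.continuous.comp
    (h.1.continuous_fderiv (by simp))
  have hs : HasCompactSupport (gradient ζ) :=
    (h.2.fderiv ℝ).comp_left (g := (InnerProductSpace.toDual ℝ Plane).symm) (map_zero _)
  exact hc.memLp_of_hasCompactSupport hs

lemma integrable_inner_of_memLp {X E : Type*} [MeasurableSpace X] {μ : Measure X}
    [NormedAddCommGroup E] [InnerProductSpace ℝ E] {a b : X → E} (ha : MemLp a 2 μ)
    (hb : MemLp b 2 μ) : Integrable (fun x => inner ℝ (a x) (b x)) μ := by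
  refine (ha.norm.integrable_mul hb.norm).mono' (ha.1.inner hb.1)
    (Eventually.of_forall fun x => norm_inner_le_norm _ _)

lemma abs_integral_inner_le {X E : Type*} [MeasurableSpace X] {μ : Measure X}
    [NormedAddCommGroup E] [InnerProductSpace ℝ E] {a b : X → E} (ha : MemLp a 2 μ)
    (hb : MemLp b 2 μ) : |∫ x, inner ℝ (a x) (b x) ∂μ| ≤
      (eLpNorm a 2 μ).toReal * (eLpNorm b 2 μ).toReal := by
  have h1 : |∫ x, inner ℝ (a x) (b x) ∂μ| ≤ ∫ x, ‖a x‖ * ‖b x‖ ∂μ :=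
    norm_integral_le_of_norm_le (f := fun x => inner ℝ (a x) (b x)) (ha.norm.integrable_mul hb.norm)
      (Eventually.of_forall fun x => norm_inner_le_norm _ _)
  have h2 := sq_integral_mul_le ha.norm hb.norm
  rw [integral_norm_sq_eq ha, integral_norm_sq_eq hb, ← mul_pow] at h2
  exact h1.trans ((sq_le_sq₀ (integral_nonneg fun x => by positivity) (by positivity)).1 h2)

/-- The gradient of the stray field potential is unique. -/
lemma IsStrayPotential.gradient_ae_eq {m₁ : ℝ → ℝ} {u u' : Plane → ℝ} (h : IsStrayPotential m₁ u)
    (h' : IsStrayPotential m₁ u') :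
    gradient u =ᵐ[volume.restrict halfPlane] gradient u' := by
  obtain ⟨hu, φ, hφ, hl⟩ := h.exists_approx
  obtain ⟨hu', φ', hφ', hl'⟩ := h'.exists_approx
  set μ := volume.restrict halfPlane with hμ
  have hw : MemLp (fun x => gradient u x - gradient u' x) 2 μ := hu.sub hu'
  have h0 : ∀ ζ, IsTestFunction ζ →
      ∫ x, inner ℝ (gradient u x - gradient u' x) (gradient ζ x) ∂μ = 0 := by
    intro ζ hζ
    have hζm := hζ.memLp_gradient μ
    simp_rw [inner_sub_left]
    rw [integral_sub (integrable_inner_of_memLp hu hζm) (integrable_inner_of_memLp hu' hζm),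
      h.weak_eq ζ hζ, h'.weak_eq ζ hζ, sub_self]
  set A := (eLpNorm (fun x => gradient u x - gradient u' x) 2 μ).toReal with hA
  -- The difference of the two gradients is orthogonal to gradients of test functions, which may
  -- therefore be subtracted in the second factor of its square. Letting k tend to infinity forces A
  -- = 0.
  have hle : ∀ k, A ^ 2 ≤ A * (eLpNorm (fun x => gradient u x - gradient (φ k) x) 2 μ).toReal +
      A * (eLpNorm (fun x => gradient u' x - gradient (φ' k) x) 2 μ).toReal := by
    intro k
    have hm := (hφ k).memLp_gradient μ
    have hm' := (hφ' k).memLp_gradient μ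
    have b1 := abs_integral_inner_le hw (hu.sub hm)
    have b2 := abs_integral_inner_le hw (hu'.sub hm')
    rw [← integral_norm_sq_eq hw]
    have e : ∫ x, ‖gradient u x - gradient u' x‖ ^ 2 ∂μ =
        (∫ x, inner ℝ (gradient u x - gradient u' x) ((gradient u - gradient (φ k)) x) ∂μ) -
        ∫ x, inner ℝ (gradient u x - gradient u' x) ((gradient u' - gradient (φ' k)) x) ∂μ := by
      have s1 := integrable_inner_of_memLp hw hu
      have s2 := integrable_inner_of_memLp hw hu'
      have s3 := integrable_inner_of_memLp hw hm
      have s4 := integrable_inner_of_memLp hw hm'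
      simp only [Pi.sub_apply]
      simp_rw [← real_inner_self_eq_norm_sq]
      have e1 : ∀ x, inner ℝ (gradient u x - gradient u' x) (gradient u x - gradient u' x) =
          inner ℝ (gradient u x - gradient u' x) (gradient u x) -
          inner ℝ (gradient u x - gradient u' x) (gradient u' x) := fun x => inner_sub_right _ _ _
      simp_rw [e1, inner_sub_right (_ - _ : Plane) _ (gradient (φ k) _),
        inner_sub_right (_ - _ : Plane) _ (gradient (φ' k) _)]
      rw [integral_sub s1 s2, integral_sub s1 s3, integral_sub s2 s4, h0 _ (hφ k), h0 _ (hφ' k)]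
      ring
    rw [e]
    have c1 := le_abs_self (∫ x, inner ℝ (gradient u x - gradient u' x)
      ((gradient u - gradient (φ k)) x) ∂μ)
    have c2 := neg_abs_le (∫ x, inner ℝ (gradient u x - gradient u' x)
      ((gradient u' - gradient (φ' k)) x) ∂μ)
    have d1 := c1.trans b1
    have d2 := (neg_le_neg b2).trans c2
    rw [← hA] at d1 d2
    refine (sub_le_sub d1 d2).trans (le_of_eq ?_)
    rw [sub_neg_eq_add]; rfl
  have ht := (ENNReal.tendsto_toReal ENNReal.zero_ne_top).comp hl
  have ht' := (ENNReal.tendsto_toReal ENNReal.zero_ne_top).comp hl'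
  have hlim := ge_of_tendsto' ((ht.const_mul A).add (ht'.const_mul A)) hle
  simp only [ENNReal.toReal_zero, mul_zero, add_zero] at hlim
  have hA0 : A = 0 := by
    have : A ^ 2 = 0 := le_antisymm hlim (sq_nonneg _)
    simpa using this
  rw [hA, ENNReal.toReal_eq_zero_iff] at hA0
  have h1 := (eLpNorm_eq_zero_iff hw.1 (by norm_num)).1 (hA0.resolve_right hw.2.ne)
  filter_upwards [h1] with x hx using sub_eq_zero.1 hx

end

/-! ### The conformal map onto the half-strip, in elliptic coordinates -/

section
lemma cosh_re (w : ℂ) : (Complex.cosh w).re = Real.cosh w.re * Real.cos w.im := by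
  conv_lhs => rw [← Complex.re_add_im w, Complex.cosh_add, Complex.cosh_mul_I, Complex.sinh_mul_I]
  simp [← Complex.ofReal_cosh, ← Complex.ofReal_sinh, ← Complex.ofReal_cos, ← Complex.ofReal_sin]

lemma cosh_im (w : ℂ) : (Complex.cosh w).im = Real.sinh w.re * Real.sin w.im := by
  conv_lhs => rw [← Complex.re_add_im w, Complex.cosh_add, Complex.cosh_mul_I, Complex.sinh_mul_I]
  simp [← Complex.ofReal_cosh, ← Complex.ofReal_sinh, ← Complex.ofReal_cos, ← Complex.ofReal_sin]

/-- The map cosh introduces confocal elliptic coordinates with foci ±1: sum and difference of the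
focal distances are 2 cosh(Re w) and 2 cos(Im w). This makes the inverse explicit. -/
lemma norm_cosh_add_one (w : ℂ) : ‖Complex.cosh w + 1‖ = Real.cosh w.re + Real.cos w.im := by
  have h0 : 0 ≤ Real.cosh w.re + Real.cos w.im := by
    linarith [Real.one_le_cosh w.re, Real.neg_one_le_cos w.im]
  rw [← sq_eq_sq₀ (norm_nonneg _) h0, Complex.sq_norm, Complex.normSq_apply]
  simp only [Complex.add_re, Complex.add_im, Complex.one_re, Complex.one_im, cosh_re, cosh_im]
  have h1 := Real.cosh_sq w.re
  have h2 := Real.sin_sq w.im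
  linear_combination (Real.sin w.im ^ 2) * (-h1) + (Real.cosh w.re ^ 2 - 1) * h2

lemma norm_cosh_sub_one (w : ℂ) : ‖Complex.cosh w - 1‖ = Real.cosh w.re - Real.cos w.im := by
  have h0 : 0 ≤ Real.cosh w.re - Real.cos w.im := by
    linarith [Real.one_le_cosh w.re, Real.cos_le_one w.im]
  rw [← sq_eq_sq₀ (norm_nonneg _) h0, Complex.sq_norm, Complex.normSq_apply]
  simp only [Complex.sub_re, Complex.sub_im, Complex.one_re, Complex.one_im, cosh_re, cosh_im]
  have h1 := Real.cosh_sq w.re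
  have h2 := Real.sin_sq w.im
  linear_combination (Real.sin w.im ^ 2) * (-h1) + (Real.cosh w.re ^ 2 - 1) * h2

/-- The inverse of `cosh` on the half-strip, in elliptic coordinates. -/
noncomputable def coshInv (c : ℂ) : ℂ :=
  ⟨Real.arcosh ((‖c + 1‖ + ‖c - 1‖) / 2), Real.arccos ((‖c + 1‖ - ‖c - 1‖) / 2)⟩

lemma coshInv_cosh {w : ℂ} (hw : w ∈ halfStrip) : coshInv (Complex.cosh w) = w := by
  rw [coshInv, norm_cosh_add_one, norm_cosh_sub_one]
  apply Complex.ext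
  · simp only
    rw [show (Real.cosh w.re + Real.cos w.im + (Real.cosh w.re - Real.cos w.im)) / 2 =
      Real.cosh w.re by ring, Real.arcosh_cosh hw.1.le]
  · simp only
    rw [show (Real.cosh w.re + Real.cos w.im - (Real.cosh w.re - Real.cos w.im)) / 2 =
      Real.cos w.im by ring, Real.arccos_cos hw.2.1.le hw.2.2.le]

/-- The weak inequalities are triangle inequalities between the foci. They are strict because (σ² -
1)(1 - τ²) = (Im c)², where σ and τ are half the sum and half the difference of the focal distances.
-/
lemma elliptic_bounds {c : ℂ} (hc : 0 < c.im) : 1 < (‖c + 1‖ + ‖c - 1‖) / 2 ∧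
    -1 < (‖c + 1‖ - ‖c - 1‖) / 2 ∧ (‖c + 1‖ - ‖c - 1‖) / 2 < 1 := by
  set p := ‖c + 1‖ with hp
  set q := ‖c - 1‖ with hq
  have hp2 : p ^ 2 = (c.re + 1) ^ 2 + c.im ^ 2 := by
    rw [hp, Complex.sq_norm, Complex.normSq_apply]; simp; ring
  have hq2 : q ^ 2 = (c.re - 1) ^ 2 + c.im ^ 2 := by
    rw [hq, Complex.sq_norm, Complex.normSq_apply]; simp; ring
  have hp0 : 0 ≤ p := norm_nonneg _
  have hq0 : 0 ≤ q := norm_nonneg _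
  have h1 : 2 ≤ p + q := by
    have := norm_sub_le (c + 1) (c - 1)
    rw [show c + 1 - (c - 1) = 2 by ring] at this
    simpa using this
  have h2 : |p - q| ≤ 2 := by
    have := abs_norm_sub_norm_le (c + 1) (c - 1)
    rw [show c + 1 - (c - 1) = 2 by ring] at this
    simpa using this
  have key : (((p + q) / 2) ^ 2 - 1) * (1 - ((p - q) / 2) ^ 2) = c.im ^ 2 := by
    have e1 : (p + q) * (p - q) = 4 * c.re := by nlinarith
    have e2 : ((p + q) / 2) ^ 2 + ((p - q) / 2) ^ 2 = c.re ^ 2 + 1 + c.im ^ 2 := by nlinarith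
    have e3 : ((p + q) / 2) ^ 2 * ((p - q) / 2) ^ 2 = c.re ^ 2 := by
      have : ((p + q) / 2) ^ 2 * ((p - q) / 2) ^ 2 = ((p + q) * (p - q)) ^ 2 / 16 := by ring
      rw [this, e1]; ring
    linear_combination e2 - e3
  have hpos : 0 < c.im ^ 2 := by positivity
  rw [abs_le] at h2
  have hA : (p + q) / 2 ≠ 1 := fun h => by rw [h] at key; nlinarith
  have hB : (p - q) / 2 ≠ 1 := fun h => by rw [h] at key; nlinarith
  have hB' : (p - q) / 2 ≠ -1 := fun h => by rw [h] at key; nlinarith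
  refine ⟨lt_of_le_of_ne (by linarith) hA.symm, lt_of_le_of_ne (by linarith) hB'.symm,
    lt_of_le_of_ne (by linarith) hB⟩

lemma coshInv_mem {c : ℂ} (hc : 0 < c.im) : coshInv c ∈ halfStrip := by
  obtain ⟨h1, h2, h3⟩ := elliptic_bounds hc
  refine ⟨Real.arcosh_pos h1, Real.arccos_pos.2 h3, ?_⟩
  simp only [coshInv]
  exact lt_of_le_of_ne (Real.arccos_le_pi _) fun h => by
    rw [Real.arccos_eq_pi] at h; linarith

/-- The real part and the distance to -1 agree, which fixes the imaginary part up to sign; both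
imaginary parts are positive. -/
lemma cosh_coshInv {c : ℂ} (hc : 0 < c.im) : Complex.cosh (coshInv c) = c := by
  obtain ⟨h1, h2, h3⟩ := elliptic_bounds hc
  have hp2 : ‖c + 1‖ ^ 2 = (c.re + 1) ^ 2 + c.im ^ 2 := by
    rw [Complex.sq_norm, Complex.normSq_apply]; simp; ring
  have hq2 : ‖c - 1‖ ^ 2 = (c.re - 1) ^ 2 + c.im ^ 2 := by
    rw [Complex.sq_norm, Complex.normSq_apply]; simp; ring
  have hre : (Complex.cosh (coshInv c)).re = c.re := by
    rw [cosh_re]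
    simp only [coshInv]
    rw [Real.cosh_arcosh h1.le, Real.cos_arccos h2.le h3.le]
    nlinarith
  have him0 : 0 < (Complex.cosh (coshInv c)).im := by
    have := coshInv_mem hc
    rw [cosh_im]
    exact mul_pos (Real.sinh_pos_iff.2 this.1) (Real.sin_pos_of_pos_of_lt_pi this.2.1 this.2.2)
  have hn := norm_cosh_add_one (coshInv c)
  simp only [coshInv] at hn
  rw [Real.cosh_arcosh h1.le, Real.cos_arccos h2.le h3.le] at hn
  have hn2 : ‖Complex.cosh (coshInv c) + 1‖ ^ 2 = ‖c + 1‖ ^ 2 := by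
    rw [coshInv, hn]; ring
  rw [hp2, Complex.sq_norm, Complex.normSq_apply] at hn2
  simp only [Complex.add_re, Complex.one_re, Complex.add_im, Complex.one_im, add_zero, hre] at hn2
  refine Complex.ext hre ?_
  have : (Complex.cosh (coshInv c)).im ^ 2 = c.im ^ 2 := by nlinarith
  exact (sq_eq_sq₀ him0.le hc.le).1 this

lemma sinh_ne_zero {w : ℂ} (hw : w ∈ halfStrip) : Complex.sinh w ≠ 0 := by
  intro h
  have h1 := Complex.cosh_sq w
  rw [h] at h1
  have h2 : (Complex.cosh w - 1) * (Complex.cosh w + 1) = 0 := by linear_combination h1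
  have him : 0 < (Complex.cosh w).im := by
    rw [cosh_im]
    exact mul_pos (Real.sinh_pos_iff.2 hw.1) (Real.sin_pos_of_pos_of_lt_pi hw.2.1 hw.2.2)
  rcases mul_eq_zero.1 h2 with h3 | h3
  · have := congrArg Complex.im h3; simp at this; linarith
  · have := congrArg Complex.im h3; simp at this; linarith

lemma continuousAt_coshInv {c : ℂ} (hc : 0 < c.im) : ContinuousAt coshInv c := by
  obtain ⟨h1, h2, h3⟩ := elliptic_bounds hc
  have e : coshInv = fun c : ℂ =>
      ((Real.arcosh ((‖c + 1‖ + ‖c - 1‖) / 2) : ℝ) : ℂ) +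
        ((Real.arccos ((‖c + 1‖ - ‖c - 1‖) / 2) : ℝ) : ℂ) * Complex.I := by
    ext1 c; exact Complex.mk_eq_add_mul_I _ _
  rw [e]
  have c1 : ContinuousAt Real.arcosh ((‖c + 1‖ + ‖c - 1‖) / 2) :=
    (Real.differentiableAt_arcosh h1).continuousAt
  have c2 : ContinuousAt (fun c : ℂ => (‖c + 1‖ + ‖c - 1‖) / 2) c := by fun_prop
  have c3 : ContinuousAt (fun c : ℂ => Real.arcosh ((‖c + 1‖ + ‖c - 1‖) / 2)) c :=
    ContinuousAt.comp (g := Real.arcosh) c1 c2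
  have c4 : Continuous (fun c : ℂ => Real.arccos ((‖c + 1‖ - ‖c - 1‖) / 2)) :=
    Real.continuous_arccos.comp (by fun_prop)
  exact (Complex.continuous_ofReal.continuousAt.comp c3).add
    ((Complex.continuous_ofReal.continuousAt.comp c4.continuousAt).mul continuousAt_const)

lemma hasDerivAt_coshInv {c : ℂ} (hc : 0 < c.im) :
    HasDerivAt coshInv (Complex.sinh (coshInv c))⁻¹ c := by
  refine HasDerivAt.of_local_left_inverse (continuousAt_coshInv hc)
    (Complex.hasDerivAt_cosh _) (sinh_ne_zero (coshInv_mem hc)) ?_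
  filter_upwards [(isOpen_lt continuous_const Complex.continuous_im).mem_nhds hc] with x hx
    using cosh_coshInv hx

lemma stripMap_injOn : Set.InjOn stripMap halfStrip := by
  intro w hw w' hw' h
  have : Complex.cosh w = Complex.cosh w' := by
    simp only [stripMap, neg_div, one_div, neg_inj, inv_inj] at h
    exact h
  rw [← coshInv_cosh hw, this, coshInv_cosh hw']

lemma neg_inv_im {z : ℂ} (hz : z ∈ upperHalf) : 0 < (-1 / z).im := by
  have hz0 : z ≠ 0 := fun h => by simp [h, upperHalf] at hz
  have : 0 < z.im := hz
  have hn : 0 < Complex.normSq z := Complex.normSq_pos.2 hz0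
  rw [neg_div, Complex.neg_im, one_div, Complex.inv_im, neg_div, neg_neg]
  positivity

/-- Identifies the abstract inverse in `basicTail` with an explicit formula, by injectivity of the
strip map on the half-strip. -/
lemma invFunOn_stripMap {z : ℂ} (hz : z ∈ upperHalf) :
    Function.invFunOn stripMap halfStrip z = coshInv (-1 / z) := by
  have hz0 : z ≠ 0 := fun h => by simp [h, upperHalf] at hz
  have h1 : stripMap (coshInv (-1 / z)) = z := by
    rw [stripMap, cosh_coshInv (neg_inv_im hz)]; field_simp
  have h2 := coshInv_mem (neg_inv_im hz)
  have hex : ∃ w ∈ halfStrip, stripMap w = z := ⟨_, h2, h1⟩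
  exact stripMap_injOn (Function.invFunOn_mem hex) h2 ((Function.invFunOn_eq hex).trans h1.symm)

/-- The conformal map `F⁻¹ ∘ Φ_{-b}` from the half-plane to the half-strip. -/
noncomputable def tailMap (b : ℝ) (z : ℂ) : ℂ := coshInv (-1 / moebius (-b) z)

/-- The hyperbolic cosine of the real part of `tailMap`. -/
noncomputable def tailCosh (b : ℝ) (z : ℂ) : ℝ :=
  ((1 + b) * ‖z - 1‖ + (1 - b) * ‖z + 1‖) / (2 * ‖z - b‖)

/-- The cosine of the imaginary part of `tailMap`. -/
noncomputable def tailCos (b : ℝ) (z : ℂ) : ℝ :=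
  ((1 + b) * ‖z - 1‖ - (1 - b) * ‖z + 1‖) / (2 * ‖z - b‖)

/-- The squared modulus of the derivative of `tailMap`. -/
noncomputable def tailDensity (b : ℝ) (z : ℂ) : ℝ :=
  (1 - b ^ 2) / (‖z - b‖ ^ 2 * (‖z - 1‖ * ‖z + 1‖))

lemma moebius_neg (b : ℝ) (z : ℂ) : moebius (-b) z = (z - b) / (1 - b * z) := by
  simp [moebius, sub_eq_add_neg]

variable {b : ℝ}

lemma one_sub_mul_ne_zero (b : ℝ) {z : ℂ} (hz : z ∈ upperHalf) :
    (1 : ℂ) - b * z ≠ 0 := by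
  intro h
  have h1 := congrArg Complex.im h
  have h2 := congrArg Complex.re h
  have hz0 : z.im ≠ 0 := ne_of_gt hz
  simp at h1 h2
  rcases h1 with h1 | h1
  · rw [h1] at h2; simp at h2
  · exact hz0 h1

lemma sub_ne_zero_of_upper {z : ℂ} (hz : z ∈ upperHalf) (t : ℝ) : z - t ≠ 0 :=
  sub_ofReal_ne_zero (ne_of_gt hz) t

lemma sub_one_ne_zero_of_upper {z : ℂ} (hz : z ∈ upperHalf) : z - 1 ≠ 0 := by
  simpa using sub_ne_zero_of_upper hz 1

lemma add_one_ne_zero_of_upper {z : ℂ} (hz : z ∈ upperHalf) : z + 1 ≠ 0 := by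
  simpa using sub_ne_zero_of_upper hz (-1)

lemma neg_inv_moebius (b : ℝ) (z : ℂ) : -1 / moebius (-b) z = -(1 - b * z) / (z - b) := by
  rw [moebius_neg, div_div_eq_mul_div, neg_one_mul]

/-- Visible from the form b - (1 - b²)/(z - b), since 1 - b² > 0. -/
lemma neg_inv_moebius_im (hb : b ∈ Set.Ioo (-1 : ℝ) 1) {z : ℂ} (hz : z ∈ upperHalf) :
    0 < (-1 / moebius (-b) z).im := by
  have h1 := sub_ne_zero_of_upper hz b
  have e : -1 / moebius (-b) z = b - (1 - b ^ 2) * (z - b)⁻¹ := by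
    rw [neg_inv_moebius]; field_simp; ring
  have hz0 : 0 < z.im := hz
  have hn : 0 < Complex.normSq (z - b) := Complex.normSq_pos.2 h1
  have e2 : ((1 : ℂ) - b ^ 2) = ((1 - b ^ 2 : ℝ) : ℂ) := by push_cast; ring
  rw [e, e2, Complex.sub_im, Complex.im_ofReal_mul, Complex.inv_im, Complex.sub_im,
    Complex.ofReal_im, sub_zero]
  have hb2 : 0 < 1 - b ^ 2 := by nlinarith [hb.1, hb.2]
  rw [zero_sub, neg_div, mul_neg, neg_neg]
  positivity

lemma moebius_mem (hb : b ∈ Set.Ioo (-1 : ℝ) 1) {z : ℂ} (hz : z ∈ upperHalf) :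
    moebius (-b) z ∈ upperHalf := by
  have h := neg_inv_im (z := -1 / moebius (-b) z) (neg_inv_moebius_im hb hz)
  have h0 : moebius (-b) z ≠ 0 := by
    rw [moebius_neg]
    exact div_ne_zero (sub_ne_zero_of_upper hz b) (one_sub_mul_ne_zero b hz)
  rwa [show -1 / (-1 / moebius (-b) z) = moebius (-b) z by field_simp] at h

lemma basicTail_moebius (hb : b ∈ Set.Ioo (-1 : ℝ) 1) {z : ℂ} (hz : z ∈ upperHalf) :
    basicTail (moebius (-b) z) = Real.pi / 2 - (tailMap b z).im := by
  rw [basicTail, invFunOn_stripMap (moebius_mem hb hz), tailMap]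

lemma norm_neg_inv_moebius_add_one (hb : b ∈ Set.Ioo (-1 : ℝ) 1) {z : ℂ} (hz : z ∈ upperHalf) :
    ‖-1 / moebius (-b) z + 1‖ = (1 + b) * ‖z - 1‖ / ‖z - b‖ := by
  have h1 := sub_ne_zero_of_upper hz b
  have e : -1 / moebius (-b) z + 1 = ((1 + b : ℝ) : ℂ) * (z - 1) / (z - b) := by
    rw [neg_inv_moebius]; push_cast; field_simp; ring
  rw [e, norm_div, norm_mul, Complex.norm_real, Real.norm_of_nonneg (by linarith [hb.1])]

lemma norm_neg_inv_moebius_sub_one (hb : b ∈ Set.Ioo (-1 : ℝ) 1) {z : ℂ} (hz : z ∈ upperHalf) :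
    ‖-1 / moebius (-b) z - 1‖ = (1 - b) * ‖z + 1‖ / ‖z - b‖ := by
  have h1 := sub_ne_zero_of_upper hz b
  have e : -1 / moebius (-b) z - 1 = -(((1 - b : ℝ) : ℂ) * (z + 1) / (z - b)) := by
    rw [neg_inv_moebius]; push_cast; field_simp; ring
  rw [e, norm_neg, norm_div, norm_mul, Complex.norm_real, Real.norm_of_nonneg (by linarith [hb.2])]

lemma tailMap_mem (hb : b ∈ Set.Ioo (-1 : ℝ) 1) {z : ℂ} (hz : z ∈ upperHalf) :
    tailMap b z ∈ halfStrip := coshInv_mem (neg_inv_moebius_im hb hz)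

lemma cosh_tailMap (hb : b ∈ Set.Ioo (-1 : ℝ) 1) {z : ℂ} (hz : z ∈ upperHalf) :
    Complex.cosh (tailMap b z) = -1 / moebius (-b) z := cosh_coshInv (neg_inv_moebius_im hb hz)

lemma cosh_re_tailMap (hb : b ∈ Set.Ioo (-1 : ℝ) 1) {z : ℂ} (hz : z ∈ upperHalf) :
    Real.cosh (tailMap b z).re = tailCosh b z := by
  have h1 := norm_cosh_add_one (tailMap b z)
  have h2 := norm_cosh_sub_one (tailMap b z)
  rw [cosh_tailMap hb hz, norm_neg_inv_moebius_add_one hb hz] at h1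
  rw [cosh_tailMap hb hz, norm_neg_inv_moebius_sub_one hb hz] at h2
  have h3 : 0 < ‖z - b‖ := norm_pos_iff.2 (sub_ne_zero_of_upper hz b)
  rw [tailCosh, mul_comm 2, ← div_div, add_div]
  linarith

lemma cos_im_tailMap (hb : b ∈ Set.Ioo (-1 : ℝ) 1) {z : ℂ} (hz : z ∈ upperHalf) :
    Real.cos (tailMap b z).im = tailCos b z := by
  have h1 := norm_cosh_add_one (tailMap b z)
  have h2 := norm_cosh_sub_one (tailMap b z)
  rw [cosh_tailMap hb hz, norm_neg_inv_moebius_add_one hb hz] at h1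
  rw [cosh_tailMap hb hz, norm_neg_inv_moebius_sub_one hb hz] at h2
  rw [tailCos, mul_comm 2, ← div_div, sub_div]
  linarith

lemma pi_div_two_sub_im_tailMap (hb : b ∈ Set.Ioo (-1 : ℝ) 1) {z : ℂ} (hz : z ∈ upperHalf) :
    Real.pi / 2 - (tailMap b z).im = Real.arcsin (tailCos b z) := by
  have h := tailMap_mem hb hz
  rw [← cos_im_tailMap hb hz, ← Real.sin_pi_div_two_sub, Real.arcsin_sin] <;>
  linarith [h.2.1, h.2.2]

lemma one_le_tailCosh (hb : b ∈ Set.Ioo (-1 : ℝ) 1) {z : ℂ} (hz : z ∈ upperHalf) :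
    1 ≤ tailCosh b z := by
  rw [← cosh_re_tailMap hb hz]; exact Real.one_le_cosh _

lemma injOn_tailMap (hb : b ∈ Set.Ioo (-1 : ℝ) 1) : Set.InjOn (tailMap b) upperHalf := by
  intro z hz z' hz' h
  have h1 := congrArg Complex.cosh h
  rw [cosh_tailMap hb hz, cosh_tailMap hb hz', neg_inv_moebius, neg_inv_moebius,
    div_eq_div_iff (sub_ne_zero_of_upper hz b) (sub_ne_zero_of_upper hz' b)] at h1
  have hb2 : ((1 - b ^ 2 : ℝ) : ℂ) ≠ 0 := by
    have : 0 < 1 - b ^ 2 := by nlinarith [hb.1, hb.2]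
    exact_mod_cast this.ne'
  have h2 : ((1 - b ^ 2 : ℝ) : ℂ) * (z - z') = 0 := by push_cast; linear_combination h1
  exact sub_eq_zero.1 ((mul_eq_zero.1 h2).resolve_left hb2)

/-- `tailMap` is holomorphic, and the squared modulus of its derivative is `tailDensity`. -/
lemma exists_hasDerivAt_tailMap (hb : b ∈ Set.Ioo (-1 : ℝ) 1) {z : ℂ} (hz : z ∈ upperHalf) :
    ∃ d, HasDerivAt (tailMap b) d z ∧ ‖d‖ ^ 2 = tailDensity b z := by
  have h1 := sub_ne_zero_of_upper hz b
  have hc := neg_inv_moebius_im hb hz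
  have hd : HasDerivAt (fun z => -1 / moebius (-b) z) (((1 - b ^ 2 : ℝ) : ℂ) / (z - b) ^ 2) z := by
    have e : (fun z => -1 / moebius (-b) z) = fun z => -(1 - b * z) / (z - (b : ℂ)) := by
      ext1 z; exact neg_inv_moebius b z
    rw [e]
    have := ((((hasDerivAt_id z).const_mul (b : ℂ)).const_sub 1).neg).div
      ((hasDerivAt_id z).sub_const (b : ℂ)) h1
    refine this.congr_deriv ?_
    simp only [id, Pi.neg_apply]
    push_cast
    ring
  refine ⟨_, (hasDerivAt_coshInv hc).comp z hd, ?_⟩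
  set w := coshInv (-1 / moebius (-b) z) with hw
  -- Here sinh² = (cosh + 1)(cosh - 1), and both factors are known rational functions of z. This is
  -- the origin of the inverse square root singularities at ±1.
  have hs : ‖Complex.sinh w‖ ^ 2 = (1 - b ^ 2) * (‖z - 1‖ * ‖z + 1‖) / ‖z - b‖ ^ 2 := by
    have e : Complex.sinh w ^ 2 = (-1 / moebius (-b) z + 1) * (-1 / moebius (-b) z - 1) := by
      have := Complex.cosh_sq w
      rw [hw, cosh_coshInv hc] at this
      linear_combination -this
    rw [← norm_pow, e, norm_mul, norm_neg_inv_moebius_add_one hb hz,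
      norm_neg_inv_moebius_sub_one hb hz]
    ring
  have hb2 : 0 < 1 - b ^ 2 := by nlinarith [hb.1, hb.2]
  have n1 : 0 < ‖z - b‖ := norm_pos_iff.2 h1
  have n2 : 0 < ‖z - 1‖ := norm_pos_iff.2 (sub_one_ne_zero_of_upper hz)
  have n3 : 0 < ‖z + 1‖ := norm_pos_iff.2 (add_one_ne_zero_of_upper hz)
  rw [norm_mul, norm_inv, mul_pow, inv_pow, hs, norm_div, norm_pow, Complex.norm_real,
    Real.norm_of_nonneg hb2.le, tailDensity]
  field_simp

end

/-! ### Conformal area and the truncated tails -/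

section
lemma volume_reProdIm_le (a c p q : ℝ) :
    volume {w : ℂ | w.re ∈ Set.Icc a c ∧ w.im ∈ Set.Ioo p q} =
      ENNReal.ofReal (c - a) * ENNReal.ofReal (q - p) := by
  have h := Complex.volume_preserving_equiv_real_prod.measure_preimage
    (s := Set.Icc a c ×ˢ Set.Ioo p q) (measurableSet_Icc.prod measurableSet_Ioo).nullMeasurableSet
  rw [Measure.volume_eq_prod, Measure.prod_prod, Real.volume_Icc, Real.volume_Ioo] at h
  exact h

/-- The real Jacobian of multiplication by d is the field norm of d from ℂ to ℝ. -/
lemma det_mul_complex (d : ℂ) :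
    ((ContinuousLinearMap.toSpanSingleton ℂ d).restrictScalars ℝ).det = ‖d‖ ^ 2 := by
  rw [Complex.sq_norm, ← Algebra.norm_complex_apply, Algebra.norm_apply]
  change LinearMap.det _ = _
  congr 1
  ext1 v
  simp [mul_comm]

variable {b : ℝ}

lemma measurable_tailCosh (b : ℝ) : Measurable (tailCosh b) := by unfold tailCosh; fun_prop

lemma measurable_tailDensity (b : ℝ) : Measurable (tailDensity b) := by unfold tailDensity; fun_prop

lemma tailDensity_nonneg (hb : b ∈ Set.Ioo (-1 : ℝ) 1) (z : ℂ) : 0 ≤ tailDensity b z := by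
  have hb2 : 0 < 1 - b ^ 2 := by nlinarith [hb.1, hb.2]
  unfold tailDensity; positivity

/-- The region of the half-plane where `tailCosh` lies between two bounds. -/
def tailRegion (b lo hi : ℝ) : Set ℂ := {z | z ∈ upperHalf ∧ lo ≤ tailCosh b z ∧ tailCosh b z ≤ hi}

lemma measurableSet_tailRegion (b lo hi : ℝ) : MeasurableSet (tailRegion b lo hi) :=
  measurableSet_upperHalf.inter ((measurableSet_le measurable_const (measurable_tailCosh b)).inter
    (measurableSet_le (measurable_tailCosh b) measurable_const))

/-- The conformal area of a region between two level sets of `tailCosh`. -/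
lemma lintegral_tailDensity_le (hb : b ∈ Set.Ioo (-1 : ℝ) 1) {lo hi : ℝ} (hlo : 0 < lo) :
    ∫⁻ z in tailRegion b lo hi, ENNReal.ofReal (tailDensity b z) ≤
      ENNReal.ofReal (Real.pi * (Real.log (2 * hi) - Real.log lo)) := by
  choose! d hd hdn using fun z (hz : z ∈ upperHalf) => exists_hasDerivAt_tailMap hb hz
  have hcv := lintegral_image_eq_lintegral_abs_det_fderiv_mul (volume : Measure ℂ)
    (f := tailMap b) (f' := fun z => (ContinuousLinearMap.toSpanSingleton ℂ (d z)).restrictScalars ℝ)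
    (measurableSet_tailRegion b lo hi)
    (fun z hz => ((hd z hz.1).hasFDerivAt.restrictScalars ℝ).hasFDerivWithinAt)
    ((injOn_tailMap hb).mono fun z hz => hz.1) (fun _ => 1)
  have e : ∫⁻ z in tailRegion b lo hi, ENNReal.ofReal (tailDensity b z) =
      volume (tailMap b '' tailRegion b lo hi) := by
    rw [← setLIntegral_one, hcv]
    refine setLIntegral_congr_fun (measurableSet_tailRegion b lo hi) fun z hz => ?_
    rw [det_mul_complex, hdn z hz.1, abs_of_nonneg (tailDensity_nonneg hb z), mul_one]
  rw [e]
  -- For x > 0 one has eˣ/2 ≤ cosh x ≤ eˣ, so bounds on cosh(Re w) place the image in a rectangle of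
  -- height π.
  have hsub : tailMap b '' tailRegion b lo hi ⊆
      {w : ℂ | w.re ∈ Set.Icc (Real.log lo) (Real.log (2 * hi)) ∧ w.im ∈ Set.Ioo 0 Real.pi} := by
    rintro _ ⟨z, ⟨hz, h1, h2⟩, rfl⟩
    have hm := tailMap_mem hb hz
    rw [← cosh_re_tailMap hb hz] at h1 h2
    rw [Real.cosh_eq] at h1 h2
    have hx : 0 < (tailMap b z).re := hm.1
    have h3 : Real.exp (-(tailMap b z).re) ≤ Real.exp (tailMap b z).re :=
      Real.exp_le_exp.2 (by linarith)
    have h4 := Real.exp_pos (tailMap b z).re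
    have h5 := Real.exp_pos (-(tailMap b z).re)
    refine ⟨⟨?_, ?_⟩, hm.2⟩
    · rw [Real.log_le_iff_le_exp hlo]; linarith
    · rw [Real.le_log_iff_exp_le (by linarith)]; linarith
  refine (measure_mono hsub).trans ?_
  rw [volume_reProdIm_le, sub_zero, mul_comm, ← ENNReal.ofReal_mul Real.pi_pos.le]

lemma integrableOn_tailDensity (hb : b ∈ Set.Ioo (-1 : ℝ) 1) {lo hi : ℝ} (hlo : 0 < lo) :
    IntegrableOn (tailDensity b) (tailRegion b lo hi) := by
  refine ⟨(measurable_tailDensity b).aestronglyMeasurable, ?_⟩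
  rw [hasFiniteIntegral_iff_ofReal (Eventually.of_forall (tailDensity_nonneg hb))]
  exact (lintegral_tailDensity_le hb hlo).trans_lt ENNReal.ofReal_lt_top

lemma integral_tailDensity_le (hb : b ∈ Set.Ioo (-1 : ℝ) 1) {lo hi : ℝ} (hlo : 0 < lo)
    (hlh : lo ≤ 2 * hi) : ∫ z in tailRegion b lo hi, tailDensity b z ≤
      Real.pi * (Real.log (2 * hi) - Real.log lo) := by
  have h0 : 0 ≤ Real.pi * (Real.log (2 * hi) - Real.log lo) :=
    mul_nonneg Real.pi_pos.le (sub_nonneg.2 (Real.log_le_log hlo hlh))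
  rw [← ENNReal.ofReal_le_ofReal_iff h0, ofReal_integral_eq_lintegral_ofReal
    (integrableOn_tailDensity hb hlo) (Eventually.of_forall (tailDensity_nonneg hb))]
  exact lintegral_tailDensity_le hb hlo

/-- A smooth function equal to one on `(-∞, 1]` and to zero on `[2, ∞)`. -/
noncomputable def tailCut (s : ℝ) : ℝ := 1 - Real.smoothTransition (s - 1)

lemma tailCut_eq_one {s : ℝ} (hs : s ≤ 1) : tailCut s = 1 := by
  rw [tailCut, Real.smoothTransition.zero_of_nonpos (by linarith), sub_zero]

lemma tailCut_eq_zero {s : ℝ} (hs : 2 ≤ s) : tailCut s = 0 := by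
  rw [tailCut, Real.smoothTransition.one_of_one_le (by linarith), sub_self]

lemma tailCut_nonneg (s : ℝ) : 0 ≤ tailCut s := sub_nonneg.2 (Real.smoothTransition.le_one _)

lemma tailCut_le_one (s : ℝ) : tailCut s ≤ 1 :=
  sub_le_self _ (Real.smoothTransition.nonneg _)

lemma contDiff_tailCut : ContDiff ℝ ∞ tailCut :=
  contDiff_const.sub (Real.smoothTransition.contDiff.comp (contDiff_id.sub contDiff_const))

lemma deriv_tailCut_eq_zero {s : ℝ} (hs : s < 1 ∨ 2 < s) : deriv tailCut s = 0 := by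
  rcases hs with hs | hs
  · have : tailCut =ᶠ[𝓝 s] fun _ => 1 := by
      filter_upwards [Iio_mem_nhds hs] with x hx using tailCut_eq_one (le_of_lt hx)
    rw [this.deriv_eq, deriv_const]
  · have : tailCut =ᶠ[𝓝 s] fun _ => 0 := by
      filter_upwards [Ioi_mem_nhds hs] with x hx using tailCut_eq_zero (le_of_lt hx)
    rw [this.deriv_eq, deriv_const]

lemma exists_bound_deriv_tailCut : ∃ B : ℝ, 0 ≤ B ∧ ∀ s, |deriv tailCut s| ≤ B := by
  have hc : Continuous (deriv tailCut) := contDiff_tailCut.continuous_deriv (by simp)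
  obtain ⟨B, hB⟩ := (isCompact_Icc (a := (1 : ℝ)) (b := 2)).exists_bound_of_continuousOn
    hc.continuousOn
  refine ⟨max B 0, le_max_right _ _, fun s => ?_⟩
  by_cases hs : s ∈ Set.Icc (1 : ℝ) 2
  · exact (hB s hs).trans (le_max_left _ _)
  · rw [deriv_tailCut_eq_zero, abs_zero]
    · exact le_max_right _ _
    · by_contra hc; push Not at hc; exact hs hc

/-- The truncated tail, normalized to vanish at infinity. -/
noncomputable def cutTail (K b : ℝ) (z : ℂ) : ℝ :=
  tailCut (tailCosh b z / K) * Real.arcsin (tailCos b z) - Real.arcsin b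

lemma hasGradientAt_comp_holomorphic {Q : ℂ → ℝ} {h : ℂ → ℂ} {q d z : ℂ}
    (hQ : HasGradientAt Q q (h z)) (hh : HasDerivAt h d z) :
    HasGradientAt (fun w => Q (h w)) ((starRingEnd ℂ) d * q) z := by
  rw [hasGradientAt_iff_hasFDerivAt] at *
  refine (hQ.comp z (hh.hasFDerivAt.restrictScalars ℝ)).congr_fderiv
    (ContinuousLinearMap.ext fun v => ?_)
  simp [Complex.inner]
  ring

/-- The truncated tail in the coordinates of the half-strip. -/
noncomputable def stripTail (K : ℝ) (w : ℂ) : ℝ :=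
  tailCut (Real.cosh w.re / K) * (Real.pi / 2 - w.im)

lemma hasGradientAt_stripTail (K : ℝ) (w : ℂ) : HasGradientAt (stripTail K)
    ⟨deriv tailCut (Real.cosh w.re / K) * (Real.sinh w.re / K) * (Real.pi / 2 - w.im),
      -tailCut (Real.cosh w.re / K)⟩ w := by
  rw [hasGradientAt_iff_hasFDerivAt]
  have h1 : HasFDerivAt (fun w : ℂ => tailCut (Real.cosh w.re / K)) _ w :=
    (((contDiff_tailCut.differentiable (by simp) _).hasDerivAt).comp w.re
      ((Real.hasDerivAt_cosh w.re).div_const K)).comp_hasFDerivAt w Complex.reCLM.hasFDerivAt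
  have h2 : HasFDerivAt (fun w : ℂ => Real.pi / 2 - w.im) _ w :=
    Complex.imCLM.hasFDerivAt.const_sub (Real.pi / 2)
  refine (h1.mul h2).congr_fderiv (ContinuousLinearMap.ext fun v => ?_)
  simp [Complex.inner]
  ring

/-- The Im w-derivative has size at most one. The Re w-derivative lives in the transition zone,
where sinh/K ≤ 2 and |π/2 - Im w| ≤ 2, so its square is at most (4B)². Keeping coefficient exactly
one in the first term is essential for the sharp leading constant of the energy. -/
lemma norm_gradient_stripTail_sq_le {B K : ℝ} (hB : ∀ s, |deriv tailCut s| ≤ B) (hK : 0 < K) {w : ℂ}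
    (hw : w ∈ halfStrip) : ‖gradient (stripTail K) w‖ ^ 2 ≤
      (if Real.cosh w.re ≤ 2 * K then 1 else 0) +
        16 * B ^ 2 * (if K ≤ Real.cosh w.re ∧ Real.cosh w.re ≤ 2 * K then 1 else 0) := by
  rw [(hasGradientAt_stripTail K w).gradient, Complex.sq_norm, Complex.normSq_apply]
  simp only
  set s := Real.cosh w.re / K with hs
  have hB0 : 0 ≤ B := (abs_nonneg _).trans (hB 0)
  have n1 := tailCut_nonneg s
  have n2 := tailCut_le_one s
  by_cases h2 : Real.cosh w.re ≤ 2 * K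
  · rw [if_pos h2]
    by_cases h1 : K ≤ Real.cosh w.re
    · rw [if_pos ⟨h1, h2⟩]
      have hsK : |Real.sinh w.re / K| ≤ 2 := by
        rw [abs_div, abs_of_pos hK, div_le_iff₀ hK, abs_of_pos (Real.sinh_pos_iff.2 hw.1)]
        exact (Real.sinh_lt_cosh _).le.trans h2
      have hy : |Real.pi / 2 - w.im| ≤ 2 := by
        have := hw.2.1; have := hw.2.2; have := Real.pi_le_four
        rw [abs_le]; constructor <;> linarith
      have h3 : |deriv tailCut s * (Real.sinh w.re / K) * (Real.pi / 2 - w.im)| ≤ B * 2 * 2 := by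
        rw [abs_mul, abs_mul]
        have := hB s
        gcongr
      have h4 := pow_le_pow_left₀ (abs_nonneg _) h3 2
      rw [sq_abs] at h4
      nlinarith
    · have : s < 1 := by rw [hs, div_lt_one hK]; exact not_le.1 h1
      rw [deriv_tailCut_eq_zero (Or.inl this), tailCut_eq_one this.le]
      simp [h1]
  · have : 2 < s := by rw [hs, lt_div_iff₀ hK]; exact not_le.1 h2
    rw [deriv_tailCut_eq_zero (Or.inr this), tailCut_eq_zero this.le]
    simp [h2]

lemma cutTail_eq_stripTail (hb : b ∈ Set.Ioo (-1 : ℝ) 1) (K : ℝ) {z : ℂ} (hz : z ∈ upperHalf) :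
    cutTail K b z = stripTail K (tailMap b z) - Real.arcsin b := by
  rw [cutTail, stripTail, cosh_re_tailMap hb hz, pi_div_two_sub_im_tailMap hb hz]

lemma hasGradientAt_cutTail (hb : b ∈ Set.Ioo (-1 : ℝ) 1) (K : ℝ) {z d : ℂ} (hz : z ∈ upperHalf)
    (hd : HasDerivAt (tailMap b) d z) : HasGradientAt (cutTail K b)
      ((starRingEnd ℂ) d * gradient (stripTail K) (tailMap b z)) z := by
  have h1 := hasGradientAt_comp_holomorphic
    (hasGradientAt_stripTail K (tailMap b z)).differentiableAt.hasGradientAt hd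
  have h2 : HasGradientAt (fun w => stripTail K (tailMap b w) - Real.arcsin b)
      ((starRingEnd ℂ) d * gradient (stripTail K) (tailMap b z)) z := by
    rw [hasGradientAt_iff_hasFDerivAt] at *
    exact h1.sub_const _
  refine h2.congr_of_eventuallyEq ?_
  filter_upwards [isOpen_upperHalf.mem_nhds hz] with w hw using cutTail_eq_stripTail hb K hw

lemma differentiableAt_cutTail (hb : b ∈ Set.Ioo (-1 : ℝ) 1) (K : ℝ) {z : ℂ} (hz : z ∈ upperHalf) :
    DifferentiableAt ℝ (cutTail K b) z := by
  obtain ⟨d, hd, -⟩ := exists_hasDerivAt_tailMap hb hz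
  exact (hasGradientAt_cutTail hb K hz hd).differentiableAt

/-- Conformal invariance: the strip estimate is multiplied by the squared modulus of the derivative
of the map. Integrals of squared gradients then become areas in the strip. -/
lemma norm_gradient_cutTail_sq_le {B K : ℝ} (hB : ∀ s, |deriv tailCut s| ≤ B) (hK : 0 < K)
    (hb : b ∈ Set.Ioo (-1 : ℝ) 1) {z : ℂ} (hz : z ∈ upperHalf) :
    ‖gradient (cutTail K b) z‖ ^ 2 ≤ (tailRegion b 1 (2 * K)).indicator (tailDensity b) z +
      16 * B ^ 2 * (tailRegion b K (2 * K)).indicator (tailDensity b) z := by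
  obtain ⟨d, hd, hdn⟩ := exists_hasDerivAt_tailMap hb hz
  rw [(hasGradientAt_cutTail hb K hz hd).gradient, norm_mul, RCLike.norm_conj, mul_pow, hdn]
  have h1 := norm_gradient_stripTail_sq_le hB hK (tailMap_mem hb hz)
  rw [cosh_re_tailMap hb hz] at h1
  have e1 : (tailRegion b 1 (2 * K)).indicator (tailDensity b) z =
      tailDensity b z * (if tailCosh b z ≤ 2 * K then 1 else 0) := by
    by_cases h : tailCosh b z ≤ 2 * K
    · rw [Set.indicator_of_mem (show z ∈ tailRegion b 1 (2 * K) from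
        ⟨hz, one_le_tailCosh hb hz, h⟩), if_pos h, mul_one]
    · rw [Set.indicator_of_notMem fun h' => h h'.2.2, if_neg h, mul_zero]
  have e2 : (tailRegion b K (2 * K)).indicator (tailDensity b) z =
      tailDensity b z * (if K ≤ tailCosh b z ∧ tailCosh b z ≤ 2 * K then 1 else 0) := by
    by_cases h : K ≤ tailCosh b z ∧ tailCosh b z ≤ 2 * K
    · rw [Set.indicator_of_mem (show z ∈ tailRegion b K (2 * K) from ⟨hz, h⟩), if_pos h, mul_one]
    · rw [Set.indicator_of_notMem fun h' => h h'.2, if_neg h, mul_zero]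
  rw [e1, e2]
  have := mul_le_mul_of_nonneg_left h1 (tailDensity_nonneg hb z)
  linarith

/-- Where the tail is not truncated, its gradient is that of the tail itself. -/
lemma hasGradientAt_basicTail_moebius (hb : b ∈ Set.Ioo (-1 : ℝ) 1) {K : ℝ} (hK : 0 < K) {z : ℂ}
    (hz : z ∈ upperHalf) (hlt : tailCosh b z < K) :
    HasGradientAt (fun w => basicTail (moebius (-b) w)) (gradient (cutTail K b) z) z := by
  have h1 := (differentiableAt_cutTail hb K hz).hasGradientAt
  have h2 : HasGradientAt (fun w => cutTail K b w + Real.arcsin b) (gradient (cutTail K b) z) z := by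
    rw [hasGradientAt_iff_hasFDerivAt] at *
    exact h1.add_const _
  refine h2.congr_of_eventuallyEq ?_
  have hc : ContinuousAt (tailCosh b) z := by
    have : 2 * ‖z - b‖ ≠ 0 := by
      have := norm_pos_iff.2 (sub_ne_zero_of_upper hz b)
      positivity
    unfold tailCosh
    exact ContinuousAt.div (by fun_prop) (by fun_prop) this
  filter_upwards [isOpen_upperHalf.mem_nhds hz, hc.eventually_lt continuousAt_const hlt] with w hw hwl
  rw [basicTail_moebius hb hw, pi_div_two_sub_im_tailMap hb hw, cutTail,
    tailCut_eq_one ((div_le_one hK).2 hwl.le)]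
  ring

lemma continuousAt_cutTail (K b : ℝ) {z : ℂ} (hz : z ≠ b) : ContinuousAt (cutTail K b) z := by
  have h0 : 2 * ‖z - b‖ ≠ 0 := by
    have := norm_pos_iff.2 (sub_ne_zero.2 hz)
    positivity
  have h1 : ContinuousAt (tailCosh b) z := by
    unfold tailCosh; exact ContinuousAt.div (by fun_prop) (by fun_prop) h0
  have h2 : ContinuousAt (tailCos b) z := by
    unfold tailCos; exact ContinuousAt.div (by fun_prop) (by fun_prop) h0
  exact ((contDiff_tailCut.continuous.continuousAt.comp (h1.div_const K)).mul
    (Real.continuous_arcsin.continuousAt.comp h2)).sub_const _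

lemma tendsto_norm_sub_div (p b : ℂ) :
    Tendsto (fun z : ℂ => ‖z - p‖ / ‖z - b‖) (cocompact ℂ) (𝓝 1) := by
  have hinf : Tendsto (fun z : ℂ => ‖z - b‖) (cocompact ℂ) atTop := by
    refine tendsto_atTop_mono (f := fun z : ℂ => ‖z‖ - ‖b‖) (fun z => norm_sub_norm_le z b)
      (tendsto_atTop_add_const_right _ _ (tendsto_norm_cocompact_atTop (E := ℂ)))
  have h0 : Tendsto (fun z : ℂ => ‖p - b‖ / ‖z - b‖) (cocompact ℂ) (𝓝 0) :=
    tendsto_const_nhds.div_atTop hinf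
  rw [tendsto_iff_norm_sub_tendsto_zero]
  refine squeeze_zero' (Eventually.of_forall fun z => norm_nonneg _) ?_ h0
  filter_upwards [hinf.eventually_gt_atTop 0] with z hz
  have e : ‖z - p‖ / ‖z - b‖ - 1 = (‖z - p‖ - ‖z - b‖) / ‖z - b‖ := by field_simp
  rw [e, norm_div, norm_norm]
  gcongr
  have := abs_norm_sub_norm_le (z - p) (z - b)
  rw [show z - p - (z - b) = b - p by ring, norm_sub_rev b p] at this
  exact this

/-- All ratios of distances tend to one at infinity, hence `tailCosh` tends to 1, where the cutoff
is inactive as K ≥ 1, and `tailCos` tends to b; this explains the subtraction of arcsin b. -/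
lemma tendsto_cutTail_cocompact {K : ℝ} (hK : 1 ≤ K) (b : ℝ) :
    Tendsto (cutTail K b) (cocompact ℂ) (𝓝 0) := by
  have h1 := tendsto_norm_sub_div 1 b
  have h2 := tendsto_norm_sub_div (-1) b
  simp only [sub_neg_eq_add] at h2
  have hc : Tendsto (tailCosh b) (cocompact ℂ) (𝓝 1) := by
    have := ((h1.const_mul (1 + b)).add (h2.const_mul (1 - b))).div_const 2
    rw [show ((1 + b) * 1 + (1 - b) * 1) / 2 = 1 by ring] at this
    refine this.congr fun z => ?_
    rw [tailCosh, mul_comm 2, ← div_div]; ring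
  have hs : Tendsto (tailCos b) (cocompact ℂ) (𝓝 b) := by
    have := ((h1.const_mul (1 + b)).sub (h2.const_mul (1 - b))).div_const 2
    rw [show ((1 + b) * 1 - (1 - b) * 1) / 2 = b by ring] at this
    refine this.congr fun z => ?_
    rw [tailCos, mul_comm 2, ← div_div]; ring
  have h3 := (((contDiff_tailCut.continuous.tendsto _).comp (hc.div_const K)).mul
    ((Real.continuous_arcsin.tendsto _).comp hs)).sub_const (Real.arcsin b)
  rw [tailCut_eq_one ((div_le_one (by linarith)).2 hK), one_mul, sub_self] at h3
  exact h3

/-- The triangle inequality for 2(1 - bz) = (1 + b)(1 - z) + (1 - b)(1 + z). It bounds the numerator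
of `tailCosh` from below, so that `tailCosh` blows up at b. -/
lemma norm_one_sub_mul_le (hb : b ∈ Set.Ioo (-1 : ℝ) 1) (z : ℂ) :
    2 * ‖1 - b * z‖ ≤ (1 + b) * ‖z - 1‖ + (1 - b) * ‖z + 1‖ := by
  have h := norm_add_le (((1 + b : ℝ) : ℂ) * (1 - z)) (((1 - b : ℝ) : ℂ) * (z + 1))
  rw [norm_mul, norm_mul, Complex.norm_real, Complex.norm_real,
    Real.norm_of_nonneg (by linarith [hb.1]), Real.norm_of_nonneg (by linarith [hb.2]),
    norm_sub_rev 1 z] at h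
  refine le_trans (le_of_eq ?_) h
  rw [show ((1 + b : ℝ) : ℂ) * (1 - z) + ((1 - b : ℝ) : ℂ) * (z + 1) = 2 * (1 - b * z) by
    push_cast; ring, norm_mul]
  simp

lemma le_norm_one_sub_mul (hb : b ∈ Set.Ioo (-1 : ℝ) 1) (z : ℂ) :
    1 - b ^ 2 - ‖z - b‖ ≤ ‖1 - b * z‖ := by
  have hb2 : 0 < 1 - b ^ 2 := by nlinarith [hb.1, hb.2]
  have h := norm_add_le (1 - b * z) ((b : ℂ) * (z - b))
  have e : 1 - (b : ℂ) * z + b * (z - b) = ((1 - b ^ 2 : ℝ) : ℂ) := by push_cast; ring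
  rw [e, norm_mul, Complex.norm_real, Complex.norm_real, Real.norm_of_nonneg hb2.le] at h
  have h3 : ‖b‖ * ‖z - b‖ ≤ 1 * ‖z - b‖ := by
    gcongr
    exact abs_le.2 ⟨hb.1.le, hb.2.le⟩
  linarith

/-- Truncated tails are admissible test functions. -/
lemma isAdmissible_cutTail {K : ℝ} (hK : 1 ≤ K) (hb : b ∈ Set.Ioo (-1 : ℝ) 1) :
    ∃ M, 0 ≤ M ∧ IsAdmissible M (cutTail K b) (fun t => cutTail K b t) := by
  obtain ⟨B, hB0, hB⟩ := exists_bound_deriv_tailCut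
  have hK0 : 0 < K := by linarith
  have hb2 : 0 < 1 - b ^ 2 := by nlinarith [hb.1, hb.2]
  -- Where `tailCosh` is at most 2K, |1 - bz| ≤ 2K|z - b|, while |1 - bz| ≥ 1 - b² - |z - b|. Hence
  -- |z - b| ≥ r on the set where the gradient can be nonzero.
  set r : ℝ := (1 - b ^ 2) / (2 * K + 1) with hr
  have hr0 : 0 < r := by positivity
  set M : ℝ := (1 + 16 * B ^ 2 + 1) * (2 / r + 1) with hM
  have hM0 : 0 ≤ M := by positivity
  refine ⟨M, hM0, fun z hz => differentiableAt_cutTail hb K hz, fun z hz => ?_, ?_, ?_⟩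
  · have h1 := norm_gradient_cutTail_sq_le hB hK0 hb hz
    have hg := gradWeight_nonneg z
    rw [← sq_le_sq₀ (norm_nonneg _) (by positivity)]
    refine h1.trans ?_
    by_cases hc : tailCosh b z ≤ 2 * K
    · have n0 : 0 < ‖z - b‖ := norm_pos_iff.2 (sub_ne_zero_of_upper hz b)
      have n1 : 0 < ‖z - 1‖ := norm_pos_iff.2 (sub_one_ne_zero_of_upper hz)
      have n2 : 0 < ‖z + 1‖ := norm_pos_iff.2 (add_one_ne_zero_of_upper hz)
      have hrz : r ≤ ‖z - b‖ := by
        have h2 := norm_one_sub_mul_le hb z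
        have h3 := le_norm_one_sub_mul hb z
        rw [tailCosh, div_le_iff₀ (by positivity)] at hc
        rw [hr, div_le_iff₀ (by positivity)]
        nlinarith
      have hz1 : 1 + ‖z‖ ≤ (2 / r + 1) * ‖z - b‖ := by
        have h4 : ‖z‖ ≤ ‖z - b‖ + ‖(b : ℂ)‖ := by simpa using norm_add_le (z - b) b
        have h5 : ‖(b : ℂ)‖ ≤ 1 := by
          rw [Complex.norm_real]; exact abs_le.2 ⟨hb.1.le, hb.2.le⟩
        have h6 : 2 ≤ 2 / r * ‖z - b‖ := by
          rw [div_mul_eq_mul_div, le_div_iff₀ hr0]; linarith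
        linarith
      have hi : ∀ lo hi, (tailRegion b lo hi).indicator (tailDensity b) z ≤ tailDensity b z :=
        fun lo hi => Set.indicator_le_self' (fun _ _ => tailDensity_nonneg hb z) z
      have hd : tailDensity b z ≤ ((2 / r + 1) * gradWeight z) ^ 2 := by
        have e : ((2 / r + 1) * gradWeight z) ^ 2 =
            (2 / r + 1) ^ 2 / ((1 + ‖z‖) ^ 2 * (‖z - 1‖ * ‖z + 1‖)) := by
          rw [gradWeight, mul_pow, div_pow, mul_pow, Real.sq_sqrt (by positivity)]
          field_simp
        rw [e, tailDensity, div_le_div_iff₀ (by positivity) (by positivity)]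
        have h7 := pow_le_pow_left₀ (by positivity) hz1 2
        calc (1 - b ^ 2) * ((1 + ‖z‖) ^ 2 * (‖z - 1‖ * ‖z + 1‖))
            ≤ 1 * (((2 / r + 1) * ‖z - b‖) ^ 2 * (‖z - 1‖ * ‖z + 1‖)) := by
              gcongr
              nlinarith [sq_nonneg b]
          _ = _ := by ring
      have hB2 : 0 ≤ 16 * B ^ 2 := by positivity
      calc _ ≤ tailDensity b z + 16 * B ^ 2 * tailDensity b z := by
            gcongr
            · exact hi _ _
            · exact hi _ _
        _ = (1 + 16 * B ^ 2) * tailDensity b z := by ring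
        _ ≤ (1 + 16 * B ^ 2 + 1) ^ 2 * ((2 / r + 1) * gradWeight z) ^ 2 := by
            refine mul_le_mul ?_ hd (tailDensity_nonneg hb z) (by positivity)
            nlinarith
        _ = _ := by rw [hM]; ring
    · have e : ∀ lo, (tailRegion b lo (2 * K)).indicator (tailDensity b) z = 0 := fun lo =>
        Set.indicator_of_notMem (fun h => hc h.2.2) _
      rw [e, e]
      simp only [mul_zero, add_zero]
      positivity
  · have : ∀ᵐ t : ℝ, t ∉ ({b} : Set ℝ) := measure_eq_zero_iff_ae_notMem.1 (by simp)
    filter_upwards [ae_restrict_of_ae this] with t ht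
    refine (continuousAt_cutTail K b ?_).tendsto.mono_left nhdsWithin_le_nhds
    exact_mod_cast ht
  · exact (tendsto_cutTail_cocompact hK b).mono_left inf_le_left

end

/-! ### Wall geometry and the charge near a wall -/

section
variable {N : ℕ} {a d : Fin N → ℝ} {R α : ℝ} {m : ℝ → Plane}

/-- The walls keep a distance from each other and from the end points. -/
structure IsSeparated (R : ℝ) (a : Fin N → ℝ) : Prop where
  mem : ∀ n, a n ∈ Set.Icc (-1 + R) (1 - R)
  dist : ∀ k n, k ≠ n → 2 * R ≤ |a k - a n|

lemma IsSeparated.mem_Ioo (h : IsSeparated R a) (hR : 0 < R) (n : Fin N) :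
    a n ∈ Set.Ioo (-1 : ℝ) 1 :=
  ⟨by linarith [(h.mem n).1], by linarith [(h.mem n).2]⟩

lemma IsWallPositions.isSeparated (ha : IsWallPositions a) (hR : R ≤ wallDistance a) :
    IsSeparated R a := by
  unfold wallDistance at hR
  set S : Set ℝ := {r | ∃ n : Fin N, (n : ℕ) = 0 ∧ r = 2 * a n + 2} ∪
      {r | ∃ k n : Fin N, (n : ℕ) = k + 1 ∧ r = a n - a k} ∪
      {r | ∃ n : Fin N, (n : ℕ) + 1 = N ∧ r = 2 - 2 * a n} with hS
  have hbdd : BddBelow S := by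
    refine ⟨0, ?_⟩
    rintro r ((⟨n, -, rfl⟩ | ⟨k, n, hkn, rfl⟩) | ⟨n, -, rfl⟩)
    · linarith [(ha.2 n).1]
    · have : a k < a n := ha.1 (Fin.lt_def.2 (by omega))
      linarith
    · linarith [(ha.2 n).2]
  have key : ∀ r ∈ S, 2 * R ≤ r := fun r hr => by linarith [csInf_le hbdd hr]
  have hlt : ∀ k n : Fin N, k < n → 2 * R ≤ a n - a k := by
    intro k n hkn
    have hlt := Fin.lt_def.1 hkn
    have hN := n.isLt
    have h1 := key _ (Or.inl (Or.inr ⟨k, ⟨k + 1, by omega⟩, rfl, rfl⟩))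
    have h2 : a ⟨k + 1, by omega⟩ ≤ a n := ha.1.monotone (Fin.le_def.2 (by simp only; omega))
    linarith
  refine ⟨fun n => ⟨?_, ?_⟩, fun k n hkn => ?_⟩
  · have h0 : 0 < N := n.pos
    have h1 := key _ (Or.inl (Or.inl ⟨⟨0, h0⟩, rfl, rfl⟩))
    have h2 : a ⟨0, h0⟩ ≤ a n := ha.1.monotone (Fin.le_def.2 (by simp))
    linarith
  · have h0 : 0 < N := n.pos
    have h1 := key _ (Or.inr ⟨⟨N - 1, by omega⟩, by simp only; omega, rfl⟩)
    have h2 : a n ≤ a ⟨N - 1, by omega⟩ := ha.1.monotone (Fin.le_def.2 (by simp only; omega))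
    linarith
  · rcases lt_or_gt_of_ne hkn with h | h
    · rw [abs_sub_comm]; exact (hlt _ _ h).trans (le_abs_self _)
    · exact (hlt _ _ h).trans (le_abs_self _)

lemma setIntegral_deriv_Ioo {g : ℝ → ℝ} (hg : AbsolutelyContinuousOnInterval g (-1) 1) {x y : ℝ}
    (hx : -1 ≤ x) (hxy : x ≤ y) (hy : y ≤ 1) : ∫ t in Set.Ioo x y, deriv g t = g y - g x := by
  have h : AbsolutelyContinuousOnInterval g x y := hg.mono (by
    rw [Set.uIcc_of_le hxy, Set.uIcc_of_le (by norm_num)]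
    exact Set.Icc_subset_Icc hx hy)
  rw [← h.integral_deriv_eq_sub, intervalIntegral.integral_of_le hxy, integral_Ioc_eq_integral_Ioo]

/-- Cauchy–Schwarz applied to the derivative, that is, Hölder continuity with exponent 1/2. -/
lemma MemSobolevInterval.sq_sub_le {g : ℝ → ℝ} (hg : MemSobolevInterval g) {x y : ℝ}
    (hx : x ∈ Set.Icc (-1 : ℝ) 1) (hy : y ∈ Set.Icc (-1 : ℝ) 1) :
    (g y - g x) ^ 2 ≤ |y - x| * ∫ t in Set.Ioo (-1 : ℝ) 1, deriv g t ^ 2 := by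
  wlog h : x ≤ y generalizing x y
  · have := this hy hx (le_of_not_ge h)
    rwa [abs_sub_comm, ← neg_sub (g y), neg_sq] at this
  have hsub : Set.Ioo x y ⊆ Set.Ioo (-1 : ℝ) 1 := Set.Ioo_subset_Ioo hx.1 hy.2
  have h1 := sq_integral_mul_le (μ := volume.restrict (Set.Ioo x y))
    (memLp_const (p := 2) (1 : ℝ)) (hg.2.mono_measure (Measure.restrict_mono_set _ hsub))
  simp only [one_mul, one_pow, setIntegral_const, smul_eq_mul, mul_one] at h1
  rw [setIntegral_deriv_Ioo hg.1 hx.1 h hy.2] at h1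
  have h2 : volume.real (Set.Ioo x y) = |y - x| := by
    rw [Real.volume_real_Ioo_of_le h, abs_of_nonneg (by linarith)]
  rw [h2] at h1
  refine h1.trans (mul_le_mul_of_nonneg_left ?_ (abs_nonneg _))
  exact setIntegral_mono_set hg.2.integrable_sq (Eventually.of_forall fun _ => sq_nonneg _)
    hsub.eventuallyLE

lemma IsMagnetisation.isDensity (h : IsMagnetisation α a d m) :
    IsDensity (deriv fun t => m t 0) where
  measurable := measurable_deriv _
  memLp := (h.sobolev 0).2
  mean := by
    rw [setIntegral_deriv_Ioo (h.sobolev 0).1 le_rfl (by norm_num) le_rfl, h.left_boundary,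
      h.right_boundary, sub_self]

/-- The exchange energy `∫_{-1}^1 |m'|²`. -/
noncomputable def exchange (m : ℝ → Plane) : ℝ :=
  ∫ t in Set.Ioo (-1 : ℝ) 1, ∑ i : Fin 2, (deriv (fun s => m s i) t) ^ 2

lemma IsMagnetisation.integrable_exchange (h : IsMagnetisation α a d m) :
    IntegrableOn (fun t => ∑ i : Fin 2, (deriv (fun s => m s i) t) ^ 2) (Set.Ioo (-1 : ℝ) 1) :=
  integrable_finsetSum _ fun i _ => (h.sobolev i).2.integrable_sq

lemma exchange_nonneg (m : ℝ → Plane) : 0 ≤ exchange m :=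
  integral_nonneg fun _ => Finset.sum_nonneg fun _ _ => sq_nonneg _

lemma IsMagnetisation.sq_add_sq (h : IsMagnetisation α a d m) {t : ℝ}
    (ht : t ∈ Set.Icc (-1 : ℝ) 1) : m t 0 ^ 2 + m t 1 ^ 2 = 1 := by
  have := EuclideanSpace.norm_sq_eq (m t)
  rw [h.norm_eq_one t ht, Fin.sum_univ_two, Real.norm_eq_abs, Real.norm_eq_abs, sq_abs, sq_abs] at this
  linarith

/-- Near a wall the second component is small. -/
lemma IsMagnetisation.sq_le_of_wall (h : IsMagnetisation α a d m) {b : ℝ}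
    (hb : b ∈ Set.Ioo (-1 : ℝ) 1) (hmb : m b 0 ^ 2 = 1) {t : ℝ} (ht : t ∈ Set.Icc (-1 : ℝ) 1) :
    m t 1 ^ 2 ≤ |t - b| * exchange m := by
  have h0 : m b 1 = 0 := by
    have := h.sq_add_sq (Set.Ioo_subset_Icc_self hb)
    rw [hmb] at this
    simpa using this
  have h1 := (h.sobolev 1).sq_sub_le (Set.Ioo_subset_Icc_self hb) ht
  rw [h0, sub_zero] at h1
  refine h1.trans (mul_le_mul_of_nonneg_left ?_ (abs_nonneg _))
  refine integral_mono (h.sobolev 1).2.integrable_sq h.integrable_exchange fun t => ?_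
  simp only [Fin.sum_univ_two]
  linarith [sq_nonneg (deriv (fun s => m s 0) t)]

/-- Differentiating m₁² + m₂² = 1 gives m₁m₁' = -m₂m₂'; multiplying (m₁')² by m₁² + m₂² then
produces the identity. -/
lemma IsMagnetisation.ae_sq_deriv_eq (h : IsMagnetisation α a d m) :
    ∀ᵐ t ∂(volume.restrict (Set.Ioo (-1 : ℝ) 1)), (deriv (fun s => m s 0) t) ^ 2 =
      m t 1 ^ 2 * ∑ i : Fin 2, (deriv (fun s => m s i) t) ^ 2 := by
  have h0 := (h.sobolev 0).1.ae_differentiableAt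
  have h1 := (h.sobolev 1).1.ae_differentiableAt
  filter_upwards [ae_restrict_mem measurableSet_Ioo, ae_restrict_of_ae h0, ae_restrict_of_ae h1]
    with t ht d0 d1
  have hu : t ∈ Set.uIcc (-1 : ℝ) 1 := by
    rw [Set.uIcc_of_le (by norm_num)]; exact Set.Ioo_subset_Icc_self ht
  have e := ((d0 hu).hasDerivAt.pow 2).add ((d1 hu).hasDerivAt.pow 2)
  have e2 : ((fun t => m t 0) ^ 2 + (fun t => m t 1) ^ 2) =ᶠ[𝓝 t] fun _ => (1 : ℝ) := by
    filter_upwards [isOpen_Ioo.mem_nhds ht] with s hs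
    exact h.sq_add_sq (Set.Ioo_subset_Icc_self hs)
  have e3 := e.deriv
  rw [e2.deriv_eq, deriv_const] at e3
  simp only [Nat.cast_ofNat, Nat.add_one_sub_one, pow_one] at e3
  have e4 := h.sq_add_sq (Set.Ioo_subset_Icc_self ht)
  rw [Fin.sum_univ_two]
  set x := m t 0
  set y := m t 1
  set p := deriv (fun s => m s 0) t
  set q := deriv (fun s => m s 1) t
  have e5 : x * p = -(y * q) := by linarith
  have e6 : (x * p) ^ 2 = (y * q) ^ 2 := by rw [e5, neg_sq]
  calc p ^ 2 = p ^ 2 * (x ^ 2 + y ^ 2) := by rw [e4, mul_one]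
    _ = (x * p) ^ 2 + y ^ 2 * p ^ 2 := by ring
    _ = _ := by rw [e6]; ring

/-- Near a wall the density of the magnetic charge is small. -/
lemma IsMagnetisation.integral_abs_deriv_le (h : IsMagnetisation α a d m) {b r : ℝ} (hr : 0 ≤ r)
    (hb : b ∈ Set.Ioo (-1 : ℝ) 1) (hmb : m b 0 ^ 2 = 1) :
    ∫ t in Set.Ioo (-1 : ℝ) 1 ∩ Set.Ioo (b - r) (b + r), |deriv (fun s => m s 0) t| ≤
      2 * r * exchange m := by
  set I := Set.Ioo (-1 : ℝ) 1 ∩ Set.Ioo (b - r) (b + r) with hI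
  have hsub : I ⊆ Set.Ioo (-1 : ℝ) 1 := Set.inter_subset_left
  have hIm : MeasurableSet I := measurableSet_Ioo.inter measurableSet_Ioo
  have hle := Measure.restrict_mono_set (volume : Measure ℝ) hsub
  have hfin : IsFiniteMeasure (volume.restrict I) := ⟨by
    rw [Measure.restrict_apply_univ]
    exact (measure_mono hsub).trans_lt (by simp)⟩
  have hZ := exchange_nonneg m
  have h1 := sq_integral_mul_le (memLp_const (p := 2) (1 : ℝ))
    ((h.sobolev 0).2.mono_measure hle).norm
  simp only [one_mul, one_pow, setIntegral_const, smul_eq_mul, mul_one, Real.norm_eq_abs,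
    sq_abs] at h1
  have h2 : volume.real I ≤ 2 * r := by
    have : volume.real I ≤ volume.real (Set.Ioo (b - r) (b + r)) :=
      measureReal_mono Set.inter_subset_right (by simp)
    rw [Real.volume_real_Ioo_of_le (by linarith)] at this
    linarith
  -- Here m₂² ≤ rZ, with Z the exchange integral, and |m₁'|² = m₂²|m'|². This gains a factor r over
  -- the trivial bound Z, so the L¹ norm is linear in r instead of being of order √r.
  have h3 : ∫ t in I, deriv (fun s => m s 0) t ^ 2 ≤ r * exchange m * exchange m := by
    have i1 := h.integrable_exchange.mono_set hsub
    calc ∫ t in I, deriv (fun s => m s 0) t ^ 2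
        ≤ ∫ t in I, r * exchange m * ∑ i : Fin 2, (deriv (fun s => m s i) t) ^ 2 := by
          refine integral_mono_ae ((h.sobolev 0).2.mono_measure hle).integrable_sq
            (i1.const_mul _) ?_
          filter_upwards [ae_mono hle h.ae_sq_deriv_eq, ae_restrict_mem hIm] with t ht htI
          rw [ht]
          refine mul_le_mul_of_nonneg_right ?_ (Finset.sum_nonneg fun _ _ => sq_nonneg _)
          refine (h.sq_le_of_wall hb hmb (Set.Ioo_subset_Icc_self htI.1)).trans ?_
          refine mul_le_mul_of_nonneg_right ?_ hZ
          rw [abs_le]; constructor <;> linarith [htI.2.1, htI.2.2]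
      _ = r * exchange m * ∫ t in I, ∑ i : Fin 2, (deriv (fun s => m s i) t) ^ 2 :=
          integral_const_mul _ _
      _ ≤ _ := by
          refine mul_le_mul_of_nonneg_left ?_ (by positivity)
          exact setIntegral_mono_set h.integrable_exchange
            (Eventually.of_forall fun _ => Finset.sum_nonneg fun _ _ => sq_nonneg _)
            hsub.eventuallyLE
  have h4 : (∫ t in I, |deriv (fun s => m s 0) t|) ^ 2 ≤ (2 * r * exchange m) ^ 2 := by
    refine h1.trans ((mul_le_mul h2 h3 (integral_nonneg fun _ => sq_nonneg _)
      (by positivity)).trans ?_)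
    nlinarith [mul_nonneg hr hZ, mul_self_nonneg (r * exchange m)]
  exact le_of_sq_le_sq h4 (by positivity)

lemma tailCos_ofReal {b t : ℝ} (ht : t ∈ Set.Ioo (-1 : ℝ) 1) (htb : t ≠ b) :
    tailCos b t = if t < b then 1 else -1 := by
  have e1 : ‖(t : ℂ) - 1‖ = 1 - t := by
    rw [← Complex.ofReal_one, ← Complex.ofReal_sub, Complex.norm_real, Real.norm_eq_abs,
      abs_of_neg (by linarith [ht.2])]; ring
  have e2 : ‖(t : ℂ) + 1‖ = 1 + t := by
    rw [← Complex.ofReal_one, ← Complex.ofReal_add, Complex.norm_real, Real.norm_eq_abs,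
      abs_of_pos (by linarith [ht.1])]; ring
  have e3 : ‖(t : ℂ) - b‖ = |t - b| := by rw [← Complex.ofReal_sub, Complex.norm_real]; rfl
  rw [tailCos, e1, e2, e3]
  rcases lt_or_gt_of_ne htb with h | h
  · rw [if_pos h, abs_of_neg (by linarith), div_eq_one_iff_eq (by linarith)]; ring
  · rw [if_neg h.le.not_gt, abs_of_pos (by linarith), div_eq_iff (by linarith)]; ring

/-- On the interval `tailCosh` equals (1 - bt)/|t - b|. Consequently the cutoff at level K = 2/r is
inactive on (-1,1) at distance at least r from b. -/
lemma tailCosh_ofReal_le {b t : ℝ} (hb : b ∈ Set.Ioo (-1 : ℝ) 1) (ht : t ∈ Set.Ioo (-1 : ℝ) 1) :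
    tailCosh b t ≤ 2 / |t - b| := by
  have e1 : ‖(t : ℂ) - 1‖ = 1 - t := by
    rw [← Complex.ofReal_one, ← Complex.ofReal_sub, Complex.norm_real, Real.norm_eq_abs,
      abs_of_neg (by linarith [ht.2])]; ring
  have e2 : ‖(t : ℂ) + 1‖ = 1 + t := by
    rw [← Complex.ofReal_one, ← Complex.ofReal_add, Complex.norm_real, Real.norm_eq_abs,
      abs_of_pos (by linarith [ht.1])]; ring
  have e3 : ‖(t : ℂ) - b‖ = |t - b| := by rw [← Complex.ofReal_sub, Complex.norm_real]; rfl
  rw [tailCosh, e1, e2, e3, ← div_div]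
  refine div_le_div_of_nonneg_right ?_ (abs_nonneg _)
  nlinarith [hb.1, hb.2, ht.1, ht.2]

lemma measurable_cutTail (K b : ℝ) : Measurable (cutTail K b) := by
  have h2 : Measurable (tailCos b) := by unfold tailCos; fun_prop
  exact ((contDiff_tailCut.continuous.measurable.comp
    ((measurable_tailCosh b).div_const K)).mul (Real.continuous_arcsin.measurable.comp h2)).sub_const _

lemma abs_cutTail_le (K b : ℝ) (z : ℂ) : |cutTail K b z| ≤ Real.pi := by
  have h1 : ∀ x, |Real.arcsin x| ≤ Real.pi / 2 := fun x =>
    abs_le.2 ⟨Real.neg_pi_div_two_le_arcsin x, Real.arcsin_le_pi_div_two x⟩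
  have h2 : |tailCut (tailCosh b z / K) * Real.arcsin (tailCos b z)| ≤ 1 * (Real.pi / 2) := by
    rw [abs_mul, abs_of_nonneg (tailCut_nonneg _)]
    exact mul_le_mul (tailCut_le_one _) (h1 _) (abs_nonneg _) zero_le_one
  have h3 := abs_sub (tailCut (tailCosh b z / K) * Real.arcsin (tailCos b z)) (Real.arcsin b)
  rw [cutTail]
  linarith [h1 b]

lemma integrableOn_mul_cutTail {f : ℝ → ℝ} (hf : IsDensity f) (K b : ℝ) :
    IntegrableOn (fun t : ℝ => f t * cutTail K b t) (Set.Ioo (-1) 1) := by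
  refine (hf.integrableOn.abs.mul_const Real.pi).mono' (hf.measurable.mul
    ((measurable_cutTail K b).comp Complex.measurable_ofReal)).aestronglyMeasurable
    (Eventually.of_forall fun t => ?_)
  rw [norm_mul, Real.norm_eq_abs, Real.norm_eq_abs]
  exact mul_le_mul_of_nonneg_left (abs_cutTail_le _ _ _) (abs_nonneg _)

/-- Testing the magnetic charge with a truncated tail detects the wall. -/
lemma IsMagnetisation.abs_integral_mul_cutTail_sub_le (h : IsMagnetisation α a d m) {b r : ℝ}
    (hr : 0 < r) (hb : b ∈ Set.Ioo (-1 : ℝ) 1) (hmb : m b 0 ^ 2 = 1) :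
    |(∫ t in Set.Ioo (-1 : ℝ) 1, deriv (fun s => m s 0) t * cutTail (2 / r) b t) -
      Real.pi * (m b 0 - Real.cos α)| ≤ Real.pi * r * exchange m := by
  set f := deriv fun s => m s 0 with hf
  have hd : IsDensity f := h.isDensity
  set J := Set.Ioo (b - r) (b + r) with hJ
  have hJm : MeasurableSet J := measurableSet_Ioo
  set g : ℝ → ℝ := fun t => if t < b then Real.pi / 2 else -(Real.pi / 2) with hg
  have hgm : Measurable g := Measurable.ite measurableSet_Iio measurable_const measurable_const
  have ig : IntegrableOn (fun t => f t * g t) (Set.Ioo (-1) 1) := by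
    refine (hd.integrableOn.abs.mul_const (Real.pi / 2)).mono'
      (hd.measurable.mul hgm).aestronglyMeasurable (Eventually.of_forall fun t => ?_)
    rw [norm_mul, Real.norm_eq_abs, Real.norm_eq_abs]
    refine mul_le_mul_of_nonneg_left ?_ (abs_nonneg _)
    have := Real.pi_pos
    simp only [hg]
    split_ifs
    · rw [abs_of_pos (by linarith)]
    · rw [abs_neg, abs_of_pos (by linarith)]
  -- The step function g carries the boundary values of the uncut tail; each half interval
  -- contributes π/2 times m₁(b) - cos α.
  have eg : ∫ t in Set.Ioo (-1 : ℝ) 1, f t * g t = Real.pi * (m b 0 - Real.cos α) := by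
    have hu : Set.Ioo (-1 : ℝ) 1 = Set.Ioo (-1) b ∪ Set.Ico b 1 :=
      (Set.Ioo_union_Ico_eq_Ioo hb.1 hb.2.le).symm
    rw [hu] at ig ⊢
    rw [setIntegral_union (Set.disjoint_left.2 fun t h1 h2 => h2.1.not_gt h1.2) measurableSet_Ico
      (ig.mono_set Set.subset_union_left) (ig.mono_set Set.subset_union_right)]
    have e1 : ∫ t in Set.Ioo (-1) b, f t * g t = (m b 0 - Real.cos α) * (Real.pi / 2) := by
      rw [setIntegral_congr_fun (g := fun t => f t * (Real.pi / 2)) measurableSet_Ioo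
        fun t ht => by simp only [hg]; rw [if_pos ht.2], integral_mul_const,
        setIntegral_deriv_Ioo (h.sobolev 0).1 le_rfl hb.1.le hb.2.le, h.left_boundary]
    have e2 : ∫ t in Set.Ico b 1, f t * g t = (Real.cos α - m b 0) * -(Real.pi / 2) := by
      rw [setIntegral_congr_fun (g := fun t => f t * -(Real.pi / 2)) measurableSet_Ico
        fun t ht => by simp only [hg]; rw [if_neg ht.1.not_gt], integral_mul_const,
        integral_Ico_eq_integral_Ioo,
        setIntegral_deriv_Ioo (h.sobolev 0).1 hb.1.le hb.2.le le_rfl, h.right_boundary]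
    rw [e1, e2]; ring
  have ic := integrableOn_mul_cutTail hd (2 / r) b
  have ia : IntegrableOn (fun t => f t * Real.arcsin b) (Set.Ioo (-1) 1) :=
    hd.integrableOn.mul_const _
  have e : (∫ t in Set.Ioo (-1 : ℝ) 1, f t * cutTail (2 / r) b t) -
      Real.pi * (m b 0 - Real.cos α) =
      ∫ t in Set.Ioo (-1 : ℝ) 1, ((f t * cutTail (2 / r) b t - f t * g t) + f t * Real.arcsin b) := by
    have is : IntegrableOn (fun t => f t * cutTail (2 / r) b t - f t * g t) (Set.Ioo (-1) 1) :=
      ic.sub ig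
    rw [integral_add is ia, integral_sub ic ig, integral_mul_const, hd.mean, eg]; ring
  rw [e]
  have hae : ∀ᵐ t : ℝ, t ∉ ({b} : Set ℝ) := measure_eq_zero_iff_ae_notMem.1 (by simp)
  -- The constant arcsin b drops out because f has mean zero, so only the cutoff within distance r
  -- of b produces an error.
  have hbound : ∀ᵐ t ∂(volume.restrict (Set.Ioo (-1 : ℝ) 1)),
      ‖(f t * cutTail (2 / r) b t - f t * g t) + f t * Real.arcsin b‖ ≤
      J.indicator (fun t => Real.pi / 2 * |f t|) t := by
    filter_upwards [ae_restrict_mem measurableSet_Ioo, ae_restrict_of_ae hae] with t ht htb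
    have htb' : t ≠ b := htb
    have hg' : g t = Real.arcsin (tailCos b t) := by
      rw [tailCos_ofReal ht htb']
      simp only [hg]
      split_ifs
      · rw [Real.arcsin_one]
      · rw [Real.arcsin_neg_one]
    have e2 : (f t * cutTail (2 / r) b t - f t * g t) + f t * Real.arcsin b =
        f t * ((tailCut (tailCosh b t / (2 / r)) - 1) * Real.arcsin (tailCos b t)) := by
      rw [hg', cutTail]; ring
    rw [e2]
    by_cases hJt : t ∈ J
    · rw [Set.indicator_of_mem hJt, norm_mul, norm_mul, Real.norm_eq_abs, Real.norm_eq_abs,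
        Real.norm_eq_abs, mul_comm]
      refine mul_le_mul_of_nonneg_right ?_ (abs_nonneg _)
      have h1 := tailCut_nonneg (tailCosh b t / (2 / r))
      have h2 := tailCut_le_one (tailCosh b t / (2 / r))
      have h3 : |tailCut (tailCosh b t / (2 / r)) - 1| ≤ 1 := by
        rw [abs_le]; constructor <;> linarith
      have h4 : |Real.arcsin (tailCos b t)| ≤ Real.pi / 2 :=
        abs_le.2 ⟨Real.neg_pi_div_two_le_arcsin _, Real.arcsin_le_pi_div_two _⟩
      calc _ ≤ 1 * (Real.pi / 2) := mul_le_mul h3 h4 (abs_nonneg _) zero_le_one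
        _ = _ := one_mul _
    · rw [Set.indicator_of_notMem hJt]
      have hfar : r ≤ |t - b| := by
        by_contra hc
        push Not at hc
        rw [abs_lt] at hc
        exact hJt ⟨by linarith, by linarith⟩
      rw [tailCut_eq_one]
      · simp
      · rw [div_le_one (by positivity)]
        exact (tailCosh_ofReal_le hb ht).trans (div_le_div_of_nonneg_left zero_le_two hr hfar)
  have hint : Integrable (J.indicator (fun t => Real.pi / 2 * |f t|))
      (volume.restrict (Set.Ioo (-1 : ℝ) 1)) := (hd.integrableOn.abs.const_mul _).indicator hJm
  refine (norm_integral_le_of_norm_le hint hbound).trans ?_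
  rw [setIntegral_indicator hJm, integral_const_mul]
  have := h.integral_abs_deriv_le hr.le hb hmb
  have hpi := Real.pi_pos
  calc _ ≤ Real.pi / 2 * (2 * r * exchange m) := mul_le_mul_of_nonneg_left this (by positivity)
    _ = _ := by ring

end

/-! ### Dirichlet energy of the superposed truncated tails -/

section
variable {N : ℕ} {a γ : Fin N → ℝ} {R b B K : ℝ}

lemma tailCosh_le_of_le (hb : b ∈ Set.Ioo (-1 : ℝ) 1) {ρ : ℝ} (hρ : 0 < ρ) {z : ℂ}
    (hz : ρ ≤ ‖z - b‖) : tailCosh b z ≤ 1 + 1 / ρ := by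
  have n0 : 0 < ‖z - b‖ := hρ.trans_le hz
  have h1 : ‖z - 1‖ ≤ ‖z - b‖ + (1 - b) := by
    have := norm_add_le (z - b) ((b - 1 : ℝ) : ℂ)
    rw [Complex.norm_real, Real.norm_eq_abs, abs_of_neg (by linarith [hb.2])] at this
    rw [show z - 1 = z - b + ((b - 1 : ℝ) : ℂ) by push_cast; ring]
    linarith
  have h2 : ‖z + 1‖ ≤ ‖z - b‖ + (1 + b) := by
    have := norm_add_le (z - b) ((b + 1 : ℝ) : ℂ)
    rw [Complex.norm_real, Real.norm_eq_abs, abs_of_pos (by linarith [hb.1])] at this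
    rw [show z + 1 = z - b + ((b + 1 : ℝ) : ℂ) by push_cast; ring]
    linarith
  have h3 : tailCosh b z ≤ 1 + 1 / ‖z - b‖ := by
    rw [tailCosh, div_le_iff₀ (by positivity)]
    have h4 : (1 + b) * ‖z - 1‖ ≤ (1 + b) * (‖z - b‖ + (1 - b)) :=
      mul_le_mul_of_nonneg_left h1 (by linarith [hb.1])
    have h5 : (1 - b) * ‖z + 1‖ ≤ (1 - b) * (‖z - b‖ + (1 + b)) :=
      mul_le_mul_of_nonneg_left h2 (by linarith [hb.2])
    have h6 : (1 + 1 / ‖z - b‖) * (2 * ‖z - b‖) = 2 * ‖z - b‖ + 2 := by field_simp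
    rw [h6]
    nlinarith [sq_nonneg b]
  have h4 : 1 / ‖z - b‖ ≤ 1 / ρ := one_div_le_one_div_of_le hρ hz
  linarith

/-- Close to b one has |1 - bz| ≥ 1 - (1 - R)² - R = R - R² ≥ R/2, and `tailCosh` is at least |1 -
bz|/|z - b|. -/
lemma le_tailCosh_of_lt (hR : R ∈ Set.Ioc (0 : ℝ) (1 / 2)) (hb : b ∈ Set.Icc (-1 + R) (1 - R))
    {δ : ℝ} (hδR : δ ≤ R) {z : ℂ} (hz : z ∈ upperHalf) (hzb : ‖z - b‖ < δ) :
    R / (2 * δ) ≤ tailCosh b z := by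
  have hb' : b ∈ Set.Ioo (-1 : ℝ) 1 := ⟨by linarith [hb.1, hR.1], by linarith [hb.2, hR.1]⟩
  have n0 : 0 < ‖z - b‖ := norm_pos_iff.2 (sub_ne_zero_of_upper hz b)
  have h1 := norm_one_sub_mul_le hb' z
  have h2 := le_norm_one_sub_mul hb' z
  have h3 : b ^ 2 ≤ (1 - R) ^ 2 := sq_le_sq' (by linarith [hb.1]) hb.2
  have h4 : R / 2 ≤ ‖1 - b * z‖ := by nlinarith [hR.1, hR.2]
  have h5 : R / (2 * δ) ≤ R / (2 * ‖z - b‖) :=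
    div_le_div_of_nonneg_left hR.1.le (by positivity) (by linarith)
  refine h5.trans ?_
  rw [tailCosh]
  exact div_le_div_of_nonneg_right (by linarith) (by positivity)

lemma integrable_indicator_tailDensity (hb : b ∈ Set.Ioo (-1 : ℝ) 1) {lo hi : ℝ} (hlo : 0 < lo) :
    Integrable ((tailRegion b lo hi).indicator (tailDensity b)) :=
  (integrable_indicator_iff (measurableSet_tailRegion b lo hi)).2 (integrableOn_tailDensity hb hlo)

lemma setIntegral_indicator_tailDensity_le (hb : b ∈ Set.Ioo (-1 : ℝ) 1) {lo hi : ℝ} (hlo : 0 < lo)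
    (hlh : lo ≤ 2 * hi) (s : Set ℂ) :
    ∫ z in s, (tailRegion b lo hi).indicator (tailDensity b) z ≤
      Real.pi * (Real.log (2 * hi) - Real.log lo) := by
  refine (setIntegral_le_integral (integrable_indicator_tailDensity hb hlo)
    (Eventually.of_forall fun z => Set.indicator_nonneg
      (fun z _ => tailDensity_nonneg hb z) z)).trans ?_
  rw [integral_indicator (measurableSet_tailRegion b lo hi)]
  exact integral_tailDensity_le hb hlo hlh

lemma memLp_gradient_cutTail (hK : 0 < K) (hb : b ∈ Set.Ioo (-1 : ℝ) 1) :
    MemLp (gradient (cutTail K b)) 2 (volume.restrict upperHalf) := by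
  obtain ⟨B, -, hB⟩ := exists_bound_deriv_tailCut
  rw [memLp_two_iff_integrable_sq_norm (measurable_gradient _).aestronglyMeasurable]
  refine ((integrable_indicator_tailDensity hb (lo := 1) (hi := 2 * K) zero_lt_one).add
    ((integrable_indicator_tailDensity hb (lo := K) (hi := 2 * K) hK).const_mul
      (16 * B ^ 2))).integrableOn.mono' ((measurable_gradient _).norm.pow_const 2).aestronglyMeasurable ?_
  filter_upwards [ae_restrict_mem measurableSet_upperHalf] with z hz
  rw [Real.norm_of_nonneg (sq_nonneg _)]
  exact norm_gradient_cutTail_sq_le hB hK hb hz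

/-- The area of a rectangle of height π and length log(4K) gives the logarithm with the sharp
constant π; the transition zone has length log 4 and contributes a constant. -/
lemma integral_norm_gradient_cutTail_sq_le (hB : ∀ s, |deriv tailCut s| ≤ B) (hK : 1 ≤ K)
    (hb : b ∈ Set.Ioo (-1 : ℝ) 1) : ∫ z in upperHalf, ‖gradient (cutTail K b) z‖ ^ 2 ≤
      Real.pi * Real.log K + (1 + 16 * B ^ 2) * (Real.pi * Real.log 4) := by
  have hK0 : 0 < K := by linarith
  have i1 := integrable_indicator_tailDensity hb (lo := 1) (hi := 2 * K) zero_lt_one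
  have i2 := integrable_indicator_tailDensity hb (lo := K) (hi := 2 * K) hK0
  have h1 := setIntegral_indicator_tailDensity_le hb (lo := 1) (hi := 2 * K) zero_lt_one
    (by linarith) upperHalf
  have h2 := setIntegral_indicator_tailDensity_le hb (lo := K) (hi := 2 * K) hK0
    (by linarith) upperHalf
  rw [show 2 * (2 * K) = 4 * K by ring, Real.log_mul (by norm_num) hK0.ne'] at h1 h2
  rw [Real.log_one] at h1
  calc ∫ z in upperHalf, ‖gradient (cutTail K b) z‖ ^ 2
      ≤ ∫ z in upperHalf, ((tailRegion b 1 (2 * K)).indicator (tailDensity b) z +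
        16 * B ^ 2 * (tailRegion b K (2 * K)).indicator (tailDensity b) z) :=
        setIntegral_mono_on (memLp_gradient_cutTail hK0 hb).norm.integrable_sq
          (i1.add (i2.const_mul _)).integrableOn measurableSet_upperHalf
          fun z hz => norm_gradient_cutTail_sq_le hB hK0 hb hz
    _ = (∫ z in upperHalf, (tailRegion b 1 (2 * K)).indicator (tailDensity b) z) +
        16 * B ^ 2 * ∫ z in upperHalf, (tailRegion b K (2 * K)).indicator (tailDensity b) z := by
        rw [integral_add i1.integrableOn (i2.const_mul _).integrableOn, integral_const_mul]
    _ ≤ Real.pi * (Real.log 4 + Real.log K - 0) +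
        16 * B ^ 2 * (Real.pi * (Real.log 4 + Real.log K - Real.log K)) := by gcongr
    _ = _ := by ring

lemma norm_gradient_cutTail_sq_le_indicator (hB : ∀ s, |deriv tailCut s| ≤ B) (hK : 1 ≤ K)
    (hb : b ∈ Set.Ioo (-1 : ℝ) 1) {z : ℂ} (hz : z ∈ upperHalf) :
    ‖gradient (cutTail K b) z‖ ^ 2 ≤
      (1 + 16 * B ^ 2) * (tailRegion b 1 (2 * K)).indicator (tailDensity b) z := by
  have h1 := norm_gradient_cutTail_sq_le hB (by linarith : 0 < K) hb hz
  have h2 : (tailRegion b K (2 * K)).indicator (tailDensity b) z ≤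
      (tailRegion b 1 (2 * K)).indicator (tailDensity b) z :=
    Set.indicator_le_indicator_of_subset (show tailRegion b K (2 * K) ⊆ tailRegion b 1 (2 * K) from
      fun w hw => ⟨hw.1, hK.trans hw.2.1, hw.2.2⟩) (tailDensity_nonneg hb) z
  have h3 := mul_le_mul_of_nonneg_left h2 (by positivity : 0 ≤ 16 * B ^ 2)
  linarith

/-- The part of the half-plane close to the walls. -/
def coreSet (a : Fin N → ℝ) (δ : ℝ) : Set ℂ := {z | z ∈ upperHalf ∧ ∃ n, ‖z - a n‖ < δ}

lemma measurableSet_coreSet (a : Fin N → ℝ) (δ : ℝ) : MeasurableSet (coreSet a δ) := by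
  have : coreSet a δ = upperHalf ∩ ⋃ n, {z : ℂ | ‖z - a n‖ < δ} := by
    ext z; simp [coreSet]
  rw [this]
  exact measurableSet_upperHalf.inter (MeasurableSet.iUnion fun n =>
    measurableSet_lt (by fun_prop) measurable_const)

lemma coreSet_subset (a : Fin N → ℝ) (δ : ℝ) : coreSet a δ ⊆ upperHalf := fun _ h => h.1

/-- In the ball around a_n itself, `tailCosh` lies between R/(2δ) and 2K where the gradient is
nonzero; the logarithm of the ratio is bounded because Kδ ≤ Q. In the other balls z is at distance
at least R from a_n and `tailCosh` is at most 1 + 1/R. -/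
lemma integral_core_norm_gradient_cutTail_sq_le (hB : ∀ s, |deriv tailCut s| ≤ B) (hK : 1 ≤ K)
    (hR : R ∈ Set.Ioc (0 : ℝ) (1 / 2)) (ha : IsSeparated R a) {δ Q : ℝ} (hδ : 0 < δ) (hδR : δ ≤ R)
    (hKδ : 1 ≤ K * δ) (hQ : K * δ ≤ Q) (n : Fin N) : ∫ z in coreSet a δ, ‖gradient (cutTail K (a n)) z‖ ^ 2 ≤
      (1 + 16 * B ^ 2) * (Real.pi * Real.log (8 * Q / R) + Real.pi * Real.log (2 * (1 + 1 / R))) := by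
  have hK0 : 0 < K := by linarith
  have hR0 := hR.1
  have hb := ha.mem_Ioo hR0 n
  have hl : 0 < R / (2 * δ) := by positivity
  have hQ0 : 0 < Q := (mul_pos hK0 hδ).trans_le hQ
  have hlh : R / (2 * δ) ≤ 2 * (2 * K) := by
    rw [div_le_iff₀ (by positivity)]
    linarith [hR.2]
  have i1 := integrable_indicator_tailDensity hb (lo := R / (2 * δ)) (hi := 2 * K) hl
  have i2 := integrable_indicator_tailDensity hb (lo := 1) (hi := 1 + 1 / R) zero_lt_one
  have h1 := setIntegral_indicator_tailDensity_le hb (hi := 2 * K) hl hlh (coreSet a δ)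
  have hR3 : 0 < 1 / R := by positivity
  have h2 := setIntegral_indicator_tailDensity_le hb (lo := 1) (hi := 1 + 1 / R) zero_lt_one
    (by linarith) (coreSet a δ)
  rw [Real.log_one, sub_zero] at h2
  have h3 : Real.log (2 * (2 * K)) - Real.log (R / (2 * δ)) ≤ Real.log (8 * Q / R) := by
    rw [← Real.log_div (by positivity) hl.ne']
    refine Real.log_le_log (by positivity) ?_
    rw [div_div_eq_mul_div]
    refine div_le_div_of_nonneg_right ?_ hR0.le
    linarith
  calc ∫ z in coreSet a δ, ‖gradient (cutTail K (a n)) z‖ ^ 2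
      ≤ ∫ z in coreSet a δ, (1 + 16 * B ^ 2) *
        ((tailRegion (a n) (R / (2 * δ)) (2 * K)).indicator (tailDensity (a n)) z +
        (tailRegion (a n) 1 (1 + 1 / R)).indicator (tailDensity (a n)) z) := by
        refine setIntegral_mono_on (((memLp_gradient_cutTail hK0 hb).norm.integrable_sq).mono_measure
          (Measure.restrict_mono_set _ (coreSet_subset a δ)))
          ((i1.add i2).const_mul _).integrableOn (measurableSet_coreSet a δ) fun z hz => ?_
        refine (norm_gradient_cutTail_sq_le_indicator hB hK hb hz.1).trans ?_
        refine mul_le_mul_of_nonneg_left ?_ (by positivity)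
        have n1 : ∀ lo hi, 0 ≤ (tailRegion (a n) lo hi).indicator (tailDensity (a n)) z :=
          fun lo hi => Set.indicator_nonneg (fun z _ => tailDensity_nonneg hb z) z
        by_cases hm : z ∈ tailRegion (a n) 1 (2 * K)
        · rw [Set.indicator_of_mem hm]
          by_cases hd : ‖z - a n‖ < δ
          · rw [Set.indicator_of_mem (show z ∈ tailRegion (a n) (R / (2 * δ)) (2 * K) from
              ⟨hz.1, le_tailCosh_of_lt hR (ha.mem n) hδR hz.1 hd, hm.2.2⟩)]
            exact le_add_of_nonneg_right (n1 _ _)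
          · have hfar : R ≤ ‖z - a n‖ := by
              obtain ⟨k, hk⟩ := hz.2
              have hkn : k ≠ n := fun h => hd (h ▸ hk)
              have h4 := ha.dist k n hkn
              have h5 : |a k - a n| ≤ ‖z - a k‖ + ‖z - a n‖ := by
                have := norm_sub_le (z - a n) (z - a k)
                rw [show z - (a n : ℂ) - (z - a k) = ((a k - a n : ℝ) : ℂ) by push_cast; ring,
                  Complex.norm_real, Real.norm_eq_abs] at this
                linarith
              linarith
            rw [Set.indicator_of_mem (show z ∈ tailRegion (a n) 1 (1 + 1 / R) from
              ⟨hz.1, hm.2.1, tailCosh_le_of_le hb hR0 hfar⟩)]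
            exact le_add_of_nonneg_left (n1 _ _)
        · rw [Set.indicator_of_notMem hm]
          exact add_nonneg (n1 _ _) (n1 _ _)
    _ = (1 + 16 * B ^ 2) * ((∫ z in coreSet a δ, (tailRegion (a n) (R / (2 * δ)) (2 * K)).indicator
        (tailDensity (a n)) z) + ∫ z in coreSet a δ,
        (tailRegion (a n) 1 (1 + 1 / R)).indicator (tailDensity (a n)) z) := by
        rw [integral_const_mul, integral_add i1.integrableOn i2.integrableOn]
    _ ≤ _ := by
        refine mul_le_mul_of_nonneg_left (add_le_add (h1.trans ?_) h2) (by positivity)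
        exact mul_le_mul_of_nonneg_left h3 Real.pi_pos.le

lemma norm_gradient_cutTail_mul_le (hB : ∀ s, |deriv tailCut s| ≤ B) (hK : 1 ≤ K) {b' : ℝ}
    (hb : b ∈ Set.Ioo (-1 : ℝ) 1) (hb' : b' ∈ Set.Ioo (-1 : ℝ) 1) {z : ℂ} (hz : z ∈ upperHalf) :
    ‖gradient (cutTail K b) z‖ * ‖gradient (cutTail K b') z‖ ≤
      (1 + 16 * B ^ 2) * (1 / (‖z - b‖ * ‖z - b'‖ * (‖z - 1‖ * ‖z + 1‖))) := by
  have key : ∀ c ∈ Set.Ioo (-1 : ℝ) 1, ‖gradient (cutTail K c) z‖ ^ 2 ≤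
      (1 + 16 * B ^ 2) * (1 / (‖z - c‖ ^ 2 * (‖z - 1‖ * ‖z + 1‖))) := by
    intro c hc
    refine (norm_gradient_cutTail_sq_le_indicator hB hK hc hz).trans ?_
    refine mul_le_mul_of_nonneg_left ?_ (by positivity)
    refine (Set.indicator_le_self' (fun _ _ => tailDensity_nonneg hc z) z).trans ?_
    exact div_le_div_of_nonneg_right (by nlinarith [sq_nonneg c]) (by positivity)
  refine le_of_sq_le_sq ?_ (by positivity)
  rw [mul_pow]
  refine (mul_le_mul (key b hb) (key b' hb') (sq_nonneg _) (by positivity)).trans (le_of_eq ?_)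
  ring

/-- For distinct walls the product of the gradients has only a first order pole at each wall and
inverse square root singularities at ±1; the majorant with first order poles at four separated
points is integrable. The bound is therefore independent of K. -/
lemma integral_cross_le (hB : ∀ s, |deriv tailCut s| ≤ B) (hK : 1 ≤ K)
    (hR : R ∈ Set.Ioc (0 : ℝ) (1 / 2)) (ha : IsSeparated R a) {n k : Fin N} (hnk : n ≠ k) :
    ∫ z in upperHalf, ‖gradient (cutTail K (a n)) z‖ * ‖gradient (cutTail K (a k)) z‖ ≤
      (1 + 16 * B ^ 2) * (4 * (5 / R) ^ 3 * (4 * ∫ z, kernelW z)) := by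
  have hK0 : 0 < K := by linarith
  have hR0 := hR.1
  have hn := ha.mem_Ioo hR0 n
  have hk := ha.mem_Ioo hR0 k
  have hreal : ∀ x y : ℝ, ‖(x : ℂ) - y‖ = |x - y| := fun x y => by
    rw [← Complex.ofReal_sub, Complex.norm_real, Real.norm_eq_abs]
  have h1 : ∀ n, R ≤ ‖(a n : ℂ) - 1‖ := fun n => by
    rw [← Complex.ofReal_one, hreal, abs_sub_comm]
    exact le_trans (by linarith [(ha.mem n).2]) (le_abs_self _)
  have h2 : ∀ n, R ≤ ‖(a n : ℂ) - -1‖ := fun n => by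
    rw [← Complex.ofReal_one, ← Complex.ofReal_neg, hreal]
    exact le_trans (by linarith [(ha.mem n).1]) (le_abs_self _)
  have h3 : ∀ x ∈ Set.Ioo (-1 : ℝ) 1, ‖(x : ℂ)‖ ≤ 1 := fun x hx => by
    rw [Complex.norm_real]; exact abs_le_of_mem_Ioo hx
  have h4 : R ≤ ‖(a n : ℂ) - a k‖ := by
    rw [hreal]; linarith [ha.dist n k hnk]
  have i := integrable_kernelW_sub
  have i12 : Integrable (fun z : ℂ => kernelW (z - a n) + kernelW (z - a k)) := (i _).add (i _)
  have i123 : Integrable (fun z : ℂ => kernelW (z - a n) + kernelW (z - a k) + kernelW (z - 1)) :=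
    i12.add (i _)
  have i1234 : Integrable (fun z : ℂ => kernelW (z - a n) + kernelW (z - a k) + kernelW (z - 1) +
    kernelW (z - -1)) := i123.add (i _)
  have hpt : ∀ z ∈ upperHalf, ‖gradient (cutTail K (a n)) z‖ * ‖gradient (cutTail K (a k)) z‖ ≤
      (1 + 16 * B ^ 2) * (4 * (5 / R) ^ 3 * (kernelW (z - a n) + kernelW (z - a k) +
        kernelW (z - 1) + kernelW (z - -1))) := by
    intro z hz
    refine (norm_gradient_cutTail_mul_le hB hK hn hk hz).trans ?_
    refine mul_le_mul_of_nonneg_left ?_ (by positivity)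
    have := cross_kernel_le hR0 (by linarith [hR.2]) (h3 _ hn) (h3 _ hk) (r := 1) (s := -1)
      (by simp) (by simp) h4 (h1 n) (h2 n) (h1 k) (h2 k)
      (by rw [show (1 : ℂ) - -1 = 2 by norm_num]; norm_num; linarith [hR.2]) z
    rwa [show z + 1 = z - -1 by ring]
  have hint : Integrable (fun z : ℂ => (1 + 16 * B ^ 2) * (4 * (5 / R) ^ 3 *
      (kernelW (z - a n) + kernelW (z - a k) + kernelW (z - 1) + kernelW (z - -1)))) :=
    (i1234.const_mul _).const_mul _
  refine (setIntegral_mono_on ((memLp_gradient_cutTail hK0 hn).norm.integrable_mul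
    (memLp_gradient_cutTail hK0 hk).norm) hint.integrableOn measurableSet_upperHalf hpt).trans ?_
  refine (setIntegral_le_integral hint (Eventually.of_forall fun z => ?_)).trans (le_of_eq ?_)
  · have := kernelW_nonneg
    have hA : 0 ≤ kernelW (z - a n) + kernelW (z - a k) + kernelW (z - 1) + kernelW (z - -1) := by
      linarith [this (z - a n), this (z - a k), this (z - 1), this (z - -1)]
    show 0 ≤ _
    positivity
  · rw [integral_const_mul, integral_const_mul]
    congr 2
    have e1 : ∫ z : ℂ, (kernelW (z - a n) + kernelW (z - a k) + kernelW (z - 1) +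
        kernelW (z - -1)) = (∫ z : ℂ, kernelW (z - a n)) + (∫ z : ℂ, kernelW (z - a k)) +
        (∫ z : ℂ, kernelW (z - 1)) + ∫ z : ℂ, kernelW (z - -1) := by
      rw [integral_add i123 (i _), integral_add i12 (i _), integral_add (i _) (i _)]
    rw [e1]
    simp only [integral_kernelW_sub]
    ring

/-- The superposition of truncated tails that serves as a test function. -/
noncomputable def tailSum (γ a : Fin N → ℝ) (K : ℝ) (z : ℂ) : ℝ := ∑ n, γ n * cutTail K (a n) z

lemma hasGradientAt_sum_mul {g : Fin N → ℂ → ℝ} {g' : Fin N → ℂ} {z : ℂ}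
    (h : ∀ n, HasGradientAt (g n) (g' n) z) (γ : Fin N → ℝ) :
    HasGradientAt (fun w => ∑ n, γ n * g n w) (∑ n, γ n • g' n) z := by
  simp only [hasGradientAt_iff_hasFDerivAt] at h ⊢
  refine (HasFDerivAt.fun_sum fun n _ => (h n).const_mul (γ n)).congr_fderiv ?_
  rw [map_sum]
  exact Finset.sum_congr rfl fun n _ => (map_smul _ (γ n) (g' n)).symm

lemma hasGradientAt_tailSum (ha : ∀ n, a n ∈ Set.Ioo (-1 : ℝ) 1) (γ : Fin N → ℝ) (K : ℝ) {z : ℂ}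
    (hz : z ∈ upperHalf) :
    HasGradientAt (tailSum γ a K) (∑ n, γ n • gradient (cutTail K (a n)) z) z :=
  hasGradientAt_sum_mul (fun n => (differentiableAt_cutTail (ha n) K hz).hasGradientAt) γ

lemma isAdmissible_tailSum (hK : 1 ≤ K) (ha : ∀ n, a n ∈ Set.Ioo (-1 : ℝ) 1) (γ : Fin N → ℝ) :
    ∃ M, 0 ≤ M ∧ IsAdmissible M (tailSum γ a K) (fun t => tailSum γ a K t) := by
  choose M hM0 hM using fun n => isAdmissible_cutTail hK (ha n)
  refine ⟨∑ n, |γ n| * M n, Finset.sum_nonneg fun n _ => mul_nonneg (abs_nonneg _) (hM0 n),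
    fun z hz => (hasGradientAt_tailSum ha γ K hz).differentiableAt, fun z hz => ?_, ?_, ?_⟩
  · rw [(hasGradientAt_tailSum ha γ K hz).gradient, Finset.sum_mul]
    refine (norm_sum_le _ _).trans (Finset.sum_le_sum fun n _ => ?_)
    rw [norm_smul, Real.norm_eq_abs, mul_assoc]
    exact mul_le_mul_of_nonneg_left ((hM n).bound z hz) (abs_nonneg _)
  · have := ae_all_iff.2 fun n => (hM n).trace
    filter_upwards [this] with t ht
    exact tendsto_finsetSum _ fun n _ => (ht n).const_mul (γ n)
  · have := tendsto_finsetSum Finset.univ fun n _ => (hM n).tendsto.const_mul (γ n)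
    simp only [mul_zero, Finset.sum_const_zero] at this
    exact this

lemma memLp_gradient_tailSum (hK : 0 < K) (ha : ∀ n, a n ∈ Set.Ioo (-1 : ℝ) 1) (γ : Fin N → ℝ) :
    MemLp (gradient (tailSum γ a K)) 2 (volume.restrict upperHalf) := by
  have h : MemLp (fun z => ∑ n, γ n • gradient (cutTail K (a n)) z) 2
      (volume.restrict upperHalf) :=
    memLp_finsetSum _ fun n _ => (memLp_gradient_cutTail hK (ha n)).const_smul (γ n)
  refine (memLp_congr_ae ?_).1 h
  filter_upwards [ae_restrict_mem measurableSet_upperHalf] with z hz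
  rw [(hasGradientAt_tailSum ha γ K hz).gradient]

/-- The Dirichlet energy of the test function. -/
lemma exists_bound_integral_tailSum (N : ℕ) (hR : R ∈ Set.Ioc (0 : ℝ) (1 / 2)) :
    ∃ C : ℝ, 0 ≤ C ∧ ∀ a γ : Fin N → ℝ, IsSeparated R a → (∀ n, |γ n| ≤ 2) → ∀ K, 1 ≤ K →
      ∫ z in upperHalf, ‖gradient (tailSum γ a K) z‖ ^ 2 ≤
        Real.pi * (∑ n, γ n ^ 2) * Real.log K + C := by
  obtain ⟨B, -, hB⟩ := exists_bound_deriv_tailCut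
  have hW : 0 ≤ ∫ z, kernelW z := integral_nonneg kernelW_nonneg
  have hR0 := hR.1
  set D := (1 + 16 * B ^ 2) * (Real.pi * Real.log 4) with hD
  set X := (1 + 16 * B ^ 2) * (4 * (5 / R) ^ 3 * (4 * ∫ z, kernelW z)) with hX
  have hD0 : 0 ≤ D := mul_nonneg (by positivity)
    (mul_nonneg Real.pi_pos.le (Real.log_nonneg (by norm_num)))
  have hX0 : 0 ≤ X := by positivity
  refine ⟨N * (4 * D + N * (4 * X)), by positivity, fun a γ ha hγ K hK => ?_⟩
  have hK0 : 0 < K := by linarith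
  have hb := ha.mem_Ioo hR0
  have hi : ∀ n k, IntegrableOn (fun z => |γ n| * |γ k| * (‖gradient (cutTail K (a n)) z‖ *
      ‖gradient (cutTail K (a k)) z‖)) upperHalf := fun n k =>
    ((memLp_gradient_cutTail hK0 (hb n)).norm.integrable_mul
      (memLp_gradient_cutTail hK0 (hb k)).norm).const_mul _
  have hpt : ∀ z ∈ upperHalf, ‖gradient (tailSum γ a K) z‖ ^ 2 ≤ ∑ n, ∑ k, |γ n| * |γ k| *
      (‖gradient (cutTail K (a n)) z‖ * ‖gradient (cutTail K (a k)) z‖) := by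
    intro z hz
    rw [(hasGradientAt_tailSum hb γ K hz).gradient]
    refine (pow_le_pow_left₀ (norm_nonneg _) (norm_sum_le _ _) 2).trans (le_of_eq ?_)
    rw [sq, Finset.sum_mul_sum]
    refine Finset.sum_congr rfl fun n _ => Finset.sum_congr rfl fun k _ => ?_
    rw [norm_smul, norm_smul, Real.norm_eq_abs, Real.norm_eq_abs]
    ring
  have hsq : ∀ n k, |γ n| * |γ k| ≤ 4 := fun n k => by
    have := mul_le_mul (hγ n) (hγ k) (abs_nonneg _) zero_le_two
    linarith
  calc ∫ z in upperHalf, ‖gradient (tailSum γ a K) z‖ ^ 2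
      ≤ ∫ z in upperHalf, ∑ n, ∑ k, |γ n| * |γ k| *
        (‖gradient (cutTail K (a n)) z‖ * ‖gradient (cutTail K (a k)) z‖) :=
        setIntegral_mono_on (memLp_gradient_tailSum hK0 hb γ).norm.integrable_sq
          (integrable_finsetSum _ fun n _ => integrable_finsetSum _ fun k _ => hi n k)
          measurableSet_upperHalf hpt
    _ = ∑ n, ∑ k, |γ n| * |γ k| * ∫ z in upperHalf,
        ‖gradient (cutTail K (a n)) z‖ * ‖gradient (cutTail K (a k)) z‖ := by
        rw [integral_finsetSum _ fun n _ => integrable_finsetSum _ fun k _ => hi n k]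
        refine Finset.sum_congr rfl fun n _ => ?_
        rw [integral_finsetSum _ fun k _ => hi n k]
        simp only [integral_const_mul]
    _ ≤ ∑ n : Fin N, ∑ k : Fin N,
        -- Only the diagonal carries log K; the factor 4 bounds |γ n|·|γ k|.
        ((if n = k then γ n ^ 2 * (Real.pi * Real.log K) + 4 * D else 0) + 4 * X) := by
        refine Finset.sum_le_sum fun n _ => Finset.sum_le_sum fun k _ => ?_
        split_ifs with h
        · subst h
          have h1 := integral_norm_gradient_cutTail_sq_le hB hK (hb n)
          simp only [← sq] at h1 ⊢
          have h2 := mul_le_mul_of_nonneg_left h1 (sq_nonneg |γ n|)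
          rw [mul_add, ← hD] at h2
          have h3 := mul_le_mul_of_nonneg_right (hsq n n) hD0
          rw [← sq] at h3
          rw [sq_abs] at h2 h3 ⊢
          linarith
        · have h1 := integral_cross_le hB hK hR ha h
          have h0 : 0 ≤ ∫ z in upperHalf, ‖gradient (cutTail K (a n)) z‖ *
              ‖gradient (cutTail K (a k)) z‖ := integral_nonneg fun z => by positivity
          rw [zero_add]
          exact mul_le_mul (hsq n k) h1 h0 (by norm_num)
    _ = _ := by
        simp only [Finset.sum_add_distrib, Finset.sum_ite_eq, Finset.mem_univ, if_true,
          Finset.sum_const, Finset.card_univ, Fintype.card_fin, nsmul_eq_mul, ← Finset.sum_mul]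
        ring

/-- The Dirichlet energy of the test function near the walls is bounded. -/
lemma exists_bound_core_tailSum (N : ℕ) (hR : R ∈ Set.Ioc (0 : ℝ) (1 / 2)) (Q : ℝ) :
    ∃ C : ℝ, 0 ≤ C ∧ ∀ a γ : Fin N → ℝ, IsSeparated R a → (∀ n, |γ n| ≤ 2) → ∀ K, 1 ≤ K →
      ∀ δ, 0 < δ → δ ≤ R → 1 ≤ K * δ → K * δ ≤ Q →
      ∫ z in coreSet a δ, ‖gradient (tailSum γ a K) z‖ ^ 2 ≤ C := by
  obtain ⟨B, -, hB⟩ := exists_bound_deriv_tailCut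
  have hR0 := hR.1
  set D := (1 + 16 * B ^ 2) *
    (Real.pi * Real.log (8 * Q / R) + Real.pi * Real.log (2 * (1 + 1 / R))) with hD
  refine ⟨N * (N * (4 * |D|)), by positivity, fun a γ ha hγ K hK δ hδ hδR hKδ hQ => ?_⟩
  have hK0 : 0 < K := by linarith
  have hb := ha.mem_Ioo hR0
  have hle := Measure.restrict_mono_set (volume : Measure ℂ) (coreSet_subset a δ)
  have hi : ∀ n, IntegrableOn (fun z => γ n ^ 2 * ‖gradient (cutTail K (a n)) z‖ ^ 2)
      (coreSet a δ) := fun n =>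
    ((memLp_gradient_cutTail hK0 (hb n)).mono_measure hle).norm.integrable_sq.const_mul _
  calc ∫ z in coreSet a δ, ‖gradient (tailSum γ a K) z‖ ^ 2
      ≤ ∫ z in coreSet a δ, N * ∑ n, γ n ^ 2 * ‖gradient (cutTail K (a n)) z‖ ^ 2 := by
        refine setIntegral_mono_on
          ((memLp_gradient_tailSum hK0 hb γ).mono_measure hle).norm.integrable_sq
          ((integrable_finsetSum _ fun n _ => hi n).const_mul _) (measurableSet_coreSet a δ)
          fun z hz => ?_
        rw [(hasGradientAt_tailSum hb γ K hz.1).gradient]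
        refine (pow_le_pow_left₀ (norm_nonneg _) (norm_sum_le _ _) 2).trans ?_
        refine (sq_sum_le_card_mul_sum_sq (s := Finset.univ)).trans (le_of_eq ?_)
        rw [Finset.card_univ, Fintype.card_fin]
        congr 1
        refine Finset.sum_congr rfl fun n _ => ?_
        rw [norm_smul, mul_pow, Real.norm_eq_abs, sq_abs]
    _ = N * ∑ n, γ n ^ 2 * ∫ z in coreSet a δ, ‖gradient (cutTail K (a n)) z‖ ^ 2 := by
        rw [integral_const_mul, integral_finsetSum _ fun n _ => hi n]
        simp only [integral_const_mul]
    _ ≤ N * ∑ _n : Fin N, 4 * |D| := by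
        refine mul_le_mul_of_nonneg_left (Finset.sum_le_sum fun n _ => ?_) (Nat.cast_nonneg N)
        have h1 := integral_core_norm_gradient_cutTail_sq_le hB hK hR ha hδ hδR hKδ hQ n
        have h2 : γ n ^ 2 ≤ 4 := by
          rw [← sq_abs]; nlinarith [hγ n, abs_nonneg (γ n)]
        exact mul_le_mul h2 (h1.trans (le_abs_self D)) (integral_nonneg fun z => sq_nonneg _)
          (by norm_num)
    _ = _ := by simp

/-- Away from the walls, the test function has the gradient of the limiting potential. -/
lemma hasGradientAt_limit (ha : ∀ n, a n ∈ Set.Ioo (-1 : ℝ) 1) (γ : Fin N → ℝ) (hK : 0 < K) {δ : ℝ}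
    (hδ : 0 < δ) (hδK : 1 + 1 / δ < K) {z : ℂ} (hz : z ∈ upperHalf) (hzc : z ∉ coreSet a δ) :
    HasGradientAt (fun w => ∑ n, γ n * basicTail (moebius (-a n) w))
      (gradient (tailSum γ a K) z) z := by
  rw [(hasGradientAt_tailSum ha γ K hz).gradient]
  refine hasGradientAt_sum_mul (fun n => hasGradientAt_basicTail_moebius (ha n) hK hz ?_) γ
  have hfar : δ ≤ ‖z - a n‖ := by
    by_contra hc
    exact hzc ⟨hz, n, not_le.1 hc⟩
  exact (tailCosh_le_of_le (ha n) hδ hfar).trans_lt hδK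

end

/-! ### Expansion of the energy around the limiting profile -/

section
variable {N : ℕ} {a d : Fin N → ℝ} {R α ε : ℝ} {m : ℝ → Plane}

lemma coreWidth_pos (hε : ε ∈ Set.Ioc (0 : ℝ) (1 / 2)) : 0 < coreWidth ε := by
  have h1 : 1 < 1 / ε := by rw [lt_div_iff₀ hε.1]; linarith [hε.2]
  exact mul_pos hε.1 (Real.log_pos h1)

/-- With x = log(1/ε) one has log(1/δ) = x - log x, so the claim is log x ≤ x/2; it follows from
log(x/2) ≤ x/2 - 1 and log 2 < 1. -/
lemma log_one_div_le (hε : ε ∈ Set.Ioc (0 : ℝ) (1 / 2)) :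
    Real.log (1 / ε) ≤ 2 * Real.log (1 / coreWidth ε) := by
  have h1 : 1 < 1 / ε := by rw [lt_div_iff₀ hε.1]; linarith [hε.2]
  have hx := Real.log_pos h1
  rw [coreWidth]
  set x := Real.log (1 / ε) with hxd
  have e : Real.log (1 / (ε * x)) = x - Real.log x := by
    rw [← div_div, Real.log_div (by have := hε.1; positivity) hx.ne', ← hxd]
  have h2 := Real.log_le_sub_one_of_pos (half_pos hx)
  rw [Real.log_div hx.ne' (by norm_num)] at h2
  have h3 := Real.log_two_lt_d9
  rw [e]
  linarith

/-- Uniqueness of the gradient transfers the explicit single layer field to the potential selected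
by the choice operator. -/
lemma IsMagnetisation.gradient_strayPotential_ae (h : IsMagnetisation α a d m) :
    ∀ᵐ x ∂(volume.restrict halfPlane), gradient (strayPotential m) x =
      toPlane (strayField (deriv fun t => m t 0) (toPlane.symm x)) := by
  filter_upwards [(isStrayPotential_strayPotential h.isDensity).gradient_ae_eq
    (isStrayPotential_layerPot (m₁ := fun t => m t 0) h.isDensity),
    ae_restrict_mem isOpen_halfPlane.measurableSet] with x hx hxh
  obtain ⟨z, rfl⟩ := toPlane.surjective x
  rw [hx, gradient_comp_symm, LinearIsometryEquiv.symm_apply_apply,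
    gradient_layerPot h.isDensity (toPlane_mem_halfPlane.1 hxh)]

lemma IsMagnetisation.setIntegral_norm_gradient_sq (h : IsMagnetisation α a d m) {s : Set Plane}
    (hs : s ⊆ halfPlane) : ∫ x in s, ‖gradient (strayPotential m) x‖ ^ 2 =
      ∫ z in toPlane ⁻¹' s, ‖strayField (deriv fun t => m t 0) z‖ ^ 2 := by
  have h1 : ∫ x in s, ‖gradient (strayPotential m) x‖ ^ 2 =
      ∫ x in s, ‖toPlane (strayField (deriv fun t => m t 0) (toPlane.symm x))‖ ^ 2 := by
    refine integral_congr_ae ?_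
    filter_upwards [ae_mono (Measure.restrict_mono_set _ hs) h.gradient_strayPotential_ae] with x hx
    rw [hx]
  rw [h1, setIntegral_toPlane]
  simp

lemma preimage_perforatedHalfPlane (a : Fin N → ℝ) (δ : ℝ) :
    toPlane ⁻¹' perforatedHalfPlane a δ = upperHalf \ coreSet a δ := by
  ext z
  have h1 : ∀ n, toPlane z ∈ Metric.ball (!₂[a n, 0] : Plane) δ ↔ ‖z - a n‖ < δ := fun n => by
    rw [← toPlane_ofReal, Metric.mem_ball, LinearIsometryEquiv.dist_map, dist_eq_norm]
  simp only [perforatedHalfPlane, Set.mem_preimage, Set.mem_sdiff, toPlane_mem_halfPlane,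
    Set.mem_iUnion, h1, coreSet, Set.mem_ofPred_eq]
  tauto

lemma limitPotential_toPlane (α : ℝ) (a d : Fin N → ℝ) (w : ℂ) :
    limitPotential α a d (toPlane w) =
      ∑ n, (d n - Real.cos α) * basicTail (moebius (-a n) w) := by
  have : (⟨toPlane w 0, toPlane w 1⟩ : ℂ) = w := by simp
  rw [limitPotential, this]

lemma IsWallSigns.abs_sub_cos_le (hd : IsWallSigns d) (α : ℝ) (n : Fin N) :
    |d n - Real.cos α| ≤ 2 := by
  have h1 := Real.neg_one_le_cos α
  have h2 := Real.cos_le_one α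
  rw [abs_le]
  rcases hd n with h | h <;> rw [h] <;> constructor <;> linarith

lemma IsWallSigns.wallStrength_le (hd : IsWallSigns d) (α : ℝ) : wallStrength α d ≤ 4 * N := by
  have : ∀ n ∈ Finset.univ, (d n - Real.cos α) ^ 2 ≤ 4 := fun n _ => by
    rw [← sq_abs]; nlinarith [hd.abs_sub_cos_le α n, abs_nonneg (d n - Real.cos α)]
  have := Finset.sum_le_sum this
  simp only [Finset.sum_const, Finset.card_univ, Fintype.card_fin, nsmul_eq_mul] at this
  rw [wallStrength]; linarith

/-- The work of the magnetic charge against the test function. -/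
lemma IsMagnetisation.abs_integral_mul_tailSum_sub_le (h : IsMagnetisation α a d m)
    (hd : IsWallSigns d) (ha : ∀ n, a n ∈ Set.Ioo (-1 : ℝ) 1) {r : ℝ} (hr : 0 < r) :
    |(∫ t in Set.Ioo (-1 : ℝ) 1, deriv (fun s => m s 0) t *
      tailSum (fun n => d n - Real.cos α) a (2 / r) t) - Real.pi * wallStrength α d| ≤
      N * (2 * (Real.pi * r * exchange m)) := by
  set f := deriv fun s => m s 0 with hf
  have e1 : ∫ t in Set.Ioo (-1 : ℝ) 1, f t * tailSum (fun n => d n - Real.cos α) a (2 / r) t =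
      ∑ n, (d n - Real.cos α) * ∫ t in Set.Ioo (-1 : ℝ) 1, f t * cutTail (2 / r) (a n) t := by
    simp only [← integral_const_mul]
    rw [← integral_finsetSum _ fun n _ =>
      (integrableOn_mul_cutTail h.isDensity (2 / r) (a n)).const_mul _]
    congr 1; ext1 t
    rw [tailSum, Finset.mul_sum]
    exact Finset.sum_congr rfl fun n _ => by ring
  have e2 : Real.pi * wallStrength α d =
      ∑ n, (d n - Real.cos α) * (Real.pi * (m (a n) 0 - Real.cos α)) := by
    rw [wallStrength, Finset.mul_sum]
    exact Finset.sum_congr rfl fun n _ => by rw [h.wall n]; ring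
  rw [e1, e2, ← Finset.sum_sub_distrib]
  refine (Finset.abs_sum_le_sum_abs _ _).trans ?_
  have h1 : ∀ n ∈ Finset.univ, |(d n - Real.cos α) *
      (∫ t in Set.Ioo (-1 : ℝ) 1, f t * cutTail (2 / r) (a n) t) -
      (d n - Real.cos α) * (Real.pi * (m (a n) 0 - Real.cos α))| ≤
      2 * (Real.pi * r * exchange m) := by
    intro n _
    rw [← mul_sub, abs_mul]
    have hw : m (a n) 0 ^ 2 = 1 := by
      rw [h.wall n]; rcases hd n with h | h <;> rw [h] <;> norm_num
    exact mul_le_mul (hd.abs_sub_cos_le α n) (h.abs_integral_mul_cutTail_sub_le hr (ha n) hw)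
      (abs_nonneg _) zero_le_two
  refine (Finset.sum_le_sum h1).trans (le_of_eq ?_)
  simp

lemma integral_norm_sub_smul_sq {X E : Type*} [MeasurableSpace X] {μ : Measure X}
    [NormedAddCommGroup E] [InnerProductSpace ℝ E] {V G : X → E} (hV : MemLp V 2 μ)
    (hG : MemLp G 2 μ) (l : ℝ) : ∫ x, ‖V x - l • G x‖ ^ 2 ∂μ =
      (∫ x, ‖V x‖ ^ 2 ∂μ) - 2 * l * (∫ x, inner ℝ (V x) (G x) ∂μ) +
        l ^ 2 * ∫ x, ‖G x‖ ^ 2 ∂μ := by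
  have i1 := hV.norm.integrable_sq
  have i2 := (integrable_inner_of_memLp hV hG).const_mul (2 * l)
  have i3 := hG.norm.integrable_sq.const_mul (l ^ 2)
  have i12 : Integrable (fun x => ‖V x‖ ^ 2 - 2 * l * inner ℝ (V x) (G x)) μ := i1.sub i2
  rw [← integral_const_mul, ← integral_const_mul, ← integral_sub i1 i2, ← integral_add i12 i3]
  congr 1; ext1 x
  rw [norm_sub_sq_real, real_inner_smul_right, norm_smul, mul_pow, Real.norm_eq_abs, sq_abs]
  ring

lemma integral_norm_sq_le_two_mul {X E : Type*} [MeasurableSpace X] {μ : Measure X}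
    [NormedAddCommGroup E] [InnerProductSpace ℝ E] {V G : X → E} (hV : MemLp V 2 μ)
    (hG : MemLp G 2 μ) (l : ℝ) : ∫ x, ‖V x‖ ^ 2 ∂μ ≤
      2 * (∫ x, ‖V x - l • G x‖ ^ 2 ∂μ) + 2 * l ^ 2 * ∫ x, ‖G x‖ ^ 2 ∂μ := by
  have i1 : Integrable (fun x => 2 * ‖V x - l • G x‖ ^ 2) μ :=
    (hV.sub (hG.const_smul l)).norm.integrable_sq.const_mul 2
  have i2 := hG.norm.integrable_sq.const_mul (2 * l ^ 2)
  rw [← integral_const_mul, ← integral_const_mul, ← integral_add i1 i2]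
  refine integral_mono hV.norm.integrable_sq (i1.add i2) fun x => ?_
  have h1 : ‖V x‖ ≤ ‖V x - l • G x‖ + |l| * ‖G x‖ := by
    have := norm_add_le (V x - l • G x) (l • G x)
    rwa [sub_add_cancel, norm_smul, Real.norm_eq_abs] at this
  have h2 := pow_le_pow_left₀ (norm_nonneg _) h1 2
  simp only
  nlinarith [sq_nonneg (‖V x - l • G x‖ - |l| * ‖G x‖), sq_abs l]

/-- The expansion of the energy of the stray field around the limiting tail profile. -/
lemma exists_bound_strayField (N : ℕ) (hN : 0 < N) (hR : R ∈ Set.Ioc (0 : ℝ) (1 / 2)) {C₀ : ℝ}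
    (hC₀ : 0 < C₀) : ∃ C₁ : ℝ, 0 < C₁ ∧ ∀ a d : Fin N → ℝ, IsSeparated R a → IsWallSigns d →
      ∀ ε ∈ Set.Ioc (0 : ℝ) (1 / 2), coreWidth ε ≤ R → ∀ (α : ℝ) (m : ℝ → Plane),
      IsMagnetisation α a d m → energy ε m ≤
        Real.pi * wallStrength α d / (2 * Real.log (1 / coreWidth ε)) +
          C₀ / Real.log (1 / coreWidth ε) ^ 2 →
      ∃ K, 0 < K ∧ 1 + 1 / coreWidth ε < K ∧
        (∫ z in upperHalf, ‖strayField (deriv fun t => m t 0) z - (1 / Real.log (1 / coreWidth ε)) •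
          gradient (tailSum (fun n => d n - Real.cos α) a K) z‖ ^ 2) ≤
          C₁ / Real.log (1 / coreWidth ε) ^ 2 ∧
        Real.pi * wallStrength α d / Real.log (1 / coreWidth ε) -
          C₁ / Real.log (1 / coreWidth ε) ^ 2 ≤
          ∫ z in upperHalf \ coreSet a (coreWidth ε),
            ‖strayField (deriv fun t => m t 0) z‖ ^ 2 := by
  have hN1 : (1 : ℝ) ≤ N := by exact_mod_cast hN
  obtain ⟨C, hC, hfull⟩ := exists_bound_integral_tailSum N hR
  obtain ⟨Cc, hCc, hcore⟩ := exists_bound_core_tailSum N hR (128 * N)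
  have hlogN : 0 ≤ Real.log (128 * N) := Real.log_nonneg (by linarith)
  have hpi := Real.pi_pos
  set C' := Real.pi * (4 * N) * Real.log (128 * N) + C with hC'
  have hC'0 : 0 ≤ C' := by positivity
  -- In units of l² the lower bound loses X/2 and 2D, each controlled through D + X/2 ≤ 2C₀ + C',
  -- then C' from the test energy and 2Cc from the cores.
  refine ⟨3 * (2 * C₀ + C') + C' + 2 * Cc, by positivity, ?_⟩
  intro a d ha hd ε hε hδR α m hm hE
  have hδ := coreWidth_pos hε
  have hxL := log_one_div_le hε
  have hδx : coreWidth ε = ε * Real.log (1 / ε) := rfl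
  set δ := coreWidth ε with hδd
  have hL : 0 < Real.log (1 / δ) := Real.log_pos (by rw [lt_div_iff₀ hδ]; linarith [hR.2])
  set L := Real.log (1 / δ) with hLd
  set f := deriv fun t => m t 0 with hf
  have hden : IsDensity f := hm.isDensity
  have hb := ha.mem_Ioo hR.1
  -- The divisor makes the work error Nr·2πZ equal to πδZ/32, which is at most XL/4. It also gives K
  -- = 128N/δ, so Kδ is independent of ε and K exceeds 1 + 1/δ.
  set r := δ / (64 * N) with hr
  have hr0 : 0 < r := by positivity
  set K := 2 / r with hK
  have hKe : K = 128 * N / δ := by rw [hK, hr]; field_simp; norm_num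
  have hKδ : K * δ = 128 * N := by rw [hKe]; field_simp
  have hδ1 : 1 ≤ 1 / δ := by rw [le_div_iff₀ hδ]; linarith [hR.2]
  have hKgt : 1 + 1 / δ < K := by
    have : K = 128 * N * (1 / δ) := by rw [hKe]; ring
    rw [this]
    nlinarith
  have hK1 : 1 ≤ K := by linarith
  have hK0 : 0 < K := by linarith
  have hlogK : Real.log K = L + Real.log (128 * N) := by
    rw [hKe, div_eq_mul_one_div, Real.log_mul (by positivity) (by positivity), add_comm]
  set γ : Fin N → ℝ := fun n => d n - Real.cos α with hγ
  have hγ2 := hd.abs_sub_cos_le α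
  set G := gradient (tailSum γ a K) with hG
  set V := strayField f with hV
  have hVm : MemLp V 2 (volume.restrict upperHalf) := by
    have := memLp_layerField hden
    rw [layerField_zero] at this
    exact this.restrict _
  have hGm : MemLp G 2 (volume.restrict upperHalf) := memLp_gradient_tailSum hK0 hb γ
  set A := ∫ z in upperHalf, ‖V z‖ ^ 2 with hA
  set P := ∫ z in upperHalf, inner ℝ (V z) (G z) with hP
  set Q := ∫ z in upperHalf, ‖G z‖ ^ 2 with hQ
  set Γ := wallStrength α d with hΓ
  set l := 1 / L with hl
  have hl0 : 0 < l := by positivity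
  have hlL : l * L = 1 := by rw [hl]; field_simp
  set D := ∫ z in upperHalf, ‖V z - l • G z‖ ^ 2 with hD
  have hDe : D = A - 2 * l * P + l ^ 2 * Q := integral_norm_sub_smul_sq hVm hGm l
  have hD0 : 0 ≤ D := integral_nonneg fun z => sq_nonneg _
  set X := ε * exchange m with hX
  have hZ := exchange_nonneg m
  have hX0 : 0 ≤ X := mul_nonneg hε.1.le hZ
  have hAE : energy ε m = X / 2 + A / 2 := by
    have := hm.setIntegral_norm_gradient_sq (s := halfPlane) le_rfl
    rw [preimage_halfPlane] at this
    rw [energy, this, hX, exchange]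
    ring
  have e1 : Real.pi * Γ / (2 * L) = Real.pi * Γ * l / 2 := by rw [hl]; field_simp
  have e2 : ∀ c, c / L ^ 2 = c * l ^ 2 := fun c => by rw [hl]; field_simp
  have e3 : Real.pi * Γ / L = Real.pi * Γ * l := by rw [hl]; field_simp
  rw [hAE, e1, e2] at hE
  have hPe : |P - Real.pi * Γ| ≤ X * L / 4 := by
    obtain ⟨M, hM, hadm⟩ := isAdmissible_tailSum hK1 hb γ
    have h1 := integral_inner_strayField hM hadm hden.measurable hden.integrableOn
    have h2 := hm.abs_integral_mul_tailSum_sub_le hd hb hr0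
    rw [hP, h1]
    refine h2.trans ?_
    have h3 : (N : ℝ) * (2 * (Real.pi * r * exchange m)) = Real.pi * δ * exchange m / 32 := by
      rw [hr]; field_simp; ring
    rw [h3]
    have h4 : Real.pi * δ ≤ 4 * (ε * (2 * L)) := by
      rw [hδx]
      exact mul_le_mul Real.pi_le_four (mul_le_mul_of_nonneg_left hxL hε.1.le)
        (by rw [← hδx]; exact hδ.le) (by norm_num)
    have h5 := mul_le_mul_of_nonneg_right h4 hZ
    rw [hX]
    linarith
  have hQe : Q ≤ Real.pi * Γ * L + C' := by
    have h1 := hfull a γ ha hγ2 K hK1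
    have h2 : ∑ n, γ n ^ 2 = Γ := rfl
    rw [h2, hlogK] at h1
    have h3 : Real.pi * Γ * Real.log (128 * N) ≤ Real.pi * (4 * N) * Real.log (128 * N) :=
      mul_le_mul_of_nonneg_right (mul_le_mul_of_nonneg_left (hd.wallStrength_le α) hpi.le) hlogN
    rw [hC']
    linarith
  have hlP : Real.pi * Γ * l - X / 4 ≤ l * P := by
    have h1 := mul_le_mul_of_nonneg_left (abs_le.1 hPe).1 hl0.le
    have h2 : l * -(X * L / 4) = -(X / 4) := by linear_combination (-(X / 4)) * hlL
    rw [h2, mul_sub] at h1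
    linarith
  have hlQ : l ^ 2 * Q ≤ Real.pi * Γ * l + C' * l ^ 2 := by
    have h1 := mul_le_mul_of_nonneg_left hQe (sq_nonneg l)
    have h2 : l ^ 2 * (Real.pi * Γ * L + C') = Real.pi * Γ * l + C' * l ^ 2 := by
      linear_combination (Real.pi * Γ * l) * hlL
    rwa [h2] at h1
  -- The terms of order l cancel. The error X/2 from the work is half of the -X that the exchange
  -- energy supplies, and the other half stays on the left to bound X in the lower estimate.
  have hDX : D + X / 2 ≤ (2 * C₀ + C') * l ^ 2 := by linarith
  have hl2 := sq_nonneg l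
  have hCl : 0 ≤ C' * l ^ 2 := mul_nonneg hC'0 hl2
  have hC0l : 0 ≤ C₀ * l ^ 2 := mul_nonneg hC₀.le hl2
  have hCcl : 0 ≤ Cc * l ^ 2 := mul_nonneg hCc hl2
  refine ⟨K, hK0, hKgt, ?_, ?_⟩
  · rw [e2]
    linarith
  · rw [e2, e3]
    have hsub := coreSet_subset a δ
    have hle := Measure.restrict_mono_set (volume : Measure ℂ) hsub
    rw [setIntegral_sdiff (measurableSet_coreSet a δ) hVm.norm.integrable_sq hsub]
    have h1 := integral_norm_sq_le_two_mul (hVm.mono_measure hle) (hGm.mono_measure hle) l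
    have h2 : ∫ z in coreSet a δ, ‖V z - l • G z‖ ^ 2 ≤ D :=
      setIntegral_mono_set (hVm.sub (hGm.const_smul l)).norm.integrable_sq
        (Eventually.of_forall fun z => sq_nonneg _) hsub.eventuallyLE
    have h3 := hcore a γ ha hγ2 K hK1 δ hδ hδR (by rw [hKδ]; linarith) hKδ.le
    have h4 := mul_le_mul_of_nonneg_left h3 (by positivity : 0 ≤ 2 * l ^ 2)
    rw [← hA]
    -- Since D ≥ 0, A ≥ 2lP - l²Q ≥ πΓl - X/2 - C'l²; the core part of ∫|V|² to be subtracted is at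
    -- most 2D + 2Cc l².
    linarith

end

end NeelWall

/-! ### The theorem, transferred back to the Euclidean plane -/

open NeelWall

theorem mainTheorem6 (α : ℝ) (hα : α ∈ Set.Ioo 0 Real.pi) (N : ℕ) (hN : 0 < N)
    (R : ℝ) (hR : R ∈ Set.Ioc (0 : ℝ) (1 / 2)) (C₀ : ℝ) (hC₀ : 0 < C₀) :
    ∃ C₁ : ℝ, 0 < C₁ ∧
      ∀ a d : Fin N → ℝ, NeelWall.IsWallPositions a → R ≤ NeelWall.wallDistance a →
        NeelWall.IsWallSigns d →
      ∀ ε ∈ Set.Ioc (0 : ℝ) (1 / 2), NeelWall.coreWidth ε ≤ R →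
      ∀ m : ℝ → NeelWall.Plane, NeelWall.IsMagnetisation α a d m →
        NeelWall.energy ε m ≤
            Real.pi * NeelWall.wallStrength α d / (2 * Real.log (1 / NeelWall.coreWidth ε)) +
              C₀ / Real.log (1 / NeelWall.coreWidth ε) ^ 2 →
        (MeasureTheory.IntegrableOn
            (fun x => ‖gradient (NeelWall.strayPotential m) x -
              (1 / Real.log (1 / NeelWall.coreWidth ε)) •
                gradient (NeelWall.limitPotential α a d) x‖ ^ 2)
            (NeelWall.perforatedHalfPlane a (NeelWall.coreWidth ε)) MeasureTheory.volume ∧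
          ∫ x in NeelWall.perforatedHalfPlane a (NeelWall.coreWidth ε),
              ‖gradient (NeelWall.strayPotential m) x -
                (1 / Real.log (1 / NeelWall.coreWidth ε)) •
                  gradient (NeelWall.limitPotential α a d) x‖ ^ 2 ≤
            C₁ / Real.log (1 / NeelWall.coreWidth ε) ^ 2) ∧
        Real.pi * NeelWall.wallStrength α d / Real.log (1 / NeelWall.coreWidth ε) -
            C₁ / Real.log (1 / NeelWall.coreWidth ε) ^ 2 ≤
          ∫ x in NeelWall.perforatedHalfPlane a (NeelWall.coreWidth ε),
            ‖gradient (NeelWall.strayPotential m) x‖ ^ 2 := by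
  obtain ⟨C₁, hC₁, hmain⟩ := exists_bound_strayField N hN hR hC₀
  refine ⟨C₁, hC₁, fun a d ha hρ hd ε hε hδR m hm hE => ?_⟩
  have hsep := ha.isSeparated hρ
  have hδ := coreWidth_pos hε
  obtain ⟨K, hK0, hK, h1, h2⟩ := hmain a d hsep hd ε hε hδR α m hm hE
  set δ := coreWidth ε
  set l := 1 / Real.log (1 / δ)
  set V := strayField (deriv fun t => m t 0)
  set G := gradient (tailSum (fun n => d n - Real.cos α) a K)
  have hb := hsep.mem_Ioo hR.1
  have hVm : MemLp V 2 (volume.restrict upperHalf) := by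
    have := memLp_layerField hm.isDensity
    rw [layerField_zero] at this
    exact this.restrict _
  have hGm : MemLp G 2 (volume.restrict upperHalf) := memLp_gradient_tailSum hK0 hb _
  have hint := (hVm.sub (hGm.const_smul l)).norm.integrable_sq
  have hsub : perforatedHalfPlane a δ ⊆ halfPlane := Set.sdiff_subset
  have hpre := preimage_perforatedHalfPlane a δ
  have hms : MeasurableSet (upperHalf \ coreSet a δ) :=
    measurableSet_upperHalf.diff (measurableSet_coreSet a δ)
  -- Outside the δ-balls every truncation is inactive, so the gradient of the limiting potential is
  -- that of the test function. Both integrability and the bound are then inherited from the whole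
  -- half-plane.
  have hae : (fun x => ‖gradient (strayPotential m) x - l • gradient (limitPotential α a d) x‖ ^ 2)
      =ᵐ[volume.restrict (perforatedHalfPlane a δ)]
      fun x => ‖V (toPlane.symm x) - l • G (toPlane.symm x)‖ ^ 2 := by
    have hmp : MeasurableSet (perforatedHalfPlane a δ) :=
      isOpen_halfPlane.measurableSet.diff (MeasurableSet.iUnion fun n => measurableSet_ball)
    filter_upwards [ae_mono (Measure.restrict_mono_set _ hsub) hm.gradient_strayPotential_ae,
      ae_restrict_mem hmp] with x hx hxm
    obtain ⟨z, rfl⟩ := toPlane.surjective x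
    have hz : z ∈ upperHalf \ coreSet a δ := hpre ▸ hxm
    have hg := (hasGradientAt_limit hb (fun n => d n - Real.cos α) hK0 hδ hK hz.1 hz.2).gradient
    rw [hx, gradient_toPlane]
    simp only [limitPotential_toPlane, LinearIsometryEquiv.symm_apply_apply]
    rw [hg, ← LinearIsometryEquiv.map_smul, ← map_sub, LinearIsometryEquiv.norm_map]
  refine ⟨⟨?_, ?_⟩, ?_⟩
  · rw [IntegrableOn, integrable_congr hae]
    refine (integrableOn_toPlane (g := fun x => ‖V (toPlane.symm x) - l • G (toPlane.symm x)‖ ^ 2)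
      (s := perforatedHalfPlane a δ)).2 ?_
    rw [hpre]
    simp only [LinearIsometryEquiv.symm_apply_apply]
    exact hint.mono_measure (Measure.restrict_mono_set _ Set.sdiff_subset)
  · rw [integral_congr_ae hae, setIntegral_toPlane, hpre]
    simp only [LinearIsometryEquiv.symm_apply_apply]
    refine le_trans ?_ h1
    exact setIntegral_mono_set hint (Filter.Eventually.of_forall fun z => sq_nonneg _)
      (Set.sdiff_subset.eventuallyLE)
  · rw [hm.setIntegral_norm_gradient_sq hsub, hpre]
    exact h2
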